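/- Let $\overline{\mathbb R}=[-\infty,\infty]$ with its usual compact topology. Let $\mathcal B_c(\overline{\mathbb R}^2)$ be the space of continuous functions $F:\overline{\mathbb R}^2\to\mathbb R$ with $F(-\infty,s)=F(s,-\infty)=0$ for all $s\in\overline{\mathbb R}$, with the norm $\|F\|_\infty$. Let $\mathcal A_c(\mathbb R^2)$ be the set of distributions $T\in\mathcal D'(\mathbb R^2)$ such that $T=\partial_{12}F$ for some $F\in\mathcal B_c(\overline{\mathbb R}^2)$, where $\langle\partial_{12}F,\varphi\rangle=\int_{\mathbb R^2}F\,\partial_{12}\varphi$. This $F$ is unique; it is called the primitive of $T$. Put $\|T\|=\|F\|_\infty$ and, for $a\le b$ and $c\le d$ in $\overline{\mathbb R}$, $\int_a^b\int_c^d T=F(a,c)+F(b,d)-F(a,d)-F(b,c)$. A step function is a function $\sigma=\sum_{i,j=1}^n\sigma_{ij}\chi_{(p_{i-1},p_i]\times(p_{j-1},p_j]}$ on $\overline{\mathbb R}^2$ with $-\infty=p_0<p_1<\dots<p_n=\infty$ and $\sigma_{ij}\in\mathbb R$. For $z>0$ let $\Phi_z(x,y)=z(x^2+y^2+z^2)^{-3/2}/(2\pi)$.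 (a) For every $F\in\mathcal B_c(\overline{\mathbb R}^2)$ and $\epsilon>0$ there is a step function $\sigma$ with $|F-\sigma|<\epsilon$ on $\overline{\mathbb R}^2$. (b) $\mathcal B_c(\overline{\mathbb R}^2)$ and $\mathcal A_c(\mathbb R^2)$ are separable. (c) The functions $U\in\mathcal B_c(\overline{\mathbb R}^2)$ that are real analytic on $\mathbb R^2$ and agree there with $\sigma*\Phi_z$ for some step function $\sigma$ and some $z>0$ are dense in $\mathcal B_c(\overline{\mathbb R}^2)$. The distributions in $\mathcal A_c(\mathbb R^2)$ that are given by a real analytic function $g$ on $\mathbb R^2$ (that is, $\varphi\mapsto\int g\varphi$) and are of the form $\partial_{12}U$, where $U\in\mathcal B_c(\overline{\mathbb R}^2)$ agrees on $\mathbb R^2$ with some $\sigma*\Phi_z$ as above, are dense in $\mathcal A_c(\mathbb R^2)$. In particular, real analytic functions are dense in both spaces. (d) Let $f:\mathbb R^2\to\mathbb R$ be Lebesgue integrable, or Henstock–Kurzweil integrable over $\overline{\mathbb R}^2$, or Denjoy integrable over $\overline{\mathbb R}^2$. Then $f\in\mathcal A_c(\mathbb R^2)$ and the integrals agree on intervals: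 there is $T\in\mathcal A_c(\mathbb R^2)$ such that for every test function $\varphi\in C_c^\infty(\mathbb R^2)$ the product $f\varphi$ is integrable in the same sense with integral $\langle T,\varphi\rangle$, and for all $a\le b$, $c\le d$ in $\overline{\mathbb R}$ the integral of $f$ over $[a,b]\times[c,d]$ in that sense exists, is unique, and equals $\int_a^b\int_c^dT$. Here a gauge assigns to each point $p\in\overline{\mathbb R}^2$ an open set $\gamma(p)\ni p$, contained in $\mathbb R^2$ if $p\in\mathbb R^2$; a tagged interval $(J,p)$, $p\in J$, is $\gamma$-fine if $J\subseteq\gamma(p)$. The number $A$ is the Henstock–Kurzweil integral of $f$ over $I=[a,b]\times[c,d]$ if for every $\epsilon>0$ there is a gauge $\gamma$ such that $|\sum_i f(p_i)|J_i|-A|<\epsilon$ for every finite division of $I$ into nonoverlapping $\gamma$-fine tagged intervals $(J_i,p_i)$, where terms with $p_i\notin\mathbb R^2$ are $0$. For a function $F$ on $I$ and an interval $J=[a',b']\times[c',d']$ write $F(J)=F(a',c')+F(b',d')-F(a',d')-F(b',c')$. The number $A$ is the Denjoy integral of $f$ over $I$ if $A=F(I)$ for some continuous $F:I\to\mathbb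 R$ such that: (i) $I\cap\mathbb R^2$ is covered by countably many sets $E\subseteq\mathbb R^2$ such that for every $\epsilon>0$ there are $\eta>0$ and a gauge $\gamma$ with $\sum_i|F(J_i)|<\epsilon$ for all finite families of nonoverlapping $\gamma$-fine tagged intervals $J_i\subseteq I$ with tags in $E$ and $\sum_i|J_i|<\eta$; (ii) for every $\epsilon>0$ there is a gauge $\gamma$ with $\sum_i|F(J_i)|<\epsilon$ for all finite families of nonoverlapping $\gamma$-fine tagged intervals $J_i\subseteq I$ with tags in $I\setminus\mathbb R^2$; (iii) for almost every $p\in\mathbb R^2$ in the interior $(a,b)\times(c,d)$, $F(J)/|J|\to f(p)$ as the nondegenerate interval $J\ni p$ shrinks to $p$ with the ratio of its sides bounded. -/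

import Mathlib

noncomputable section

namespace CPI

open MeasureTheory
open scoped Distributions LineDeriv

/-! ### The extended plane and intervals in it -/

/-- The inclusion of the plane into the extended plane `[-∞,∞]²`. -/
def emb (p : ℝ × ℝ) : EReal × EReal := ((p.1 : EReal), (p.2 : EReal))

/-- The copy of `ℝ²` inside `[-∞,∞]²`. -/
def finitePlane : Set (EReal × EReal) := Set.range emb

/-- The closed interval `[a,b] × [c,d]` of the extended plane. -/
def box (a b c d : EReal) : Set (EReal × EReal) := Set.Icc a b ×ˢ Set.Icc c d

/-- The interval function attached to a point function:
`F(a,c) + F(b,d) - F(a,d) - F(b,c)`. -/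
def incr (F : EReal × EReal → ℝ) (a b c d : EReal) : ℝ :=
  F (a, c) + F (b, d) - F (a, d) - F (b, c)

/-! ### Primitives, distributions and the continuous primitive integral -/

/-- Continuous functions on the extended plane vanishing when a coordinate is `-∞`.
As a subspace of `C(EReal × EReal, ℝ)` it carries the uniform norm. -/
def Bc : Submodule ℝ C(EReal × EReal, ℝ) where
  carrier := {F | ∀ s : EReal, F (⊥, s) = 0 ∧ F (s, ⊥) = 0}
  add_mem' := by
    intro F G hF hG s
    simp [(hF s).1, (hF s).2, (hG s).1, (hG s).2]
  zero_mem' := by intro s; simp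
  smul_mem' := by
    intro c F hF s
    simp [(hF s).1, (hF s).2]

/-- Distributions on the plane. -/
abbrev Dist : Type := 𝓓'((⊤ : TopologicalSpace.Opens (ℝ × ℝ)), ℝ)

/-- Test functions on the plane. -/
abbrev Test : Type := 𝓓((⊤ : TopologicalSpace.Opens (ℝ × ℝ)), ℝ)

/-- The distribution `φ ↦ ∫ φ g` defined by a locally integrable function `g` on the plane. -/
def toDist (g : ℝ × ℝ → ℝ) : Dist :=
  ContinuousLinearMap.toUniformConvergenceCLM (RingHom.id ℝ) ℝ _
    (TestFunction.integralAgainstBilinCLM (ContinuousLinearMap.mul ℝ ℝ) volume g)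

theorem toDist_apply {g : ℝ × ℝ → ℝ} (hg : LocallyIntegrable g) (φ : Test) :
    toDist g φ = ∫ p, φ p * g p :=
  TestFunction.integralAgainstBilinCLM_eq_integral (hg.locallyIntegrableOn _)

/-- The distributional derivative `∂₁₂ F = ∂²F/∂x∂y` of a function continuous on the
extended plane. -/
def d12 (F : C(EReal × EReal, ℝ)) : Dist :=
  ∂_{((1 : ℝ), (0 : ℝ))} (∂_{((0 : ℝ), (1 : ℝ))} (toDist fun p => F (emb p)))

/-- The action of `∂₁₂ F` on a test function: `⟨∂₁₂ F, φ⟩ = ∫ F ∂₁₂ φ`. -/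
theorem d12_apply (F : C(EReal × EReal, ℝ)) (φ : Test) :
    d12 F φ = ∫ p, (∂_{((0 : ℝ), (1 : ℝ))} (∂_{((1 : ℝ), (0 : ℝ))} φ) : Test) p * F (emb p) := by
  have hc : Continuous fun p : ℝ × ℝ => F (emb p) :=
    F.continuous.comp ((continuous_coe_real_ereal.comp continuous_fst).prodMk
      (continuous_coe_real_ereal.comp continuous_snd))
  unfold d12
  rw [Distribution.lineDerivOp_apply_apply, Distribution.lineDerivOp_apply_apply,
    LineDeriv.lineDerivOp_neg, neg_neg, toDist_apply hc.locallyIntegrable]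

/-- The integrable distributions: those of the form `∂₁₂ F` with `F ∈ Bc`. -/
def Ac : Set Dist := {T | ∃ F ∈ Bc, d12 F = T}

open Classical in
/-- The primitive in `Bc` of an integrable distribution (it is unique). -/
def primitive (T : Dist) : C(EReal × EReal, ℝ) :=
  if h : T ∈ Ac then h.choose else 0

/-- The Alexiewicz norm of `T ∈ Ac`: the uniform norm of its primitive. -/
def alexNorm (T : Dist) : ℝ := ‖primitive T‖

/-- The continuous primitive integral of `T ∈ Ac` over `[a,b] × [c,d]`. -/
def cpi (T : Dist) (a b c d : EReal) : ℝ := incr (primitive T) a b c d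

/-- Density of a set of distributions in `Ac` for the Alexiewicz norm. -/
def DenseInAc (S : Set Dist) : Prop :=
  ∀ T ∈ Ac, ∀ ε > 0, ∃ U ∈ S, U ∈ Ac ∧ alexNorm (T - U) < ε

/-! ### Step functions and the Poisson kernel -/

/-- Step functions `∑ᵢ ∑ⱼ sᵢⱼ χ_{(pᵢ,pᵢ₊₁] × (pⱼ,pⱼ₊₁]}` on the extended plane, where
`-∞ = p₀ < p₁ < ⋯ < pₙ = ∞`. They vanish when a coordinate is `-∞`. -/
def IsStep (σ : EReal × EReal → ℝ) : Prop :=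
  ∃ (n : ℕ) (p : ℕ → EReal) (s : ℕ → ℕ → ℝ),
    p 0 = ⊥ ∧ p n = ⊤ ∧ (∀ i < n, p i < p (i + 1)) ∧
    ∀ z, σ z = ∑ i ∈ Finset.range n, ∑ j ∈ Finset.range n,
      Set.indicator (Set.Ioc (p i) (p (i + 1)) ×ˢ Set.Ioc (p j) (p (j + 1)))
        (fun _ => s i j) z

/-- The half-space Poisson kernel `Φ_z(x,y) = z (x² + y² + z²)^{-3/2} / (2π)`. -/
def poisson (z : ℝ) (p : ℝ × ℝ) : ℝ :=
  z * (p.1 ^ 2 + p.2 ^ 2 + z ^ 2) ^ (-(3 / 2) : ℝ) / (2 * Real.pi)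

/-- `U`, on the plane, is the convolution `σ ∗ Φ_z` of a step function `σ` with the Poisson
kernel, for some `z > 0`. (If `U` is continuous on the extended plane, its values at infinity
are determined by this.) -/
def IsPoissonSmoothing (U : EReal × EReal → ℝ) : Prop :=
  ∃ σ : EReal × EReal → ℝ, IsStep σ ∧ ∃ z > 0,
    ∀ p : ℝ × ℝ, U (emb p) = ∫ q : ℝ × ℝ, σ (emb (p - q)) * poisson z q

/-! ### Tagged divisions and gauges -/

/-- A closed interval of the extended plane with a tag in it. -/
structure Cell where
  a : EReal
  b : EReal
  c : EReal
  d : EReal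
  tag : EReal × EReal
  hab : a ≤ b
  hcd : c ≤ d
  tag_mem : tag ∈ box a b c d

/-- The underlying interval. -/
def Cell.set (J : Cell) : Set (EReal × EReal) := box J.a J.b J.c J.d

/-- The area of a bounded interval. (Unbounded intervals only ever occur with a tag at infinity,
where integrands are extended by `0`, so their value here plays no role.) -/
def Cell.area (J : Cell) : ℝ := (J.b.toReal - J.a.toReal) * (J.d.toReal - J.c.toReal)

/-- The increment of `F` over the interval. -/
def Cell.incr (F : EReal × EReal → ℝ) (J : Cell) : ℝ := CPI.incr F J.a J.b J.c J.d

/-- Gauges: each point gets an open neighbourhood, and points of `ℝ²` get one inside `ℝ²`. -/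
def IsGauge (γ : EReal × EReal → Set (EReal × EReal)) : Prop :=
  ∀ p, IsOpen (γ p) ∧ p ∈ γ p ∧ (p ∈ finitePlane → γ p ⊆ finitePlane)

/-- A finite collection of nonoverlapping tagged intervals contained in `I`, each of them inside
the `γ`-neighbourhood of its tag. -/
def IsFinePartialDivision (γ : EReal × EReal → Set (EReal × EReal)) (I : Set (EReal × EReal))
    {n : ℕ} (P : Fin n → Cell) : Prop :=
  (∀ i, (P i).set ⊆ I ∧ (P i).set ⊆ γ (P i).tag) ∧
  ∀ i j, i ≠ j → Disjoint
    (Set.Ioo (P i).a (P i).b ×ˢ Set.Ioo (P i).c (P i).d)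
    (Set.Ioo (P j).a (P j).b ×ˢ Set.Ioo (P j).c (P j).d)

/-- A `γ`-fine tagged division of `I`: the intervals moreover cover `I`. -/
def IsFineDivision (γ : EReal × EReal → Set (EReal × EReal)) (I : Set (EReal × EReal))
    {n : ℕ} (P : Fin n → Cell) : Prop :=
  IsFinePartialDivision γ I P ∧ I ⊆ ⋃ i, (P i).set

/-! ### The Henstock–Kurzweil integral -/

open Classical in
/-- The extension of `f` by `0` to the points at infinity. -/
def extendZero (f : ℝ × ℝ → ℝ) (p : EReal × EReal) : ℝ :=
  if p ∈ finitePlane then f (p.1.toReal, p.2.toReal) else 0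

/-- `f` is Henstock–Kurzweil integrable over `[a,b] × [c,d] ⊆ [-∞,∞]²`, with integral `A`. -/
def HasHKIntegral (f : ℝ × ℝ → ℝ) (a b c d : EReal) (A : ℝ) : Prop :=
  ∀ ε > 0, ∃ γ, IsGauge γ ∧ ∀ (n : ℕ) (P : Fin n → Cell), IsFineDivision γ (box a b c d) P →
    |∑ i, extendZero f (P i).tag * (P i).area - A| < ε

/-! ### The Denjoy integral

It is defined descriptively: the primitive is continuous, generalised absolutely continuous, and
its derivative is almost everywhere the integrand. -/

/-- `F` is absolutely continuous (in the generalised sense, with respect to intervals tagged in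
`E` and fine for a gauge) on the set `E ⊆ ℝ²`, relative to `I`. -/
def IsACOn (F : EReal × EReal → ℝ) (I E : Set (EReal × EReal)) : Prop :=
  ∀ ε > 0, ∃ η > 0, ∃ γ, IsGauge γ ∧ ∀ (n : ℕ) (P : Fin n → Cell),
    IsFinePartialDivision γ I P → (∀ i, (P i).tag ∈ E) → ∑ i, (P i).area < η →
      ∑ i, |(P i).incr F| < ε

/-- `F` has negligible variation on the set `E`, relative to `I`. -/
def IsNegligibleOn (F : EReal × EReal → ℝ) (I E : Set (EReal × EReal)) : Prop :=
  ∀ ε > 0, ∃ γ, IsGauge γ ∧ ∀ (n : ℕ) (P : Fin n → Cell),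
    IsFinePartialDivision γ I P → (∀ i, (P i).tag ∈ E) → ∑ i, |(P i).incr F| < ε

/-- Generalised absolute continuity on an interval `I` of the extended plane: the points of
`I` in `ℝ²` are covered by countably many sets on which `F` is absolutely continuous, and `F` has
negligible variation on the part of `I` at infinity, which counts as a null set. -/
def IsACG (F : EReal × EReal → ℝ) (I : Set (EReal × EReal)) : Prop :=
  (∃ E : ℕ → Set (EReal × EReal), I ∩ finitePlane ⊆ ⋃ n, E n ∧
    ∀ n, E n ⊆ finitePlane ∧ IsACOn F I (E n)) ∧
  IsNegligibleOn F I (I \ finitePlane)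

/-- The interval function of `F` has (ordinary) derivative `L` at `p`: the increment of `F` over
`J` divided by the area of `J` tends to `L` as the interval `J ∋ p` shrinks to `p`, the ratio of
its sides staying bounded. -/
def HasIntervalDerivAt (F : EReal × EReal → ℝ) (L : ℝ) (p : ℝ × ℝ) : Prop :=
  ∀ κ : ℝ, ∀ ε > 0, ∃ δ > 0, ∀ a b c d : ℝ, a < b → c < d →
    p ∈ Set.Icc a b ×ˢ Set.Icc c d → b - a < δ → d - c < δ →
    b - a ≤ κ * (d - c) → d - c ≤ κ * (b - a) →
      |incr F a b c d - L * ((b - a) * (d - c))| ≤ ε * ((b - a) * (d - c))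

/-- `F` is a Denjoy primitive of `f` on `[a,b] × [c,d] ⊆ [-∞,∞]²`. -/
def IsDenjoyPrimitive (f : ℝ × ℝ → ℝ) (a b c d : EReal) (F : EReal × EReal → ℝ) : Prop :=
  ContinuousOn F (box a b c d) ∧ IsACG F (box a b c d) ∧
  ∀ᵐ p : ℝ × ℝ, emb p ∈ Set.Ioo a b ×ˢ Set.Ioo c d → HasIntervalDerivAt F (f p) p

/-- `f` is Denjoy integrable over `[a,b] × [c,d] ⊆ [-∞,∞]²`, with integral `A`. -/
def HasDenjoyIntegral (f : ℝ × ℝ → ℝ) (a b c d : EReal) (A : ℝ) : Prop :=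
  ∃ F, IsDenjoyPrimitive f a b c d F ∧ incr F a b c d = A

end CPI

end

noncomputable section
namespace CPI

open MeasureTheory Set Filter Topology
open scoped Distributions LineDeriv

/-! ### Families of nonoverlapping cells -/

/-! The map F ↦ ∂₁₂F is injective on `Bc`: paired with a smoothed indicator of a rectangle, ∂₁₂F
gives in the limit the increment of F over it, and an F vanishing at -∞ is recovered from its
increments. So ∂₁₂ is an isometry of `Bc` onto `Ac`, and density and separability only have to be
proved in `Bc`. The extended line is order isomorphic to [0,1]; uniform continuity on a grid gives
(a), and second countability of the continuous functions on a compact metrizable space gives (b).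

For (c), a step function that vanishes on the strips of its grid adjacent to -∞ is a combination of
indicators of corners {x > c, y > d} with c, d > -∞. Convolving such an indicator with Φ_z gives a
translate of the cumulative distribution function of Φ_z, which is explicit in arctangents, hence
analytic, and is the primitive of a translate of Φ_z. The kernels Φ_z approximate the identity
uniformly, because translation acts continuously on the functions continuous on the compact extended
plane.

In (d) the Lebesgue case is Fubini. For the other two integrals the core is the primitive of fφ.
Since φ(p) is the integral of ∂₁₂φ(q) over q > p, the primitive of φ ∂₁₂F is z ↦ ∫ ∂₁₂φ(q)
F(min(z,q)) dq (`mulPrim`), whose value at (∞,∞) is ⟨∂₁₂F, φ⟩. Its increment over a cell J is an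
integral over q of increments of F over J truncated at q. A truncated cell may lose its tag, but its
increment is a combination, with coefficients at most 1 in absolute value, of the increments over
four subcells of J that keep the tag (`Cell.exists_truncate`). Hence an estimate valid for every
shrinking of a fine family passes to `mulPrim` with a factor 4∫|∂₁₂φ|. This transfers the
Saks–Henstock inequality, generalised absolute continuity and negligibility at infinity, and, with
an extra argument for thin intervals, the interval derivative.

For the Henstock–Kurzweil integral it remains to produce a continuous primitive: the Cauchy
criterion gives integrals over subboxes, additivity makes them increments of a point function, and
the Saks–Henstock lemma on thin strips gives continuity. For the Denjoy integral it remains to prove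
uniqueness: the difference of two primitives has derivative 0 off a null set, null sets are
negligible by generalised absolute continuity, and a Cousin argument with similar boxes makes the
increments vanish. -/

theorem box_subset_box_iff {a b c d a' b' c' d' : EReal} (hab : a ≤ b) (hcd : c ≤ d) :
    box a b c d ⊆ box a' b' c' d' ↔ (a' ≤ a ∧ b ≤ b') ∧ (c' ≤ c ∧ d ≤ d') := by
  constructor
  · intro h
    have h1 : (a, c) ∈ box a' b' c' d' := h ⟨⟨le_rfl, hab⟩, ⟨le_rfl, hcd⟩⟩
    have h2 : (b, d) ∈ box a' b' c' d' := h ⟨⟨hab, le_rfl⟩, ⟨hcd, le_rfl⟩⟩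
    exact ⟨⟨h1.1.1, h2.1.2⟩, ⟨h1.2.1, h2.2.2⟩⟩
  · rintro ⟨⟨h1, h2⟩, h3, h4⟩
    exact prod_mono (Icc_subset_Icc h1 h2) (Icc_subset_Icc h3 h4)

theorem box_univ : box ⊥ ⊤ ⊥ ⊤ = univ := by
  simp [box]

/-- The open kernel of a cell. -/
def Cell.inside (J : Cell) : Set (EReal × EReal) := Ioo J.a J.b ×ˢ Ioo J.c J.d

theorem Cell.inside_mono {J K : Cell} (h : J.set ⊆ K.set) : J.inside ⊆ K.inside := by
  obtain ⟨⟨h1, h2⟩, h3, h4⟩ := (box_subset_box_iff J.hab J.hcd).1 h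
  exact prod_mono (Ioo_subset_Ioo h1 h2) (Ioo_subset_Ioo h3 h4)

/-- Fine partial divisions indexed by an arbitrary type. -/
def IsPartial (γ : EReal × EReal → Set (EReal × EReal)) (I : Set (EReal × EReal))
    {ι : Type} (P : ι → Cell) : Prop :=
  (∀ i, (P i).set ⊆ I ∧ (P i).set ⊆ γ (P i).tag) ∧
  Pairwise fun i j => Disjoint (P i).inside (P j).inside

/-- Fine divisions indexed by an arbitrary type. -/
def IsDivision (γ : EReal × EReal → Set (EReal × EReal)) (I : Set (EReal × EReal))
    {ι : Type} (P : ι → Cell) : Prop :=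
  IsPartial γ I P ∧ I ⊆ ⋃ i, (P i).set

section families
variable {γ γ' : EReal × EReal → Set (EReal × EReal)} {I I' : Set (EReal × EReal)}
  {ι κ : Type}

theorem isFinePartialDivision_iff {n : ℕ} {P : Fin n → Cell} :
    IsFinePartialDivision γ I P ↔ IsPartial γ I P := Iff.rfl

theorem isFineDivision_iff {n : ℕ} {P : Fin n → Cell} :
    IsFineDivision γ I P ↔ IsDivision γ I P := Iff.rfl

theorem IsPartial.comp {P : ι → Cell} (h : IsPartial γ I P) {e : κ → ι}
    (he : Function.Injective e) : IsPartial γ I (P ∘ e) :=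
  ⟨fun i => h.1 (e i), fun _ _ hij => h.2 (he.ne hij)⟩

theorem IsDivision.comp {P : ι → Cell} (h : IsDivision γ I P) (e : κ ≃ ι) :
    IsDivision γ I (P ∘ e) :=
  ⟨h.1.comp e.injective, by
    rw [show (⋃ i, ((P ∘ e) i).set) = ⋃ i, (P i).set from e.surjective.iUnion_comp fun i => (P i).set]
    exact h.2⟩

theorem IsPartial.mono {P : ι → Cell} (h : IsPartial γ I P) (hI : I ⊆ I')
    (hγ : ∀ p, γ p ⊆ γ' p) : IsPartial γ' I' P :=
  ⟨fun i => ⟨(h.1 i).1.trans hI, (h.1 i).2.trans (hγ _)⟩, h.2⟩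

theorem IsDivision.mono_gauge {P : ι → Cell} (h : IsDivision γ I P)
    (hγ : ∀ p, γ p ⊆ γ' p) : IsDivision γ' I P :=
  ⟨h.1.mono subset_rfl hγ, h.2⟩

theorem IsPartial.shrink {P P' : ι → Cell} (h : IsPartial γ I P)
    (hP : ∀ i, (P' i).tag = (P i).tag ∧ (P' i).set ⊆ (P i).set) : IsPartial γ I P' :=
  ⟨fun i => ⟨(hP i).2.trans (h.1 i).1, by rw [(hP i).1]; exact (hP i).2.trans (h.1 i).2⟩,
    fun _ _ hij => (h.2 hij).mono (Cell.inside_mono (hP _).2) (Cell.inside_mono (hP _).2)⟩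

theorem IsPartial.sumElim {P : ι → Cell} {Q : κ → Cell} (hP : IsPartial γ I P)
    (hQ : IsPartial γ I Q) (hPQ : ∀ i k, Disjoint (P i).inside (Q k).inside) :
    IsPartial γ I (Sum.elim P Q) := by
  refine ⟨?_, ?_⟩
  · rintro (i | k)
    exacts [hP.1 i, hQ.1 k]
  · rintro (i | k) (j | l) hne
    · exact hP.2 fun h => hne (by rw [h])
    · exact hPQ i l
    · exact (hPQ j k).symm
    · exact hQ.2 fun h => hne (by rw [h])

/-- The hypothesis of nonoverlapping boxes, for cells inside them. -/
theorem disjoint_inside_of_split {J K : Cell} {a b c d a' b' c' d' : EReal}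
    (hJ : J.set ⊆ box a b c d) (hK : K.set ⊆ box a' b' c' d') (h : b ≤ a' ∨ d ≤ c') :
    Disjoint J.inside K.inside := by
  obtain ⟨⟨h1, h2⟩, h3, h4⟩ := (box_subset_box_iff J.hab J.hcd).1 hJ
  obtain ⟨⟨h5, h6⟩, h7, h8⟩ := (box_subset_box_iff K.hab K.hcd).1 hK
  rw [Set.disjoint_left]
  rintro ⟨x, y⟩ ⟨⟨hx1, hx2⟩, hy1, hy2⟩ ⟨⟨hx3, hx4⟩, hy3, hy4⟩
  dsimp only at *
  rcases h with h | h
  · exact absurd (hx2.trans_le (h2.trans (h.trans h5))) hx3.not_gt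
  · exact absurd (hy2.trans_le (h4.trans (h.trans h7))) hy3.not_gt

end families

/-! ### Gauges -/

theorem IsGauge.inter {γ γ' : EReal × EReal → Set (EReal × EReal)} (h : IsGauge γ)
    (h' : IsGauge γ') : IsGauge fun p => γ p ∩ γ' p := fun p =>
  ⟨(h p).1.inter (h' p).1, ⟨(h p).2.1, (h' p).2.1⟩, fun hp => inter_subset_left.trans ((h p).2.2 hp)⟩

theorem isOpen_finitePlane : IsOpen finitePlane := by
  have : finitePlane = Ioo (⊥ : EReal) ⊤ ×ˢ Ioo (⊥ : EReal) ⊤ := by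
    ext ⟨x, y⟩
    simp only [finitePlane, emb, mem_range, Prod.exists, Prod.mk.injEq, mem_prod, mem_Ioo]
    constructor
    · rintro ⟨a, b, rfl, rfl⟩
      exact ⟨⟨EReal.bot_lt_coe _, EReal.coe_lt_top _⟩, EReal.bot_lt_coe _, EReal.coe_lt_top _⟩
    · rintro ⟨⟨h1, h2⟩, h3, h4⟩
      exact ⟨x.toReal, y.toReal, EReal.coe_toReal h2.ne h1.ne', EReal.coe_toReal h4.ne h3.ne'⟩
  rw [this]
  exact isOpen_Ioo.prod isOpen_Ioo

open Classical in
/-- The largest gauge. -/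
def topGauge (p : EReal × EReal) : Set (EReal × EReal) := if p ∈ finitePlane then finitePlane else univ

theorem isGauge_topGauge : IsGauge topGauge := by
  intro p
  unfold topGauge
  split_ifs with h
  · exact ⟨isOpen_finitePlane, h, fun _ => subset_rfl⟩
  · exact ⟨isOpen_univ, mem_univ _, fun h' => absurd h' h⟩

theorem IsGauge.of_open {U : EReal × EReal → Set (EReal × EReal)} (hU : ∀ p, IsOpen (U p))
    (hp : ∀ p, p ∈ U p) : IsGauge fun p => U p ∩ topGauge p := fun p =>
  ⟨(hU p).inter (isGauge_topGauge p).1, ⟨hp p, (isGauge_topGauge p).2.1⟩,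
    fun h => inter_subset_right.trans ((isGauge_topGauge p).2.2 h)⟩

/-- A cell contained in the plane has real endpoints. -/
theorem Cell.exists_real {J : Cell} (h : J.set ⊆ finitePlane) :
    ∃ a b c d : ℝ, J.a = a ∧ J.b = b ∧ J.c = c ∧ J.d = d ∧ a ≤ b ∧ c ≤ d := by
  have h1 : (J.a, J.c) ∈ finitePlane := h ⟨⟨le_rfl, J.hab⟩, ⟨le_rfl, J.hcd⟩⟩
  have h2 : (J.b, J.d) ∈ finitePlane := h ⟨⟨J.hab, le_rfl⟩, ⟨J.hcd, le_rfl⟩⟩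
  obtain ⟨⟨a, c⟩, h1⟩ := h1
  obtain ⟨⟨b, d⟩, h2⟩ := h2
  simp only [emb, Prod.mk.injEq] at h1 h2
  refine ⟨a, b, c, d, h1.1.symm, h2.1.symm, h1.2.symm, h2.2.symm, ?_, ?_⟩
  · have := J.hab; rw [← h1.1, ← h2.1] at this; exact_mod_cast this
  · have := J.hcd; rw [← h1.2, ← h2.2] at this; exact_mod_cast this

/-! ### Cousin's lemma -/

/-- Cousin's principle on the extended line, with a local hypothesis at endpoints only. -/
theorem cousin_line {P : EReal → EReal → Prop}
    (hadd : ∀ a m b, a ≤ m → m ≤ b → P a m → P m b → P a b)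
    (hloc : ∀ t, ∃ U ∈ 𝓝 t, ∀ a b, a ≤ b → Icc a b ⊆ U → (t = a ∨ t = b) → P a b)
    {a b : EReal} (hab : a ≤ b) : P a b := by
  have hrefl : ∀ t, P t t := fun t => by
    obtain ⟨U, hU, h⟩ := hloc t
    exact h t t le_rfl (by simpa using mem_of_mem_nhds hU) (Or.inl rfl)
  set S : Set EReal := {x | a ≤ x ∧ x ≤ b ∧ P a x} with hS
  have haS : a ∈ S := ⟨le_rfl, hab, hrefl a⟩
  set s := sSup S with hs
  have has : a ≤ s := le_sSup haS
  have hsb : s ≤ b := sSup_le fun x hx => hx.2.1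
  obtain ⟨U, hU, h⟩ := hloc s
  have hPs : P a s := by
    rcases has.eq_or_lt with e | hlt
    · rw [← e]; exact hrefl a
    · obtain ⟨l, hl, hlU⟩ := exists_Ioc_subset_of_mem_nhds hU ⟨a, hlt⟩
      obtain ⟨x, hx, hlx⟩ := lt_sSup_iff.1 hl
      have hxs : x ≤ s := le_sSup hx
      exact hadd a x s hx.1 hxs hx.2.2
        (h x s hxs (fun y hy => hlU ⟨hlx.trans_le hy.1, hy.2⟩) (Or.inr rfl))
  rcases hsb.eq_or_lt with e | hlt
  · rw [← e]; exact hPs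
  · exfalso
    obtain ⟨l, hl, hlU⟩ := exists_Ico_subset_of_mem_nhds hU ⟨b, hlt⟩
    obtain ⟨y, hy1, hy2⟩ := exists_between (lt_min hl hlt)
    have hyS : y ∈ S := ⟨has.trans hy1.le, (hy2.trans_le (min_le_right _ _)).le,
      hadd a s y has hy1.le hPs (h s y hy1.le
        (fun z hz => hlU ⟨hz.1, hz.2.trans_lt (hy2.trans_le (min_le_left _ _))⟩) (Or.inl rfl))⟩
    exact (le_sSup hyS).not_gt hy1

/-- Cousin's principle on the extended plane, with a local hypothesis at corners only. -/
theorem cousin_plane {P : EReal → EReal → EReal → EReal → Prop}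
    (haddx : ∀ a m b c d, a ≤ m → m ≤ b → c ≤ d → P a m c d → P m b c d → P a b c d)
    (haddy : ∀ a b c m d, a ≤ b → c ≤ m → m ≤ d → P a b c m → P a b m d → P a b c d)
    (hloc : ∀ p : EReal × EReal, ∃ U ∈ 𝓝 p, ∀ a b c d, a ≤ b → c ≤ d → box a b c d ⊆ U →
      (p.1 = a ∨ p.1 = b) → (p.2 = c ∨ p.2 = d) → P a b c d)
    {a b c d : EReal} (hab : a ≤ b) (hcd : c ≤ d) : P a b c d := by
  -- Cousin's principle in the second variable along the segment {t} × [c, d]: finitely many local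
  -- neighbourhoods intersect to one neighbourhood of t that serves the whole segment. The first
  -- variable is then handled by the line version.
  have key : ∀ t : EReal, ∀ c d, c ≤ d → ∃ U ∈ 𝓝 t, ∀ a b, a ≤ b → Icc a b ⊆ U →
      (t = a ∨ t = b) → P a b c d := by
    intro t c d hcd
    have := cousin_line (P := fun c d => c ≤ d → ∃ U ∈ 𝓝 t, ∀ a b, a ≤ b → Icc a b ⊆ U →
      (t = a ∨ t = b) → P a b c d) ?_ ?_ hcd hcd
    · exact this
    · intro c m d hcm hmd h1 h2 _
      obtain ⟨U, hU, h1⟩ := h1 hcm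
      obtain ⟨V, hV, h2⟩ := h2 hmd
      refine ⟨U ∩ V, inter_mem hU hV, fun a b hab hs ht => ?_⟩
      exact haddy a b c m d hab hcm hmd (h1 a b hab (hs.trans inter_subset_left) ht)
        (h2 a b hab (hs.trans inter_subset_right) ht)
    · intro s
      obtain ⟨U, hU, h⟩ := hloc (t, s)
      obtain ⟨V, hV, W, hW, hVW⟩ := mem_nhds_prod_iff.1 hU
      refine ⟨W, hW, fun c d hcd hs1 hs2 _ => ⟨V, hV, fun a b hab ht1 ht2 => ?_⟩⟩
      exact h a b c d hab hcd ((prod_mono ht1 hs1).trans hVW) ht2 hs2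
  exact cousin_line (P := fun a b => P a b c d)
    (fun a m b h1 h2 h3 h4 => haddx a m b c d h1 h2 hcd h3 h4)
    (fun t => by
      obtain ⟨U, hU, h⟩ := key t c d hcd
      exact ⟨U, hU, h⟩) hab

/-- A nonoverlapping family of boxes can be completed, by fine cells, to a cover. -/
theorem exists_completion {γ : EReal × EReal → Set (EReal × EReal)} (hγ : IsGauge γ)
    {ι : Type} [Finite ι] (B : ι → Cell) {a b c d : EReal} (hab : a ≤ b) (hcd : c ≤ d) :
    ∃ (κ : Type) (_ : Fintype κ) (R : κ → Cell), IsPartial γ (box a b c d) R ∧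
      (∀ k i, Disjoint (R k).inside (B i).inside) ∧
      box a b c d ⊆ (⋃ k, (R k).set) ∪ ⋃ i, (B i).set := by
  refine cousin_plane (P := fun a b c d => ∃ (κ : Type) (_ : Fintype κ) (R : κ → Cell),
      IsPartial γ (box a b c d) R ∧ (∀ k i, Disjoint (R k).inside (B i).inside) ∧
      box a b c d ⊆ (⋃ k, (R k).set) ∪ ⋃ i, (B i).set) ?_ ?_ ?_ hab hcd
  · rintro a m b c d ham hmb hcd ⟨κ, _, R, hR, hB, hc⟩ ⟨κ', _, R', hR', hB', hc'⟩
    have h1 : box a m c d ⊆ box a b c d := prod_mono (Icc_subset_Icc_right hmb) subset_rfl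
    have h2 : box m b c d ⊆ box a b c d := prod_mono (Icc_subset_Icc_left ham) subset_rfl
    refine ⟨κ ⊕ κ', inferInstance, Sum.elim R R', ?_, ?_, ?_⟩
    · refine (hR.mono h1 fun _ => subset_rfl).sumElim (hR'.mono h2 fun _ => subset_rfl) ?_
      exact fun i k => disjoint_inside_of_split (hR.1 i).1 (hR'.1 k).1 (Or.inl le_rfl)
    · rintro (k | k) i
      exacts [hB k i, hB' k i]
    · rw [iUnion_sum]
      rintro ⟨x, y⟩ ⟨hx, hy⟩
      rcases le_total x m with h | h
      · rcases hc ⟨⟨hx.1, h⟩, hy⟩ with h | h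
        exacts [Or.inl (Or.inl h), Or.inr h]
      · rcases hc' ⟨⟨h, hx.2⟩, hy⟩ with h | h
        exacts [Or.inl (Or.inr h), Or.inr h]
  · rintro a b c m d hab hcm hmd ⟨κ, _, R, hR, hB, hc⟩ ⟨κ', _, R', hR', hB', hc'⟩
    have h1 : box a b c m ⊆ box a b c d := prod_mono subset_rfl (Icc_subset_Icc_right hmd)
    have h2 : box a b m d ⊆ box a b c d := prod_mono subset_rfl (Icc_subset_Icc_left hcm)
    refine ⟨κ ⊕ κ', inferInstance, Sum.elim R R', ?_, ?_, ?_⟩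
    · refine (hR.mono h1 fun _ => subset_rfl).sumElim (hR'.mono h2 fun _ => subset_rfl) ?_
      exact fun i k => disjoint_inside_of_split (hR.1 i).1 (hR'.1 k).1 (Or.inr le_rfl)
    · rintro (k | k) i
      exacts [hB k i, hB' k i]
    · rw [iUnion_sum]
      rintro ⟨x, y⟩ ⟨hx, hy⟩
      rcases le_total y m with h | h
      · rcases hc ⟨hx, ⟨hy.1, h⟩⟩ with h | h
        exacts [Or.inl (Or.inl h), Or.inr h]
      · rcases hc' ⟨hx, ⟨h, hy.2⟩⟩ with h | h
        exacts [Or.inl (Or.inr h), Or.inr h]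
  · intro p
    -- The neighbourhood of p avoids every endpoint coordinate of the given cells other than those
    -- of p itself. A small box with corner p is then crossed by no edge of a given cell, so it
    -- either lies in one of them (and nothing has to be added) or meets none of their interiors
    -- (and is itself added, tagged at p).
    set X : Set EReal := (range (fun i => (B i).a) ∪ range (fun i => (B i).b)) \ {p.1} with hX
    set Y : Set EReal := (range (fun i => (B i).c) ∪ range (fun i => (B i).d)) \ {p.2} with hY
    have hXf : X.Finite := ((finite_range _).union (finite_range _)).sdiff
    have hYf : Y.Finite := ((finite_range _).union (finite_range _)).sdiff
    refine ⟨γ p ∩ Xᶜ ×ˢ Yᶜ, inter_mem ((hγ p).1.mem_nhds (hγ p).2.1)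
      (prod_mem_nhds (hXf.isClosed.isOpen_compl.mem_nhds (by simp [hX]))
        (hYf.isClosed.isOpen_compl.mem_nhds (by simp [hY]))), ?_⟩
    intro a b c d hab hcd hs hp1 hp2
    by_cases hcase : ∃ i, box a b c d ⊆ (B i).set
    · obtain ⟨i, hi⟩ := hcase
      exact ⟨Empty, inferInstance, Empty.elim, ⟨fun i => i.elim, fun i => i.elim⟩,
        fun i => i.elim, fun q hq => Or.inr (mem_iUnion.2 ⟨i, hi hq⟩)⟩
    · push Not at hcase
      have hpm : p ∈ box a b c d := by
        refine ⟨?_, ?_⟩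
        · rcases hp1 with h | h <;> rw [h]
          exacts [left_mem_Icc.2 hab, right_mem_Icc.2 hab]
        · rcases hp2 with h | h <;> rw [h]
          exacts [left_mem_Icc.2 hcd, right_mem_Icc.2 hcd]
      refine ⟨Unit, inferInstance, fun _ => ⟨a, b, c, d, p, hab, hcd, hpm⟩,
        ⟨fun _ => ⟨subset_rfl, hs.trans inter_subset_left⟩, fun i j hij => absurd rfl hij⟩,
        fun _ i => ?_, fun q hq => Or.inl (mem_iUnion.2 ⟨(), hq⟩)⟩
      rw [Set.disjoint_left]
      rintro ⟨x, y⟩ ⟨⟨hx1, hx2⟩, hy1, hy2⟩ ⟨⟨hx3, hx4⟩, hy3, hy4⟩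
      dsimp only at *
      have hnx : ∀ w, w ∈ range (fun i => (B i).a) ∪ range (fun i => (B i).b) →
          ¬ (a < w ∧ w < b) := by
        rintro w hw ⟨h1, h2⟩
        have h3 : (w, c) ∈ Xᶜ ×ˢ Yᶜ := (hs ⟨⟨h1.le, h2.le⟩, left_mem_Icc.2 hcd⟩).2
        refine h3.1 ⟨hw, ?_⟩
        simp only [mem_singleton_iff]
        rintro rfl
        rcases hp1 with h | h
        exacts [h1.ne' h, h2.ne h]
      have hny : ∀ w, w ∈ range (fun i => (B i).c) ∪ range (fun i => (B i).d) →
          ¬ (c < w ∧ w < d) := by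
        rintro w hw ⟨h1, h2⟩
        have h3 : (a, w) ∈ Xᶜ ×ˢ Yᶜ := (hs ⟨left_mem_Icc.2 hab, ⟨h1.le, h2.le⟩⟩).2
        refine h3.2 ⟨hw, ?_⟩
        simp only [mem_singleton_iff]
        rintro rfl
        rcases hp2 with h | h
        exacts [h1.ne' h, h2.ne h]
      refine hcase i ((box_subset_box_iff hab hcd).2 ⟨⟨?_, ?_⟩, ?_, ?_⟩)
      · by_contra! h
        exact hnx _ (Or.inl ⟨i, rfl⟩) ⟨h, hx3.trans hx2⟩
      · by_contra! h
        exact hnx _ (Or.inr ⟨i, rfl⟩) ⟨hx1.trans hx4, h⟩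
      · by_contra! h
        exact hny _ (Or.inl ⟨i, rfl⟩) ⟨h, hy3.trans hy2⟩
      · by_contra! h
        exact hny _ (Or.inr ⟨i, rfl⟩) ⟨hy1.trans hy4, h⟩

/-- Cousin's lemma. -/
theorem exists_isDivision {γ : EReal × EReal → Set (EReal × EReal)} (hγ : IsGauge γ)
    {a b c d : EReal} (hab : a ≤ b) (hcd : c ≤ d) :
    ∃ (κ : Type) (_ : Fintype κ) (R : κ → Cell), IsDivision γ (box a b c d) R := by
  obtain ⟨κ, hκ, R, hR, -, hc⟩ := exists_completion hγ (Empty.elim : Empty → Cell) hab hcd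
  exact ⟨κ, hκ, R, hR, by simpa using hc⟩

/-! ### Additivity of increments -/

/-- On a finite ordered set every function is a cumulative sum of jumps. In two variables this
replaces F on a finite grid by the distribution function of signed point masses. -/
theorem exists_stepRepr (X : Finset EReal) (g : EReal → ℝ) :
    ∃ m : EReal → ℝ, ∀ x ∈ X, g x = ∑ u ∈ X, if u ≤ x then m u else 0 := by
  induction X using Finset.induction_on_max with
  | empty => exact ⟨0, by simp⟩
  | insert b X hb ih =>
    obtain ⟨m, hm⟩ := ih
    have hbX : b ∉ X := fun h => lt_irrefl _ (hb b h)
    refine ⟨Function.update m b (g b - ∑ u ∈ X, m u), fun x hx => ?_⟩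
    rw [Finset.sum_insert hbX]
    have hne : ∀ u ∈ X, Function.update m b (g b - ∑ u ∈ X, m u) u = m u := fun u hu =>
      Function.update_of_ne (hb u hu).ne _ _
    rcases Finset.mem_insert.1 hx with rfl | hx
    · have hsum : ∑ u ∈ X, (if u ≤ x then Function.update m x (g x - ∑ u ∈ X, m u) u else 0) =
          ∑ u ∈ X, m u := Finset.sum_congr rfl fun u hu => by rw [if_pos (hb u hu).le, hne u hu]
      rw [hsum]
      simp
    · rw [if_neg (hb x hx).not_ge, zero_add, hm x hx]
      exact Finset.sum_congr rfl fun u hu => by rw [hne u hu]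

theorem exists_stepRepr₂ (X Y : Finset EReal) (F : EReal × EReal → ℝ) :
    ∃ m : EReal → EReal → ℝ, ∀ x ∈ X, ∀ y ∈ Y,
      F (x, y) = ∑ u ∈ X, ∑ v ∈ Y, (if u ≤ x then 1 else 0) * (if v ≤ y then 1 else 0) * m u v := by
  choose m₁ h₁ using fun y => exists_stepRepr X fun x => F (x, y)
  choose m h using fun u => exists_stepRepr Y fun y => m₁ y u
  refine ⟨m, fun x hx y hy => ?_⟩
  rw [h₁ y x hx]
  refine Finset.sum_congr rfl fun u _ => ?_
  rw [h u y hy]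
  split_ifs with h <;> simp

open Classical in
theorem ite_le_sub_ite_le {a b u : EReal} (hab : a ≤ b) :
    ((if u ≤ b then 1 else 0) - (if u ≤ a then 1 else 0) : ℝ) = if u ∈ Ioc a b then 1 else 0 := by
  by_cases h1 : u ≤ a
  · simp [h1, h1.trans hab, not_lt.2 h1]
  · by_cases h2 : u ≤ b <;> simp [h1, h2, not_le.1 h1]

/-- A finite set of points of the extended line leaves room below any point but `⊥`. -/
theorem exists_lt_forall_lt (X : Finset EReal) {u : EReal} (hu : ⊥ < u) :
    ∃ u' < u, ∀ x ∈ X, x < u → x < u' := by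
  obtain ⟨u', h1, h2⟩ := exists_between (show ((X.filter (· < u)).sup id) < u from
    (Finset.sup_lt_iff hu).2 fun x hx => (Finset.mem_filter.1 hx).2)
  exact ⟨u', h2, fun x hx hxu =>
    (Finset.le_sup (f := id) (Finset.mem_filter.2 ⟨hx, hxu⟩)).trans_lt h1⟩

/-- On the grid of all endpoints F is the distribution function of point masses at the nodes, and an
increment is the mass of the half-open cell (a, b] × (c, d]. The half-open cells of a division
partition the half-open box, so every mass is counted exactly once. -/
theorem sum_incr_eq {γ : EReal × EReal → Set (EReal × EReal)} {ι : Type} [Fintype ι]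
    {P : ι → Cell} {a b c d : EReal} (hab : a ≤ b) (hcd : c ≤ d)
    (h : IsDivision γ (box a b c d) P) (F : EReal × EReal → ℝ) :
    ∑ i, (P i).incr F = incr F a b c d := by
  classical
  set X : Finset EReal := {a, b} ∪ (Finset.univ.image fun i => (P i).a) ∪
    Finset.univ.image fun i => (P i).b with hX
  set Y : Finset EReal := {c, d} ∪ (Finset.univ.image fun i => (P i).c) ∪
    Finset.univ.image fun i => (P i).d with hY
  have haX : a ∈ X := by simp [hX]
  have hbX : b ∈ X := by simp [hX]
  have hcY : c ∈ Y := by simp [hY]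
  have hdY : d ∈ Y := by simp [hY]
  have hPa : ∀ i, (P i).a ∈ X := fun i => by simp [hX]
  have hPb : ∀ i, (P i).b ∈ X := fun i => by simp [hX]
  have hPc : ∀ i, (P i).c ∈ Y := fun i => by simp [hY]
  have hPd : ∀ i, (P i).d ∈ Y := fun i => by simp [hY]
  obtain ⟨m, hm⟩ := exists_stepRepr₂ X Y F
  have hincr : ∀ a b c d : EReal, a ∈ X → b ∈ X → c ∈ Y → d ∈ Y → a ≤ b → c ≤ d →
      incr F a b c d = ∑ u ∈ X, ∑ v ∈ Y, (if (u, v) ∈ Ioc a b ×ˢ Ioc c d then 1 else 0) * m u v := by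
    intro a b c d ha hb hc hd hab hcd
    rw [incr, hm a ha c hc, hm b hb d hd, hm a ha d hd, hm b hb c hc]
    simp only [← Finset.sum_add_distrib, ← Finset.sum_sub_distrib]
    refine Finset.sum_congr rfl fun u _ => Finset.sum_congr rfl fun v _ => ?_
    have : (if (u, v) ∈ Ioc a b ×ˢ Ioc c d then 1 else 0 : ℝ) =
        ((if u ≤ b then 1 else 0) - (if u ≤ a then 1 else 0)) *
        ((if v ≤ d then 1 else 0) - (if v ≤ c then 1 else 0)) := by
      rw [ite_le_sub_ite_le hab, ite_le_sub_ite_le hcd]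
      by_cases h1 : u ∈ Ioc a b
      · by_cases h2 : v ∈ Ioc c d
        · rw [if_pos h1, if_pos h2, if_pos ⟨h1, h2⟩, mul_one]
        · rw [if_neg h2, if_neg fun h => h2 h.2, mul_zero]
      · rw [if_neg h1, if_neg fun h => h1 h.1, zero_mul]
    rw [this]
    ring
  rw [hincr a b c d haX hbX hcY hdY hab hcd]
  rw [Finset.sum_congr rfl fun i _ => show (P i).incr F = _ from
    hincr _ _ _ _ (hPa i) (hPb i) (hPc i) (hPd i) (P i).hab (P i).hcd]
  rw [Finset.sum_comm]
  refine Finset.sum_congr rfl fun u _ => ?_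
  rw [Finset.sum_comm]
  refine Finset.sum_congr rfl fun v _ => ?_
  rw [← Finset.sum_mul]
  congr 1
  have hsub := fun i => (box_subset_box_iff (P i).hab (P i).hcd).1 (h.1.1 i).1
  by_cases huv : (u, v) ∈ Ioc a b ×ˢ Ioc c d
  · rw [if_pos huv]
    obtain ⟨⟨hau, hub⟩, hcv, hvd⟩ := huv
    dsimp only at hau hub hcv hvd
    -- The node (u, v) is moved down and left by less than the grid spacing, to a point on no grid
    -- line. The half-open cells containing (u, v) are then exactly the cells whose interior
    -- contains (u', v'): covering gives one, nonoverlapping gives at most one.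
    obtain ⟨u', hu', hX'⟩ := exists_lt_forall_lt X (bot_le.trans_lt hau)
    obtain ⟨v', hv', hY'⟩ := exists_lt_forall_lt Y (bot_le.trans_lt hcv)
    have hmem : ∀ i, (u, v) ∈ Ioc (P i).a (P i).b ×ˢ Ioc (P i).c (P i).d →
        (u', v') ∈ (P i).inside := by
      rintro i ⟨⟨h1, h2⟩, h3, h4⟩
      exact ⟨⟨hX' _ (hPa i) h1, hu'.trans_le h2⟩, hY' _ (hPc i) h3, hv'.trans_le h4⟩
    obtain ⟨i, hi⟩ := mem_iUnion.1 (h.2 (show (u', v') ∈ box a b c d from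
      ⟨⟨(hX' a haX hau).le, hu'.le.trans hub⟩, (hY' c hcY hcv).le, hv'.le.trans hvd⟩))
    have hi' : (u, v) ∈ Ioc (P i).a (P i).b ×ˢ Ioc (P i).c (P i).d := by
      obtain ⟨⟨h1, h2⟩, h3, h4⟩ := hi
      refine ⟨⟨h1.trans_lt hu', ?_⟩, h3.trans_lt hv', ?_⟩
      · by_contra! hlt
        exact (hX' _ (hPb i) hlt).not_ge h2
      · by_contra! hlt
        exact (hY' _ (hPd i) hlt).not_ge h4
    rw [Finset.sum_eq_single i, if_pos hi']
    · intro j _ hj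
      rw [if_neg]
      intro hj'
      exact Set.disjoint_left.1 (h.1.2 hj) (hmem j hj') (hmem i hi')
    · simp
  · rw [if_neg huv]
    refine Finset.sum_eq_zero fun i _ => if_neg fun hi => huv ?_
    obtain ⟨⟨h1, h2⟩, h3, h4⟩ := hsub i
    exact ⟨Ioc_subset_Ioc h1 h2 hi.1, Ioc_subset_Ioc h3 h4 hi.2⟩

/-! ### Truncation of cells -/

/-- If the cut u lies at or above the tag t, the truncated interval is a subinterval containing t.
Otherwise its increment is the full one minus that over the part above the cut, and this part
contains t. Either way only subintervals containing the tag occur, as fineness requires. -/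
theorem exists_truncate_line {a b t : EReal} (hat : a ≤ t) (htb : t ≤ b) (u : EReal) :
    ∃ a' b' : EReal, ∃ k l : ℝ, a ≤ a' ∧ a' ≤ t ∧ t ≤ b' ∧ b' ≤ b ∧ |k| ≤ 1 ∧ |l| ≤ 1 ∧
      ∀ g : EReal → ℝ, g (min b u) - g (min a u) = k * (g b - g a) + l * (g b' - g a') := by
  rcases le_or_gt t u with h | h
  · refine ⟨a, min b u, 0, 1, le_rfl, hat, le_min htb h, min_le_left _ _, by simp, by simp, ?_⟩
    intro g
    rw [min_eq_left (hat.trans h)]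
    ring
  · refine ⟨max a u, b, 1, -1, le_max_left _ _, max_le hat h.le, htb, le_rfl, by simp, by simp, ?_⟩
    intro g
    rw [min_eq_right (h.le.trans htb)]
    rcases le_total a u with h' | h'
    · rw [min_eq_left h', max_eq_right h']; ring
    · rw [min_eq_right h', max_eq_left h']; ring

/-- The one-dimensional decomposition in each variable yields four products of intervals, all
containing the tag, with coefficients products of two numbers in [-1, 1]. -/
theorem Cell.exists_truncate (J : Cell) (u v : EReal) :
    ∃ K : Fin 4 → Cell, (∀ j, (K j).tag = J.tag ∧ (K j).set ⊆ J.set) ∧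
      ∀ F : EReal × EReal → ℝ,
        |CPI.incr F (min J.a u) (min J.b u) (min J.c v) (min J.d v)| ≤ ∑ j, |(K j).incr F| := by
  obtain ⟨⟨h1, h2⟩, h3, h4⟩ := J.tag_mem
  obtain ⟨a, b, k, l, ha, hat, htb, hb, hk, hl, hx⟩ := exists_truncate_line h1 h2 u
  obtain ⟨c, d, k', l', hc, hct, htd, hd, hk', hl', hy⟩ := exists_truncate_line h3 h4 v
  refine ⟨![⟨J.a, J.b, J.c, J.d, J.tag, J.hab, J.hcd, J.tag_mem⟩,
    ⟨J.a, J.b, c, d, J.tag, J.hab, hct.trans htd, ⟨⟨h1, h2⟩, hct, htd⟩⟩,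
    ⟨a, b, J.c, J.d, J.tag, hat.trans htb, J.hcd, ⟨⟨hat, htb⟩, h3, h4⟩⟩,
    ⟨a, b, c, d, J.tag, hat.trans htb, hct.trans htd, ⟨⟨hat, htb⟩, hct, htd⟩⟩], ?_, ?_⟩
  · intro j
    fin_cases j
    · exact ⟨rfl, subset_rfl⟩
    · exact ⟨rfl, prod_mono subset_rfl (Icc_subset_Icc hc hd)⟩
    · exact ⟨rfl, prod_mono (Icc_subset_Icc ha hb) subset_rfl⟩
    · exact ⟨rfl, prod_mono (Icc_subset_Icc ha hb) (Icc_subset_Icc hc hd)⟩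
  · intro F
    have key : CPI.incr F (min J.a u) (min J.b u) (min J.c v) (min J.d v) =
        (k * k') * CPI.incr F J.a J.b J.c J.d + (k * l') * CPI.incr F J.a J.b c d +
        (l * k') * CPI.incr F a b J.c J.d + (l * l') * CPI.incr F a b c d := by
      have e := hx fun x => F (x, min J.d v) - F (x, min J.c v)
      have e1 := hy fun y => F (J.b, y) - F (J.a, y)
      have e2 := hy fun y => F (b, y) - F (a, y)
      simp only [CPI.incr]
      linear_combination e + k * e1 + l * e2
    rw [key, Fin.sum_univ_four]
    have hm : ∀ s t r : ℝ, |s| ≤ 1 → |t| ≤ 1 → |s * t * r| ≤ |r| := by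
      intro s t r hs ht
      rw [abs_mul, abs_mul]
      exact mul_le_of_le_one_left (abs_nonneg _) (mul_le_one₀ hs (abs_nonneg _) ht)
    refine (abs_add_le _ _).trans (add_le_add ((abs_add_le _ _).trans (add_le_add
      ((abs_add_le _ _).trans (add_le_add ?_ ?_)) ?_)) ?_)
    exacts [hm _ _ _ hk hk', hm _ _ _ hk hl', hm _ _ _ hl hk', hm _ _ _ hl hl']

/-- Taking the j-th subcell of every cell gives four families, each a shrinking of P with the same
tags, and the hypothesis applies to each. The functions Φ may depend on i so that f(tag)·area - F
can be inserted. -/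
theorem sum_abs_truncate_le {ι : Type} [Fintype ι] {P : ι → Cell}
    {Φ : ι → EReal × EReal → ℝ} {C : ℝ}
    (h : ∀ P' : ι → Cell, (∀ i, (P' i).tag = (P i).tag ∧ (P' i).set ⊆ (P i).set) →
      ∑ i, |(P' i).incr (Φ i)| ≤ C) (u v : EReal) :
    ∑ i, |incr (Φ i) (min (P i).a u) (min (P i).b u) (min (P i).c v) (min (P i).d v)| ≤ 4 * C := by
  choose K hK hle using fun i => (P i).exists_truncate u v
  calc _ ≤ ∑ i, ∑ j, |(K i j).incr (Φ i)| := Finset.sum_le_sum fun i _ => hle i (Φ i)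
    _ = ∑ j, ∑ i, |(K i j).incr (Φ i)| := Finset.sum_comm
    _ ≤ ∑ _j : Fin 4, C := Finset.sum_le_sum fun j _ => h (fun i => K i j) fun i => hK i j
    _ = 4 * C := by simp

/-! ### Test functions -/

theorem lineDeriv_test_apply (φ : Test) (v p : ℝ × ℝ) : (∂_{v} φ : Test) p = lineDeriv ℝ φ p v := by
  rw [TestFunction.lineDerivOp_eq_lineDerivCLM ℝ]
  exact TestFunction.lineDerivCLM_apply_of_le (by simp)
theorem lineDeriv_fst_apply (φ : Test) (x y : ℝ) :
    (∂_{((1 : ℝ), (0 : ℝ))} φ : Test) (x, y) = deriv (fun t => φ (t, y)) x := by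
  rw [lineDeriv_test_apply, lineDeriv]
  have := deriv_comp_const_add (fun t => φ (t, y)) x 0
  simpa using this
theorem lineDeriv_snd_apply (φ : Test) (x y : ℝ) :
    (∂_{((0 : ℝ), (1 : ℝ))} φ : Test) (x, y) = deriv (fun t => φ (x, t)) y := by
  rw [lineDeriv_test_apply, lineDeriv]
  have := deriv_comp_const_add (fun t => φ (x, t)) y 0
  simpa using this
theorem contDiff_slice_fst (φ : Test) (y : ℝ) : ContDiff ℝ (⊤ : ℕ∞) fun t => φ (t, y) :=
  φ.contDiff.comp (contDiff_id.prodMk contDiff_const)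
theorem contDiff_slice_snd (φ : Test) (x : ℝ) : ContDiff ℝ (⊤ : ℕ∞) fun t => φ (x, t) :=
  φ.contDiff.comp (contDiff_const.prodMk contDiff_id)
theorem hasCompactSupport_slice_fst (φ : Test) (y : ℝ) : HasCompactSupport fun t => φ (t, y) := by
  refine HasCompactSupport.intro (φ.hasCompactSupport.isCompact.image continuous_fst) fun x hx => ?_
  by_contra h
  exact hx ⟨(x, y), subset_tsupport _ h, rfl⟩
theorem hasCompactSupport_slice_snd (φ : Test) (x : ℝ) : HasCompactSupport fun t => φ (x, t) := by
  refine HasCompactSupport.intro (φ.hasCompactSupport.isCompact.image continuous_snd) fun y hy => ?_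
  by_contra h
  exact hy ⟨(x, y), subset_tsupport _ h, rfl⟩

/-- The mixed derivative `∂₁₂ φ`. -/
def mixed (φ : Test) : Test := ∂_{((0 : ℝ), (1 : ℝ))} (∂_{((1 : ℝ), (0 : ℝ))} φ)

theorem integrable_test (φ : Test) : Integrable φ :=
  φ.continuous.integrable_of_hasCompactSupport φ.hasCompactSupport

/-- Each integration up to infinity contributes a minus sign, and the two cancel. The formula makes
φ a superposition of indicators of quadrants, from which all integrations by parts below are derived
by Fubini. -/
theorem integral_mixed (φ : Test) (x y : ℝ) :
    ∫ q in Ioi x ×ˢ Ioi y, mixed φ q = φ (x, y) := by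
  rw [Measure.volume_eq_prod, setIntegral_prod _ (integrable_test _).integrableOn]
  have h1 : ∀ u : ℝ, ∫ v in Ioi y, mixed φ (u, v) = -(∂_{((1 : ℝ), (0 : ℝ))} φ : Test) (u, y) := by
    intro u
    rw [← HasCompactSupport.integral_Ioi_deriv_eq
      ((contDiff_slice_snd (∂_{((1 : ℝ), (0 : ℝ))} φ : Test) u).of_le (by simp))
      (hasCompactSupport_slice_snd _ u)]
    exact integral_congr_ae (ae_of_all _ fun v => lineDeriv_snd_apply _ u v)
  simp_rw [h1, lineDeriv_fst_apply]
  rw [integral_neg, HasCompactSupport.integral_Ioi_deriv_eq ((contDiff_slice_fst φ y).of_le (by simp))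
    (hasCompactSupport_slice_fst φ y), neg_neg]

theorem d12_apply' (F : C(EReal × EReal, ℝ)) (φ : Test) :
    d12 F φ = ∫ p, mixed φ p * F (emb p) := d12_apply F φ

theorem continuous_emb : Continuous emb :=
  (continuous_coe_real_ereal.comp continuous_fst).prodMk
    (continuous_coe_real_ereal.comp continuous_snd)

theorem measurable_emb : Measurable emb := continuous_emb.measurable

theorem integrable_test_mul (φ : Test) {g : ℝ × ℝ → ℝ} (hg : Continuous g) :
    Integrable fun p => φ p * g p :=
  (φ.continuous.mul hg).integrable_of_hasCompactSupport φ.hasCompactSupport.mul_right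

theorem integral_add_sub_sub {α : Type*} [MeasurableSpace α] {μ : Measure α}
    {f₁ f₂ f₃ f₄ : α → ℝ} (h₁ : Integrable f₁ μ) (h₂ : Integrable f₂ μ) (h₃ : Integrable f₃ μ)
    (h₄ : Integrable f₄ μ) : ∫ x, (f₁ x + f₂ x - f₃ x - f₄ x) ∂μ =
      ∫ x, f₁ x ∂μ + ∫ x, f₂ x ∂μ - ∫ x, f₃ x ∂μ - ∫ x, f₄ x ∂μ := by
  rw [integral_sub (f := fun x => f₁ x + f₂ x - f₃ x) ((h₁.add h₂).sub h₃) h₄,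
    integral_sub (f := fun x => f₁ x + f₂ x) (h₁.add h₂) h₃, integral_add h₁ h₂]

theorem d12_sub (F G : C(EReal × EReal, ℝ)) : d12 (F - G) = d12 F - d12 G := by
  ext φ
  rw [show (d12 F - d12 G) φ = d12 F φ - d12 G φ from rfl, d12_apply', d12_apply', d12_apply',
    ← integral_sub (integrable_test_mul _ (g := fun p => F (emb p)) (F.continuous.comp continuous_emb))
      (integrable_test_mul _ (g := fun p => G (emb p)) (G.continuous.comp continuous_emb))]
  exact integral_congr_ae (ae_of_all _ fun p => mul_sub _ _ _)

/-! ### Uniqueness of the primitive -/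

theorem dense_range_coe : DenseRange ((↑) : ℝ → EReal) := by
  refine dense_of_exists_between fun a b hab => ?_
  obtain ⟨x, h1, h2⟩ := EReal.lt_iff_exists_real_btwn.1 hab
  exact ⟨x, mem_range_self x, h1, h2⟩

theorem dense_range_emb : DenseRange emb := dense_range_coe.prodMap dense_range_coe

theorem contDiff_smoothTransition : ContDiff ℝ (⊤ : ℕ∞) Real.smoothTransition :=
  Real.smoothTransition.contDiff

theorem hasDerivAt_smoothTransition (x : ℝ) :
    HasDerivAt Real.smoothTransition (deriv Real.smoothTransition x) x :=
  (contDiff_smoothTransition.differentiable (by simp) x).hasDerivAt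

theorem hasCompactSupport_deriv_smoothTransition :
    HasCompactSupport (deriv Real.smoothTransition) := by
  refine HasCompactSupport.intro (isCompact_Icc (a := (0 : ℝ)) (b := 1)) fun x hx => ?_
  rw [mem_Icc, not_and_or, not_le, not_le] at hx
  rcases hx with h | h
  · have : Real.smoothTransition =ᶠ[𝓝 x] fun _ => 0 :=
      (eventually_lt_nhds h).mono fun y hy => Real.smoothTransition.zero_of_nonpos hy.le
    rw [this.deriv_eq]; simp
  · have : Real.smoothTransition =ᶠ[𝓝 x] fun _ => 1 :=
      (eventually_gt_nhds h).mono fun y hy => Real.smoothTransition.one_of_one_le hy.le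
    rw [this.deriv_eq]; simp

theorem continuous_deriv_smoothTransition : Continuous (deriv Real.smoothTransition) :=
  contDiff_smoothTransition.continuous_deriv (by simp)

theorem integrable_deriv_smoothTransition : Integrable (deriv Real.smoothTransition) :=
  continuous_deriv_smoothTransition.integrable_of_hasCompactSupport
    hasCompactSupport_deriv_smoothTransition

theorem integral_deriv_smoothTransition : ∫ x, deriv Real.smoothTransition x = 1 := by
  have h0 : Tendsto Real.smoothTransition atBot (𝓝 0) :=
    tendsto_const_nhds.congr' ((eventually_le_atBot 0).mono fun x hx =>
      (Real.smoothTransition.zero_of_nonpos hx).symm)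
  have h1 : Tendsto Real.smoothTransition atTop (𝓝 1) :=
    tendsto_const_nhds.congr' ((eventually_ge_atTop 1).mono fun x hx =>
      (Real.smoothTransition.one_of_one_le hx).symm)
  rw [integral_of_hasDerivAt_of_tendsto hasDerivAt_smoothTransition
    integrable_deriv_smoothTransition h0 h1, sub_zero]

/-- A smooth approximation, at scale `1 / k`, of the signed indicator of `(x₀, x₁]`. -/
def plateau (k x₀ x₁ u : ℝ) : ℝ :=
  Real.smoothTransition (k * (u - x₀)) - Real.smoothTransition (k * (u - x₁))

theorem hasDerivAt_plateau (k x₀ x₁ u : ℝ) :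
    HasDerivAt (plateau k x₀ x₁) (k * (deriv Real.smoothTransition (k * (u - x₀)) -
      deriv Real.smoothTransition (k * (u - x₁)))) u := by
  have h : ∀ x, HasDerivAt (fun u => Real.smoothTransition (k * (u - x)))
      (deriv Real.smoothTransition (k * (u - x)) * (k * 1)) u := fun x =>
    (hasDerivAt_smoothTransition _).comp u (((hasDerivAt_id u).sub_const x).const_mul k)
  refine ((h x₀).sub (h x₁)).congr_deriv ?_
  ring

theorem contDiff_plateau (k x₀ x₁ : ℝ) : ContDiff ℝ (⊤ : ℕ∞) (plateau k x₀ x₁) :=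
  (contDiff_smoothTransition.comp (contDiff_const.mul (contDiff_id.sub contDiff_const))).sub
    (contDiff_smoothTransition.comp (contDiff_const.mul (contDiff_id.sub contDiff_const)))

theorem plateau_eq_zero {k x₀ x₁ u : ℝ} (hk : 0 < k)
    (hu : u ∉ Icc (min x₀ x₁) (max x₀ x₁ + 1 / k)) : plateau k x₀ x₁ u = 0 := by
  rw [mem_Icc, not_and_or, not_le, not_le] at hu
  unfold plateau
  rcases hu with h | h
  · rw [Real.smoothTransition.zero_of_nonpos, Real.smoothTransition.zero_of_nonpos, sub_zero]
    · exact mul_nonpos_of_nonneg_of_nonpos hk.le (by linarith [min_le_right x₀ x₁])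
    · exact mul_nonpos_of_nonneg_of_nonpos hk.le (by linarith [min_le_left x₀ x₁])
  · have h1 : ∀ x, x ≤ max x₀ x₁ → 1 ≤ k * (u - x) := fun x hx => by
      have : 1 / k ≤ u - x := by linarith
      rwa [div_le_iff₀' hk] at this
    rw [Real.smoothTransition.one_of_one_le (h1 _ (le_max_left _ _)),
      Real.smoothTransition.one_of_one_le (h1 _ (le_max_right _ _)), sub_self]

/-- The product of two smooth approximations of indicators, as a test function. -/
def plateauTest (k x₀ x₁ y₀ y₁ : ℝ) (hk : 0 < k) : Test where
  toFun p := plateau k x₀ x₁ p.1 * plateau k y₀ y₁ p.2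
  contDiff' := ((contDiff_plateau k x₀ x₁).comp contDiff_fst).mul
    ((contDiff_plateau k y₀ y₁).comp contDiff_snd)
  hasCompactSupport' := by
    refine HasCompactSupport.intro
      ((isCompact_Icc (a := min x₀ x₁) (b := max x₀ x₁ + 1 / k)).prod
        (isCompact_Icc (a := min y₀ y₁) (b := max y₀ y₁ + 1 / k))) fun p hp => ?_
    rw [mem_prod, not_and_or] at hp
    rcases hp with h | h
    · rw [plateau_eq_zero hk h, zero_mul]
    · rw [plateau_eq_zero hk h, mul_zero]
  tsupport_subset' := subset_univ _

theorem mixed_plateauTest {k : ℝ} (hk : 0 < k) (x₀ x₁ y₀ y₁ : ℝ) (p : ℝ × ℝ) :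
    mixed (plateauTest k x₀ x₁ y₀ y₁ hk) p =
      (k * (deriv Real.smoothTransition (k * (p.1 - x₀)) -
        deriv Real.smoothTransition (k * (p.1 - x₁)))) *
      (k * (deriv Real.smoothTransition (k * (p.2 - y₀)) -
        deriv Real.smoothTransition (k * (p.2 - y₁)))) := by
  obtain ⟨x, y⟩ := p
  rw [mixed, lineDeriv_snd_apply]
  have h : ∀ t, (∂_{((1 : ℝ), (0 : ℝ))} (plateauTest k x₀ x₁ y₀ y₁ hk) : Test) (x, t) =
      (k * (deriv Real.smoothTransition (k * (x - x₀)) -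
        deriv Real.smoothTransition (k * (x - x₁)))) * plateau k y₀ y₁ t := fun t => by
    rw [lineDeriv_fst_apply]
    exact ((hasDerivAt_plateau k x₀ x₁ x).mul_const (plateau k y₀ y₁ t)).deriv
  simp_rw [h]
  exact ((hasDerivAt_plateau k y₀ y₁ y).const_mul _).deriv

/-- The derivative of the smooth transition has compact support and integral 1, so its tensor square
is a mollifier; boundedness of F permits dominated convergence. -/
theorem tendsto_integral_mollify (F : C(EReal × EReal, ℝ)) (P : ℝ × ℝ) :
    Tendsto (fun n : ℕ => ∫ r : ℝ × ℝ, deriv Real.smoothTransition r.1 *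
      deriv Real.smoothTransition r.2 * F (emb (P + (n + 1 : ℝ)⁻¹ • r))) atTop (𝓝 (F (emb P))) := by
  have hint : Integrable fun r : ℝ × ℝ => deriv Real.smoothTransition r.1 *
      deriv Real.smoothTransition r.2 :=
    integrable_deriv_smoothTransition.mul_prod integrable_deriv_smoothTransition
  have h1 : F (emb P) = ∫ r : ℝ × ℝ, deriv Real.smoothTransition r.1 *
      deriv Real.smoothTransition r.2 * F (emb P) := by
    rw [integral_mul_const, Measure.volume_eq_prod, integral_prod_mul,
      integral_deriv_smoothTransition]
    simp
  rw [h1]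
  refine tendsto_integral_of_dominated_convergence
    (fun r : ℝ × ℝ => |deriv Real.smoothTransition r.1 * deriv Real.smoothTransition r.2| * ‖F‖)
    (fun n => ?_) (hint.abs.mul_const _) (fun n => ae_of_all _ fun r => ?_)
    (ae_of_all _ fun r => ?_)
  · refine hint.aestronglyMeasurable.mul (Continuous.aestronglyMeasurable ?_)
    exact F.continuous.comp (continuous_emb.comp (by fun_prop))
  · rw [norm_mul, Real.norm_eq_abs]
    exact mul_le_mul_of_nonneg_left (F.norm_coe_le_norm _) (abs_nonneg _)
  · refine Tendsto.const_mul _ ?_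
    have h2 : Tendsto (fun n : ℕ => P + ((n : ℝ) + 1)⁻¹ • r) atTop (𝓝 (P + (0 : ℝ) • r)) :=
      tendsto_const_nhds.add ((tendsto_inv_atTop_zero.comp
        (tendsto_atTop_add_const_right _ 1 tendsto_natCast_atTop_atTop)).smul_const r)
    rw [zero_smul, add_zero] at h2
    exact ((F.continuous.comp continuous_emb).tendsto P).comp h2

theorem integral_scaled (F : C(EReal × EReal, ℝ)) (P : ℝ × ℝ) {k : ℝ} (hk : 0 < k) :
    ∫ q : ℝ × ℝ, deriv Real.smoothTransition (k * (q.1 - P.1)) *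
      deriv Real.smoothTransition (k * (q.2 - P.2)) * F (emb q) =
    (k ^ 2)⁻¹ * ∫ r : ℝ × ℝ, deriv Real.smoothTransition r.1 *
      deriv Real.smoothTransition r.2 * F (emb (P + k⁻¹ • r)) := by
  have h := Measure.integral_comp_smul (volume : Measure (ℝ × ℝ)) (fun r : ℝ × ℝ =>
    deriv Real.smoothTransition r.1 * deriv Real.smoothTransition r.2 *
      F (emb (P + k⁻¹ • r))) k
  rw [← integral_sub_right_eq_self _ P] at h
  rw [Module.finrank_prod, Module.finrank_self, abs_of_nonneg (by positivity), smul_eq_mul] at h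
  rw [← h]
  refine integral_congr_ae (ae_of_all _ fun q => ?_)
  simp only [Prod.smul_fst, Prod.smul_snd, Prod.fst_sub, Prod.snd_sub, smul_eq_mul, smul_smul,
    inv_mul_cancel₀ hk.ne', one_smul, add_sub_cancel]

/-- The mixed derivative of a product of plateaus is a signed sum of four rescaled bumps at the
corners of the rectangle, so pairing it with F gives the increment of a mollified F. Letting the
scale tend to 0 settles real rectangles; density of ℝ in the extended line and continuity settle the
others. -/
theorem incr_eq_zero_of_d12_eq_zero {F : C(EReal × EReal, ℝ)} (h : d12 F = 0) (a b c d : EReal) :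
    incr F a b c d = 0 := by
  have hreal : ∀ x₀ x₁ y₀ y₁ : ℝ, incr F x₀ x₁ y₀ y₁ = 0 := by
    intro x₀ x₁ y₀ y₁
    have hlim := (((tendsto_integral_mollify F (x₀, y₀)).add
      (tendsto_integral_mollify F (x₁, y₁))).sub (tendsto_integral_mollify F (x₀, y₁))).sub
      (tendsto_integral_mollify F (x₁, y₀))
    refine tendsto_nhds_unique (hlim.congr fun n => ?_) tendsto_const_nhds
    have hk : (0 : ℝ) < n + 1 := by positivity
    set k : ℝ := n + 1 with hkdef
    have h1 : d12 F (plateauTest k x₀ x₁ y₀ y₁ hk) = 0 := by rw [h]; rfl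
    rw [d12_apply'] at h1
    have hsupp : ∀ x : ℝ, HasCompactSupport fun u => deriv Real.smoothTransition (k * (u - x)) :=
      fun x => by
        have := hasCompactSupport_deriv_smoothTransition.comp_homeomorph
          ((Homeomorph.subRight x).trans (Homeomorph.mulLeft₀ k hk.ne'))
        exact this
    have hint : ∀ x y : ℝ, Integrable fun q : ℝ × ℝ => deriv Real.smoothTransition (k * (q.1 - x)) *
        deriv Real.smoothTransition (k * (q.2 - y)) * F (emb q) := by
      intro x y
      have hc : ∀ x : ℝ, Continuous fun u => deriv Real.smoothTransition (k * (u - x)) := fun x =>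
        continuous_deriv_smoothTransition.comp (by fun_prop)
      have hi : ∀ x : ℝ, Integrable fun u => deriv Real.smoothTransition (k * (u - x)) := fun x =>
        (hc x).integrable_of_hasCompactSupport (hsupp x)
      exact ((hi x).mul_prod (hi y)).mul_bdd (c := ‖F‖)
        (F.continuous.comp continuous_emb).aestronglyMeasurable
        (ae_of_all _ fun q => F.norm_coe_le_norm _)
    have h2 : ∀ q : ℝ × ℝ, mixed (plateauTest k x₀ x₁ y₀ y₁ hk) q * F (emb q) = k ^ 2 *
        (deriv Real.smoothTransition (k * (q.1 - x₀)) *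
          deriv Real.smoothTransition (k * (q.2 - y₀)) * F (emb q) +
        deriv Real.smoothTransition (k * (q.1 - x₁)) *
          deriv Real.smoothTransition (k * (q.2 - y₁)) * F (emb q) -
        deriv Real.smoothTransition (k * (q.1 - x₀)) *
          deriv Real.smoothTransition (k * (q.2 - y₁)) * F (emb q) -
        deriv Real.smoothTransition (k * (q.1 - x₁)) *
          deriv Real.smoothTransition (k * (q.2 - y₀)) * F (emb q)) := by
      intro q
      rw [mixed_plateauTest]
      ring
    simp_rw [h2] at h1
    rw [integral_const_mul, integral_add_sub_sub (hint _ _) (hint _ _) (hint _ _) (hint _ _),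
      integral_scaled F (x₀, y₀) hk, integral_scaled F (x₁, y₁) hk,
      integral_scaled F (x₀, y₁) hk, integral_scaled F (x₁, y₀) hk, ← mul_add, ← mul_sub, ← mul_sub,
      mul_inv_cancel_left₀ (by positivity)] at h1
    exact h1
  have hcont : Continuous fun z : (EReal × EReal) × EReal × EReal =>
      incr F z.1.1 z.1.2 z.2.1 z.2.2 := by
    unfold incr
    fun_prop
  have hd := (dense_range_coe.prodMap dense_range_coe).prodMap
    (dense_range_coe.prodMap dense_range_coe)
  have := hd.equalizer hcont continuous_const (funext fun z => hreal z.1.1 z.1.2 z.2.1 z.2.2)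
  exact congrFun this ((a, b), c, d)

theorem apply_eq_incr {F : C(EReal × EReal, ℝ)} (hF : F ∈ Bc) (z : EReal × EReal) :
    F z = incr F ⊥ z.1 ⊥ z.2 := by
  rw [incr, (hF ⊥).1, (hF z.2).1, (hF z.1).2]
  simp

theorem d12_injOn : InjOn d12 (Bc : Set C(EReal × EReal, ℝ)) := by
  intro F hF G hG h
  have h0 : d12 (F - G) = 0 := by rw [d12_sub, h, sub_self]
  refine sub_eq_zero.1 (ContinuousMap.ext fun z => ?_)
  rw [apply_eq_incr (Bc.sub_mem hF hG), incr_eq_zero_of_d12_eq_zero h0]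
  rfl

theorem primitive_d12 {F : C(EReal × EReal, ℝ)} (hF : F ∈ Bc) : primitive (d12 F) = F := by
  have h : d12 F ∈ Ac := ⟨F, hF, rfl⟩
  rw [primitive, dif_pos h]
  exact d12_injOn h.choose_spec.1 hF h.choose_spec.2

theorem cpi_d12 {F : C(EReal × EReal, ℝ)} (hF : F ∈ Bc) (a b c d : EReal) :
    cpi (d12 F) a b c d = incr F a b c d := by
  rw [cpi, primitive_d12 hF]

/-- This is the isometry through which density in `Bc` becomes density in `Ac`. -/
theorem alexNorm_d12_sub {F G : C(EReal × EReal, ℝ)} (hF : F ∈ Bc) (hG : G ∈ Bc) :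
    alexNorm (d12 F - d12 G) = ‖F - G‖ := by
  rw [alexNorm, ← d12_sub, primitive_d12 (Bc.sub_mem hF hG)]

/-! ### Primitives of Lebesgue integrable functions -/

/-- The indicator of `r < x`. -/
def chi (x : EReal) (r : ℝ) : ℝ := if (r : EReal) < x then 1 else 0

theorem chi_nonneg (x : EReal) (r : ℝ) : 0 ≤ chi x r := by unfold chi; split_ifs <;> simp

theorem chi_le_one (x : EReal) (r : ℝ) : chi x r ≤ 1 := by unfold chi; split_ifs <;> simp

theorem chi_mono {x y : EReal} (h : x ≤ y) (r : ℝ) : chi x r ≤ chi y r := by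
  unfold chi
  split_ifs with h1 h2
  · exact le_rfl
  · exact absurd (h1.trans_le h) h2
  · exact zero_le_one
  · exact le_rfl

@[simp] theorem chi_bot (r : ℝ) : chi ⊥ r = 0 := by simp [chi]

@[simp] theorem chi_top (r : ℝ) : chi ⊤ r = 1 := by simp [chi]

theorem measurable_chi : Measurable fun q : EReal × ℝ => chi q.1 q.2 :=
  Measurable.ite (measurableSet_lt (measurable_coe_real_ereal.comp measurable_snd) measurable_fst)
    measurable_const measurable_const

theorem continuousAt_chi {x : EReal} {r : ℝ} (h : (r : EReal) ≠ x) :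
    ContinuousAt (fun x => chi x r) x := by
  rcases lt_or_gt_of_ne h with h | h
  · refine (continuousAt_const (y := (1 : ℝ))).congr ((eventually_gt_nhds h).mono fun y hy => ?_)
    simp [chi, hy]
  · refine (continuousAt_const (y := (0 : ℝ))).congr ((eventually_lt_nhds h).mono fun y hy => ?_)
    simp [chi, hy.le.not_gt]

theorem ae_fst_ne (x : EReal) : ∀ᵐ p : ℝ × ℝ, (p.1 : EReal) ≠ x := by
  have h : {p : ℝ × ℝ | ¬ (p.1 : EReal) ≠ x} ⊆ {x.toReal} ×ˢ univ := by
    rintro p hp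
    simp only [ne_eq, not_not, mem_ofPred_eq] at hp
    simp [← hp]
  refine measure_mono_null h ?_
  rw [Measure.volume_eq_prod, Measure.prod_prod]
  simp

theorem ae_snd_ne (x : EReal) : ∀ᵐ p : ℝ × ℝ, (p.2 : EReal) ≠ x := by
  have h : {p : ℝ × ℝ | ¬ (p.2 : EReal) ≠ x} ⊆ univ ×ˢ {x.toReal} := by
    rintro p hp
    simp only [ne_eq, not_not, mem_ofPred_eq] at hp
    simp [← hp]
  refine measure_mono_null h ?_
  rw [Measure.volume_eq_prod, Measure.prod_prod]
  simp

/-- The primitive `(x, y) ↦ ∫_{-∞}^x ∫_{-∞}^y f`. -/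
def lebPrim (f : ℝ × ℝ → ℝ) (z : EReal × EReal) : ℝ :=
  ∫ p : ℝ × ℝ, chi z.1 p.1 * chi z.2 p.2 * f p

theorem measurable_chi_left (x : EReal) : Measurable fun r => chi x r :=
  measurable_chi.comp (measurable_const.prodMk measurable_id)

theorem measurable_chi_mul_chi (z : EReal × EReal) :
    Measurable fun p : ℝ × ℝ => chi z.1 p.1 * chi z.2 p.2 :=
  ((measurable_chi_left z.1).comp measurable_fst).mul ((measurable_chi_left z.2).comp measurable_snd)

theorem abs_chi_mul_chi_le (z : EReal × EReal) (p : ℝ × ℝ) : |chi z.1 p.1 * chi z.2 p.2| ≤ 1 := by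
  rw [abs_of_nonneg (mul_nonneg (chi_nonneg _ _) (chi_nonneg _ _))]
  exact mul_le_one₀ (chi_le_one _ _) (chi_nonneg _ _) (chi_le_one _ _)

theorem integrable_chi_mul {f : ℝ × ℝ → ℝ} (hf : Integrable f) (z : EReal × EReal) :
    Integrable fun p : ℝ × ℝ => chi z.1 p.1 * chi z.2 p.2 * f p :=
  hf.bdd_mul (c := 1) (measurable_chi_mul_chi z).aestronglyMeasurable
    (ae_of_all _ fun p => abs_chi_mul_chi_le z p)

/-- The indicator of a quadrant depends continuously on its vertex except at points of two lines,
which are null; dominated convergence then applies, also at infinite vertices. -/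
theorem continuous_lebPrim {f : ℝ × ℝ → ℝ} (hf : Integrable f) : Continuous (lebPrim f) := by
  refine continuous_iff_continuousAt.2 fun z => ?_
  refine continuousAt_of_dominated (bound := fun p => |f p|)
    (Eventually.of_forall fun w => (integrable_chi_mul hf w).aestronglyMeasurable)
    (Eventually.of_forall fun w => ae_of_all _ fun p => ?_) hf.abs ?_
  · rw [norm_mul, Real.norm_eq_abs, Real.norm_eq_abs]
    exact mul_le_of_le_one_left (abs_nonneg _) (abs_chi_mul_chi_le w p)
  · filter_upwards [ae_fst_ne z.1, ae_snd_ne z.2] with p h1 h2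
    exact ((ContinuousAt.comp (f := Prod.fst) (continuousAt_chi h1) continuousAt_fst).mul
      (ContinuousAt.comp (f := Prod.snd) (continuousAt_chi h2) continuousAt_snd)).mul
      continuousAt_const

/-- `lebPrim f` as a continuous function. -/
def lebC (f : ℝ × ℝ → ℝ) (hf : Integrable f) : C(EReal × EReal, ℝ) := ⟨lebPrim f, continuous_lebPrim hf⟩

theorem lebC_mem_Bc (f : ℝ × ℝ → ℝ) (hf : Integrable f) : lebC f hf ∈ Bc := fun s => by
  simp [lebC, lebPrim]

theorem incr_lebPrim {f : ℝ × ℝ → ℝ} (hf : Integrable f) (a b c d : EReal) :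
    incr (lebPrim f) a b c d =
      ∫ p : ℝ × ℝ, (chi b p.1 - chi a p.1) * (chi d p.2 - chi c p.2) * f p := by
  unfold incr lebPrim
  rw [← integral_add_sub_sub (integrable_chi_mul hf (a, c)) (integrable_chi_mul hf (b, d))
    (integrable_chi_mul hf (a, d)) (integrable_chi_mul hf (b, c))]
  exact integral_congr_ae (ae_of_all _ fun p => by ring)

theorem incr_lebPrim_nonneg {f : ℝ × ℝ → ℝ} (hf : Integrable f) (h0 : ∀ p, 0 ≤ f p)
    {a b c d : EReal} (hab : a ≤ b) (hcd : c ≤ d) : 0 ≤ incr (lebPrim f) a b c d := by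
  rw [incr_lebPrim hf]
  exact integral_nonneg fun p => mul_nonneg (mul_nonneg (sub_nonneg.2 (chi_mono hab _))
    (sub_nonneg.2 (chi_mono hcd _))) (h0 p)

theorem chi_coe_integral (φ : Test) (p : ℝ × ℝ) :
    ∫ q : ℝ × ℝ, mixed φ q * (chi (q.1 : EReal) p.1 * chi (q.2 : EReal) p.2) = φ p := by
  have h := integral_mixed φ p.1 p.2
  rw [← integral_indicator (measurableSet_Ioi.prod measurableSet_Ioi)] at h
  rw [← show φ (p.1, p.2) = φ p from rfl, ← h]
  refine integral_congr_ae (ae_of_all _ fun q => ?_)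
  by_cases h1 : p.1 < q.1 <;> by_cases h2 : p.2 < q.2 <;> simp [chi, indicator, h1, h2]

/-- Fubini: after the interchange, the inner integral of `mixed φ` against the indicator of {p < q}
is φ p. -/
theorem integral_mixed_mul_lebPrim (φ : Test) {f : ℝ × ℝ → ℝ} (hf : Integrable f) :
    ∫ q, mixed φ q * lebPrim f (emb q) = ∫ p, f p * φ p := by
  have hint : Integrable (Function.uncurry fun (q p : ℝ × ℝ) =>
      (chi (q.1 : EReal) p.1 * chi (q.2 : EReal) p.2) * (mixed φ q * f p))
      (volume.prod volume) := by
    refine ((integrable_test (mixed φ)).mul_prod hf).bdd_mul (c := 1)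
      (f := fun z : (ℝ × ℝ) × ℝ × ℝ => chi (z.1.1 : EReal) z.2.1 * chi (z.1.2 : EReal) z.2.2) ?_ ?_
    · refine Measurable.aestronglyMeasurable (Measurable.mul ?_ ?_)
      · exact measurable_chi.comp ((measurable_coe_real_ereal.comp
          (measurable_fst.comp measurable_fst)).prodMk (measurable_fst.comp measurable_snd))
      · exact measurable_chi.comp ((measurable_coe_real_ereal.comp
          (measurable_snd.comp measurable_fst)).prodMk (measurable_snd.comp measurable_snd))
    · exact ae_of_all _ fun z => abs_chi_mul_chi_le (emb z.1) z.2
  calc ∫ q, mixed φ q * lebPrim f (emb q)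
      = ∫ q : ℝ × ℝ, ∫ p : ℝ × ℝ,
          (chi (q.1 : EReal) p.1 * chi (q.2 : EReal) p.2) * (mixed φ q * f p) := by
        refine integral_congr_ae (ae_of_all _ fun q => ?_)
        simp only [lebPrim, ← integral_const_mul, emb]
        exact integral_congr_ae (ae_of_all _ fun p => by ring)
    _ = ∫ p : ℝ × ℝ, ∫ q : ℝ × ℝ,
          (chi (q.1 : EReal) p.1 * chi (q.2 : EReal) p.2) * (mixed φ q * f p) :=
        integral_integral_swap hint
    _ = ∫ p, f p * φ p := by
        refine integral_congr_ae (ae_of_all _ fun p => ?_)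
        simp only
        rw [← chi_coe_integral φ p, ← integral_const_mul]
        exact integral_congr_ae (ae_of_all _ fun q => by ring)

theorem d12_lebC_apply {f : ℝ × ℝ → ℝ} (hf : Integrable f) (φ : Test) :
    d12 (lebC f hf) φ = ∫ p, f p * φ p :=
  (d12_apply' _ φ).trans (integral_mixed_mul_lebPrim φ hf)

theorem d12_lebC {f : ℝ × ℝ → ℝ} (hf : Integrable f) : d12 (lebC f hf) = toDist f := by
  ext φ
  rw [d12_lebC_apply, toDist_apply hf.locallyIntegrable]
  exact integral_congr_ae (ae_of_all _ fun p => mul_comm _ _)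

theorem chi_sub_chi {a b : EReal} (hab : a ≤ b) {r : ℝ} (ha : (r : EReal) ≠ a) (hb : (r : EReal) ≠ b) :
    chi b r - chi a r = (Icc a b).indicator (fun _ => 1) (r : EReal) := by
  rcases lt_or_gt_of_ne ha with h1 | h1
  · simp [chi, h1, h1.trans_le hab, h1.not_ge]
  · rcases lt_or_gt_of_ne hb with h2 | h2
    · simp [chi, h2, h1.not_gt, h1.le, h2.le]
    · simp [chi, h2.not_gt, h1.not_gt, h2.not_ge]

theorem setIntegral_box {f : ℝ × ℝ → ℝ} (hf : Integrable f) {a b c d : EReal} (hab : a ≤ b)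
    (hcd : c ≤ d) : ∫ p in emb ⁻¹' box a b c d, f p = incr (lebPrim f) a b c d := by
  have hm : MeasurableSet (emb ⁻¹' box a b c d) :=
    measurable_emb (measurableSet_Icc.prod measurableSet_Icc)
  rw [incr_lebPrim hf, ← integral_indicator hm]
  refine integral_congr_ae ?_
  filter_upwards [ae_fst_ne a, ae_fst_ne b, ae_snd_ne c, ae_snd_ne d] with p h1 h2 h3 h4
  rw [chi_sub_chi hab h1 h2, chi_sub_chi hcd h3 h4]
  by_cases hx : (p.1 : EReal) ∈ Icc a b
  · by_cases hy : (p.2 : EReal) ∈ Icc c d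
    · rw [indicator_of_mem hx, indicator_of_mem hy,
        indicator_of_mem (show p ∈ emb ⁻¹' box a b c d from ⟨hx, hy⟩)]
      ring
    · rw [indicator_of_notMem hy, indicator_of_notMem fun h : p ∈ emb ⁻¹' box a b c d => hy h.2]
      ring
  · rw [indicator_of_notMem hx, indicator_of_notMem fun h : p ∈ emb ⁻¹' box a b c d => hx h.1]
    ring

theorem lebesgue_cpi {f : ℝ × ℝ → ℝ} (hf : Integrable f) :
    ∃ T ∈ Ac, (∀ φ : Test, T φ = ∫ p, f p * φ p) ∧
      ∀ a b c d : EReal, a ≤ b → c ≤ d → ∫ p in emb ⁻¹' box a b c d, f p = cpi T a b c d := by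
  refine ⟨d12 (lebC f hf), ⟨_, lebC_mem_Bc f hf, rfl⟩, d12_lebC_apply hf, ?_⟩
  intro a b c d hab hcd
  rw [cpi_d12 (lebC_mem_Bc f hf), setIntegral_box hf hab hcd]
  rfl

/-! ### Step functions and separability -/

/-- An order isomorphism of the extended line with [0,1] is a homeomorphism, so Heine–Cantor applies
on the unit square, and the equidistant grid pulled back to the extended line has the required
property. -/
theorem exists_grid (F : C(EReal × EReal, ℝ)) {ε : ℝ} (hε : 0 < ε) :
    ∃ (n : ℕ) (p : ℕ → EReal), p 0 = ⊥ ∧ p n = ⊤ ∧ (∀ i < n, p i < p (i + 1)) ∧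
      ∀ i < n, ∀ j < n, ∀ z ∈ Icc (p i) (p (i + 1)) ×ˢ Icc (p j) (p (j + 1)),
        |F z - F (p i, p j)| < ε := by
  set e : EReal ≃o Icc (0 : ℝ) 1 :=
    EReal.expOrderIso.trans ENNReal.orderIsoUnitIntervalBirational with he
  have hu : UniformContinuous fun w : Icc (0 : ℝ) 1 × Icc (0 : ℝ) 1 =>
      F (e.symm w.1, e.symm w.2) :=
    CompactSpace.uniformContinuous_of_continuous (F.continuous.comp
      ((e.symm.continuous.comp continuous_fst).prodMk (e.symm.continuous.comp continuous_snd)))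
  obtain ⟨δ, hδ, hF⟩ := Metric.uniformContinuous_iff.1 hu ε hε
  obtain ⟨m, hm⟩ := exists_nat_one_div_lt hδ
  set n : ℕ := m + 1 with hn
  have hn0 : (0 : ℝ) < n := by positivity
  have hnδ : 1 / (n : ℝ) < δ := by rw [hn]; exact_mod_cast hm
  set t : ℕ → Icc (0 : ℝ) 1 := fun i => projIcc 0 1 zero_le_one (i / n) with ht
  have htv : ∀ i ≤ n, (t i : ℝ) = i / n := fun i hi => by
    have : (i / n : ℝ) ∈ Icc (0 : ℝ) 1 :=
      ⟨by positivity, by rw [div_le_one hn0]; exact_mod_cast hi⟩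
    rw [ht]; simp only; rw [projIcc_of_mem _ this]
  refine ⟨n, fun i => e.symm (t i), ?_, ?_, ?_, ?_⟩
  · have : t 0 = ⊥ := Subtype.ext (by rw [htv 0 (Nat.zero_le _)]; simp)
    simp only [this]; exact e.symm.map_bot
  · have : t n = ⊤ := Subtype.ext (by rw [htv n le_rfl, div_self hn0.ne']; rfl)
    simp only [this]; exact e.symm.map_top
  · intro i hi
    refine e.symm.strictMono ?_
    rw [← Subtype.coe_lt_coe, htv i hi.le, htv (i + 1) hi]
    push_cast
    gcongr
    linarith
  · intro i hi j hj z hz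
    have hd : ∀ k < n, ∀ x ∈ Icc (e.symm (t k)) (e.symm (t (k + 1))), dist (e x) (t k) < δ := by
      intro k hk x hx
      have h1 : t k ≤ e x := by simpa using e.monotone hx.1
      have h2 : e x ≤ t (k + 1) := by simpa using e.monotone hx.2
      rw [← Subtype.coe_le_coe, htv k hk.le] at h1
      rw [← Subtype.coe_le_coe, htv (k + 1) hk] at h2
      rw [Subtype.dist_eq, Real.dist_eq, htv k hk.le, abs_of_nonneg (by linarith)]
      push_cast at h2
      rw [add_div] at h2
      linarith
    have := @hF (e z.1, e z.2) (t i, t j) (max_lt (hd i hi z.1 hz.1) (hd j hj z.2 hz.2))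
    simpa [Real.dist_eq] using this

theorem exists_mem_Ioc_of_grid {n : ℕ} {p : ℕ → EReal} (h0 : p 0 = ⊥) (hn : p n = ⊤)
    {x : EReal} (hx : ⊥ < x) : ∃ i < n, x ∈ Ioc (p i) (p (i + 1)) := by
  classical
  have hex : ∃ k, x ≤ p k := ⟨n, by rw [hn]; exact le_top⟩
  set k := Nat.find hex with hk
  have hk0 : k ≠ 0 := by
    intro h
    have := Nat.find_spec hex
    rw [← hk, h, h0] at this
    exact hx.not_ge this
  obtain ⟨i, hi⟩ := Nat.exists_eq_succ_of_ne_zero hk0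
  have hin : k ≤ n := Nat.find_min' hex (by rw [hn]; exact le_top)
  refine ⟨i, by omega, ?_, ?_⟩
  · exact not_le.1 (Nat.find_min hex (show i < k by omega))
  · have := Nat.find_spec hex
    rwa [← hk, hi] at this

theorem eq_of_mem_Ioc_of_grid {n : ℕ} {p : ℕ → EReal} (hp : ∀ i < n, p i < p (i + 1))
    {x : EReal} {i j : ℕ} (hi : i < n) (hj : j < n) (hxi : x ∈ Ioc (p i) (p (i + 1)))
    (hxj : x ∈ Ioc (p j) (p (j + 1))) : i = j := by
  have hmono : ∀ k l, k ≤ l → l ≤ n → p k ≤ p l := by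
    intro k l hkl
    induction l, hkl using Nat.le_induction with
    | base => exact fun _ => le_rfl
    | succ l _ ih => exact fun hl => (ih (by omega)).trans (hp l (by omega)).le
  by_contra hne
  rcases Nat.lt_or_gt_of_ne hne with h | h
  · exact (hxj.1.trans_le (hxi.2.trans (hmono _ _ h hj.le))).false
  · exact (hxi.1.trans_le (hxj.2.trans (hmono _ _ h hi.le))).false

/-- The step function with values `s i j` on the cells of a grid. -/
def gridStep (n : ℕ) (p : ℕ → EReal) (s : ℕ → ℕ → ℝ) (z : EReal × EReal) : ℝ :=
  ∑ i ∈ Finset.range n, ∑ j ∈ Finset.range n,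
    Set.indicator (Set.Ioc (p i) (p (i + 1)) ×ˢ Set.Ioc (p j) (p (j + 1))) (fun _ => s i j) z

theorem gridStep_apply {n : ℕ} {p : ℕ → EReal} (hp : ∀ i < n, p i < p (i + 1))
    (s : ℕ → ℕ → ℝ) {z : EReal × EReal} {i j : ℕ} (hi : i < n) (hj : j < n)
    (hz : z ∈ Ioc (p i) (p (i + 1)) ×ˢ Ioc (p j) (p (j + 1))) : gridStep n p s z = s i j := by
  rw [gridStep, Finset.sum_eq_single i, Finset.sum_eq_single j]
  · exact indicator_of_mem hz _
  · intro l hl hne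
    refine indicator_of_notMem (fun h => hne ?_) _
    exact eq_of_mem_Ioc_of_grid hp (Finset.mem_range.1 hl) hj h.2 hz.2
  · exact fun h => absurd (Finset.mem_range.2 hj) h
  · intro k hk hne
    refine Finset.sum_eq_zero fun l _ => indicator_of_notMem (fun h => hne ?_) _
    exact eq_of_mem_Ioc_of_grid hp (Finset.mem_range.1 hk) hi h.1 hz.1
  · exact fun h => absurd (Finset.mem_range.2 hi) h

theorem gridStep_eq_zero {n : ℕ} {p : ℕ → EReal} (s : ℕ → ℕ → ℝ) {z : EReal × EReal}
    (hz : z.1 = ⊥ ∨ z.2 = ⊥) : gridStep n p s z = 0 := by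
  refine Finset.sum_eq_zero fun i _ => Finset.sum_eq_zero fun j _ => indicator_of_notMem ?_ _
  rintro ⟨h1, h2⟩
  rcases hz with h | h
  · rw [h] at h1; exact not_lt_bot h1.1
  · rw [h] at h2; exact not_lt_bot h2.1

/-- Step functions approximating `F`, vanishing on the first strips of the grid. -/
theorem exists_gridStep_near {F : C(EReal × EReal, ℝ)} (hF : F ∈ Bc) {ε : ℝ} (hε : 0 < ε) :
    ∃ (n : ℕ) (p : ℕ → EReal) (s : ℕ → ℕ → ℝ), p 0 = ⊥ ∧ p n = ⊤ ∧ (∀ i < n, p i < p (i + 1)) ∧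
      (∀ i, s 0 i = 0 ∧ s i 0 = 0) ∧ ∀ z, |F z - gridStep n p s z| < ε := by
  obtain ⟨n, p, h0, hn, hp, h⟩ := exists_grid F hε
  -- Sampling at the lower left node makes the values on the first row and column vanish, since p 0
  -- = -∞ and F ∈ `Bc`. Without this the Poisson smoothing would not tend to 0 at -∞.
  refine ⟨n, p, fun i j => F (p i, p j), h0, hn, hp, fun i => ?_, fun z => ?_⟩
  · simp only [h0]
    exact hF (p i)
  · by_cases hz : z.1 = ⊥ ∨ z.2 = ⊥
    · rw [gridStep_eq_zero _ hz]
      have : F z = 0 := by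
        rcases hz with h | h
        · rw [← show (z.1, z.2) = z from rfl, h]; exact (hF _).1
        · rw [← show (z.1, z.2) = z from rfl, h]; exact (hF _).2
      simpa [this] using hε
    · rw [not_or] at hz
      obtain ⟨i, hi, hxi⟩ := exists_mem_Ioc_of_grid h0 hn (bot_lt_iff_ne_bot.2 hz.1)
      obtain ⟨j, hj, hyj⟩ := exists_mem_Ioc_of_grid h0 hn (bot_lt_iff_ne_bot.2 hz.2)
      rw [gridStep_apply hp _ hi hj ⟨hxi, hyj⟩]
      exact h i hi j hj z ⟨Ioc_subset_Icc_self hxi, Ioc_subset_Icc_self hyj⟩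

theorem isStep_gridStep {n : ℕ} {p : ℕ → EReal} (h0 : p 0 = ⊥) (hn : p n = ⊤)
    (hp : ∀ i < n, p i < p (i + 1)) (s : ℕ → ℕ → ℝ) : IsStep (gridStep n p s) :=
  ⟨n, p, s, h0, hn, hp, fun _ => rfl⟩

theorem exists_isStep_near {F : C(EReal × EReal, ℝ)} (hF : F ∈ Bc) {ε : ℝ} (hε : 0 < ε) :
    ∃ σ : EReal × EReal → ℝ, IsStep σ ∧ ∀ p, |F p - σ p| < ε := by
  obtain ⟨n, p, s, h0, hn, hp, -, h⟩ := exists_gridStep_near hF hε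
  exact ⟨_, isStep_gridStep h0 hn hp s, h⟩

theorem secondCountable_Bc : SecondCountableTopology Bc :=
  TopologicalSpace.Subtype.secondCountableTopology _

/-- Images under `∂₁₂` of dense sets are dense. -/
theorem denseInAc_image {S : Set Bc} (hS : Dense S) : DenseInAc ((fun F : Bc => d12 F.1) '' S) := by
  rintro T ⟨F, hF, rfl⟩ ε hε
  obtain ⟨G, hG, hGS⟩ := hS.exists_dist_lt ⟨F, hF⟩ hε
  refine ⟨_, ⟨G, hG, rfl⟩, ⟨G.1, G.2, rfl⟩, ?_⟩
  rw [alexNorm_d12_sub hF G.2, ← dist_eq_norm]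
  exact hGS

theorem exists_countable_denseInAc : ∃ S : Set Dist, S.Countable ∧ S ⊆ Ac ∧ DenseInAc S := by
  have := secondCountable_Bc
  obtain ⟨S, hS, hd⟩ := TopologicalSpace.exists_countable_dense Bc
  refine ⟨_, hS.image _, ?_, denseInAc_image hd⟩
  rintro _ ⟨F, -, rfl⟩
  exact ⟨F.1, F.2, rfl⟩

/-! ### The Poisson kernel and its cumulative distribution -/

theorem poisson_base_pos {z : ℝ} (hz : 0 < z) (p : ℝ × ℝ) : 0 < p.1 ^ 2 + p.2 ^ 2 + z ^ 2 := by
  positivity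

theorem poisson_nonneg {z : ℝ} (hz : 0 < z) (p : ℝ × ℝ) : 0 ≤ poisson z p := by
  have := poisson_base_pos hz p
  unfold poisson
  positivity

theorem poisson_pos {z : ℝ} (hz : 0 < z) (p : ℝ × ℝ) : 0 < poisson z p := by
  have := poisson_base_pos hz p
  unfold poisson
  positivity

theorem contDiff_poisson {z : ℝ} (hz : 0 < z) {n : WithTop ℕ∞} : ContDiff ℝ n (poisson z) := by
  unfold poisson
  refine ContDiff.div_const (contDiff_const.mul ?_) _
  exact ContDiff.rpow_const_of_ne (by fun_prop) fun p => (poisson_base_pos hz p).ne'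

theorem continuous_poisson {z : ℝ} (hz : 0 < z) : Continuous (poisson z) :=
  (contDiff_poisson hz (n := 0)).continuous

theorem poisson_eq {z : ℝ} (hz : 0 < z) (p : ℝ × ℝ) :
    poisson z p = z / (2 * Real.pi) / √(p.1 ^ 2 + p.2 ^ 2 + z ^ 2) ^ 3 := by
  have h := poisson_base_pos hz p
  have h3 : (p.1 ^ 2 + p.2 ^ 2 + z ^ 2) ^ (3 / 2 : ℝ) = √(p.1 ^ 2 + p.2 ^ 2 + z ^ 2) ^ 3 := by
    rw [Real.sqrt_eq_rpow, ← Real.rpow_mul_natCast h.le]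
    norm_num
  rw [poisson, Real.rpow_neg h.le, h3]
  field_simp

theorem integrable_poisson {z : ℝ} (hz : 0 < z) : Integrable (poisson z) := by
  have h0 : Integrable fun p : ℝ × ℝ => (1 + ‖p‖ ^ 2) ^ (-(3 : ℝ) / 2) :=
    integrable_rpow_neg_one_add_norm_sq (by
      rw [Module.finrank_prod, Module.finrank_self]; norm_num)
  -- With this m the base p.1² + p.2² + z² is at least m(1 + ‖p‖²), so the kernel is dominated by a
  -- multiple of (1 + ‖p‖²)^(-3/2), integrable because 3 exceeds the dimension 2.
  set m := min 1 (z ^ 2) with hm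
  have hm0 : 0 < m := by positivity
  refine (h0.const_mul (z * m ^ (-(3 : ℝ) / 2) / (2 * Real.pi))).mono'
    (continuous_poisson hz).aestronglyMeasurable (ae_of_all _ fun p => ?_)
  rw [Real.norm_of_nonneg (poisson_nonneg hz p), poisson, div_mul_eq_mul_div, mul_assoc]
  have hn : ‖p‖ ^ 2 ≤ p.1 ^ 2 + p.2 ^ 2 := by
    rw [Prod.norm_def]
    rcases max_choice ‖p.1‖ ‖p.2‖ with h | h <;> rw [h, Real.norm_eq_abs, sq_abs] <;>
      nlinarith [sq_nonneg p.1, sq_nonneg p.2]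
  have hle : m * (1 + ‖p‖ ^ 2) ≤ p.1 ^ 2 + p.2 ^ 2 + z ^ 2 := by
    have h1 : m ≤ 1 := min_le_left _ _
    have h2 : m ≤ z ^ 2 := min_le_right _ _
    nlinarith [sq_nonneg ‖p‖]
  have hpos : 0 < m * (1 + ‖p‖ ^ 2) := by positivity
  rw [← Real.mul_rpow hm0.le (by positivity), show -(3 : ℝ) / 2 = -(3 / 2) by ring]
  have := Real.rpow_le_rpow_of_nonpos hpos hle (show -(3 / 2 : ℝ) ≤ 0 by norm_num)
  gcongr

theorem hasDerivAt_div_sqrt {w : ℝ} (hw : 0 < w) (u : ℝ) :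
    HasDerivAt (fun u => u / √(u ^ 2 + w)) (w / √(u ^ 2 + w) ^ 3) u := by
  have h0 : 0 < u ^ 2 + w := by positivity
  have hr : 0 < √(u ^ 2 + w) := Real.sqrt_pos.2 h0
  have h1 : HasDerivAt (fun u : ℝ => u ^ 2 + w) (2 * u) u := by
    simpa using (hasDerivAt_pow 2 u).add_const w
  refine ((hasDerivAt_id u).div (h1.sqrt h0.ne') hr.ne').congr_deriv ?_
  have h2 : √(u ^ 2 + w) ^ 2 = u ^ 2 + w := Real.sq_sqrt h0.le
  simp only [id]
  field_simp
  rw [h2]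
  ring

theorem tendsto_div_sqrt_atTop {w : ℝ} (hw : 0 < w) :
    Tendsto (fun u : ℝ => u / √(u ^ 2 + w)) atTop (𝓝 1) := by
  have h1 : Tendsto (fun u : ℝ => √(1 - w / (u ^ 2 + w))) atTop (𝓝 √(1 - 0)) := by
    refine (Real.continuous_sqrt.tendsto _).comp (tendsto_const_nhds.sub ?_)
    exact tendsto_const_nhds.div_atTop
      (tendsto_atTop_add_const_right _ w (tendsto_pow_atTop two_ne_zero))
  rw [sub_zero, Real.sqrt_one] at h1
  refine h1.congr' ((eventually_gt_atTop 0).mono fun u hu => ?_)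
  have h0 : 0 < u ^ 2 + w := by positivity
  rw [show 1 - w / (u ^ 2 + w) = u ^ 2 / (u ^ 2 + w) by field_simp; ring,
    Real.sqrt_div (by positivity), Real.sqrt_sq hu.le]

theorem tendsto_div_sqrt_atBot {w : ℝ} (hw : 0 < w) :
    Tendsto (fun u : ℝ => u / √(u ^ 2 + w)) atBot (𝓝 (-1)) := by
  have h := ((tendsto_div_sqrt_atTop hw).comp tendsto_neg_atBot_atTop).neg
  refine h.congr fun u => ?_
  simp [neg_div]

/-- The cumulative distribution of the Poisson kernel. -/
def poissonCdf (z : ℝ) (p : ℝ × ℝ) : ℝ :=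
  1 / 4 + (Real.arctan (p.1 / z) + Real.arctan (p.2 / z) +
    Real.arctan (p.1 / √(p.1 ^ 2 + (p.2 ^ 2 + z ^ 2)) * (p.2 / z))) / (2 * Real.pi)

theorem contDiff_poissonCdf {z : ℝ} (hz : 0 < z) {n : WithTop ℕ∞} :
    ContDiff ℝ n (poissonCdf z) := by
  unfold poissonCdf
  have h : ∀ p : ℝ × ℝ, 0 < p.1 ^ 2 + (p.2 ^ 2 + z ^ 2) := fun p => by positivity
  refine contDiff_const.add (ContDiff.div_const (((Real.contDiff_arctan.comp
    (contDiff_fst.div_const z)).add (Real.contDiff_arctan.comp (contDiff_snd.div_const z))).add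
    (Real.contDiff_arctan.comp (ContDiff.mul (contDiff_fst.div (ContDiff.sqrt (by fun_prop)
      fun p => (h p).ne') fun p => (Real.sqrt_pos.2 (h p)).ne') (contDiff_snd.div_const z)))) _)

theorem integral_poisson_snd {z : ℝ} (hz : 0 < z) {u : ℝ}
    (hi : Integrable fun v => poisson z (u, v)) (y : ℝ) :
    ∫ v in Iic y, poisson z (u, v) =
      z / (2 * Real.pi) / (u ^ 2 + z ^ 2) * (y / √(y ^ 2 + (u ^ 2 + z ^ 2)) + 1) := by
  have hw : 0 < u ^ 2 + z ^ 2 := by positivity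
  have hd : ∀ v ∈ Iic y, HasDerivAt (fun v => z / (2 * Real.pi) / (u ^ 2 + z ^ 2) *
      (v / √(v ^ 2 + (u ^ 2 + z ^ 2)))) (poisson z (u, v)) v := by
    intro v _
    refine ((hasDerivAt_div_sqrt hw v).const_mul _).congr_deriv ?_
    rw [poisson_eq hz, show u ^ 2 + v ^ 2 + z ^ 2 = v ^ 2 + (u ^ 2 + z ^ 2) by ring]
    field_simp
  rw [integral_Iic_of_hasDerivAt_of_tendsto' hd hi.integrableOn
    ((tendsto_div_sqrt_atBot hw).const_mul _)]
  ring

/-- The derivative is the inner integral found in `integral_poisson_snd`, so the explicit formula is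
an antiderivative for the outer integration. -/
theorem hasDerivAt_poissonCdf {z : ℝ} (hz : 0 < z) (u y : ℝ) :
    HasDerivAt (fun u => poissonCdf z (u, y))
      (z / (2 * Real.pi) / (u ^ 2 + z ^ 2) * (y / √(y ^ 2 + (u ^ 2 + z ^ 2)) + 1)) u := by
  have hw : 0 < y ^ 2 + z ^ 2 := by positivity
  have hd := ((((((hasDerivAt_id u).div_const z).arctan).add_const (Real.arctan (y / z))).add
    ((hasDerivAt_div_sqrt hw u).mul_const (y / z)).arctan).div_const (2 * Real.pi)).const_add (1 / 4)
  refine hd.congr_deriv ?_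
  have h0 : 0 < u ^ 2 + (y ^ 2 + z ^ 2) := by positivity
  rw [show y ^ 2 + (u ^ 2 + z ^ 2) = u ^ 2 + (y ^ 2 + z ^ 2) by ring]
  have hr : 0 < √(u ^ 2 + (y ^ 2 + z ^ 2)) := Real.sqrt_pos.2 h0
  have hsq : √(u ^ 2 + (y ^ 2 + z ^ 2)) ^ 2 = u ^ 2 + (y ^ 2 + z ^ 2) := Real.sq_sqrt h0.le
  set r := √(u ^ 2 + (y ^ 2 + z ^ 2)) with hrdef
  simp only [id]
  have e1 : 1 / (1 + (u / z) ^ 2) * (1 / z) = z / (u ^ 2 + z ^ 2) := by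
    field_simp
    ring
  have e2 : 1 / (1 + (u / r * (y / z)) ^ 2) * ((y ^ 2 + z ^ 2) / r ^ 3 * (y / z)) =
      z / (u ^ 2 + z ^ 2) * (y / r) := by
    -- This rests on the factorisation r²z² + u²y² = (u² + z²)(y² + z²) for r² = u² + y² + z²; one
    -- factor then cancels in the derivative of the arctangent.
    have e3 : 1 + (u / r * (y / z)) ^ 2 = (u ^ 2 + z ^ 2) * (y ^ 2 + z ^ 2) / (r ^ 2 * z ^ 2) := by
      field_simp
      rw [hsq]
      ring
    rw [e3]
    field_simp
  rw [e1, e2]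
  field_simp
  ring

/-- The constant 1/4 is fixed by this limit: the two arctangents of y/z cancel and the remaining
-π/2, divided by 2π, leaves -1/4. -/
theorem tendsto_poissonCdf_atBot {z : ℝ} (hz : 0 < z) (y : ℝ) :
    Tendsto (fun u => poissonCdf z (u, y)) atBot (𝓝 0) := by
  have hw : 0 < y ^ 2 + z ^ 2 := by positivity
  have h1 : Tendsto (fun u : ℝ => Real.arctan (u / z)) atBot (𝓝 (-(Real.pi / 2))) :=
    (Real.tendsto_arctan_atBot.mono_right nhdsWithin_le_nhds).comp
      (tendsto_id.atBot_div_const hz)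
  have h2 : Tendsto (fun u : ℝ => Real.arctan (u / √(u ^ 2 + (y ^ 2 + z ^ 2)) * (y / z))) atBot
      (𝓝 (Real.arctan (-1 * (y / z)))) :=
    (Real.continuous_arctan.tendsto _).comp ((tendsto_div_sqrt_atBot hw).mul_const _)
  have h := (((h1.add_const (Real.arctan (y / z))).add h2).div_const (2 * Real.pi)).const_add (1 / 4)
  have e : 1 / 4 + (-(Real.pi / 2) + Real.arctan (y / z) + Real.arctan (-1 * (y / z))) /
      (2 * Real.pi) = 0 := by
    rw [neg_one_mul, Real.arctan_neg]
    field_simp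
    ring
  rwa [e] at h

/-- Iterated integration with explicit antiderivatives in both variables. Fubini provides the
integrability of the slices for almost every u, which suffices for the outer integral. -/
theorem lebPrim_poisson {z : ℝ} (hz : 0 < z) (p : ℝ × ℝ) :
    lebPrim (poisson z) (emb p) = poissonCdf z p := by
  obtain ⟨x, y⟩ := p
  have hi := integrable_poisson hz
  have h1 : lebPrim (poisson z) (emb (x, y)) = ∫ q in Iic x ×ˢ Iic y, poisson z q := by
    rw [lebPrim, ← integral_indicator (measurableSet_Iic.prod measurableSet_Iic)]
    refine integral_congr_ae ?_
    filter_upwards [ae_fst_ne x, ae_snd_ne y] with q hx hy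
    have hx' : q.1 ≠ x := fun h => hx (by rw [h])
    have hy' : q.2 ≠ y := fun h => hy (by rw [h])
    rcases lt_or_gt_of_ne hx' with h1 | h1 <;> rcases lt_or_gt_of_ne hy' with h2 | h2 <;>
      simp [chi, emb, indicator, Prod.le_def, h1, h2, h1.le, h2.le, h1.not_gt, h2.not_gt,
        h1.not_ge, h2.not_ge]
  have hiv : Integrable (poisson z) (volume.prod volume) := hi
  have hir : Integrable (poisson z) ((volume.restrict (Iic x)).prod (volume.restrict (Iic y))) := by
    rw [Measure.prod_restrict]
    exact hiv.restrict
  have hae : ∀ᵐ u : ℝ, ∫ v in Iic y, poisson z (u, v) =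
      z / (2 * Real.pi) / (u ^ 2 + z ^ 2) * (y / √(y ^ 2 + (u ^ 2 + z ^ 2)) + 1) := by
    filter_upwards [hiv.prod_right_ae] with u hu
    exact integral_poisson_snd hz hu y
  rw [h1, Measure.volume_eq_prod, setIntegral_prod _ hiv.integrableOn,
    integral_congr_ae (ae_restrict_of_ae hae),
    integral_Iic_of_hasDerivAt_of_tendsto' (fun u _ => hasDerivAt_poissonCdf hz u y)
      (hir.integral_prod_left.congr (ae_restrict_of_ae hae)) (tendsto_poissonCdf_atBot hz y), sub_zero]


/-- The total mass is the primitive at (∞, ∞). Continuity of the primitive on the extended plane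
allows x → ∞ and then y → ∞ in the closed form, giving 1/4 + (3π/2)/(2π) = 1. -/
theorem integral_poisson {z : ℝ} (hz : 0 < z) : ∫ p, poisson z p = 1 := by
  have hc := continuous_lebPrim (integrable_poisson hz)
  have h1 : ∀ y : ℝ, lebPrim (poisson z) (⊤, (y : EReal)) =
      1 / 4 + (Real.pi / 2 + Real.arctan (y / z) + Real.arctan (1 * (y / z))) / (2 * Real.pi) := by
    intro y
    have hw : 0 < y ^ 2 + z ^ 2 := by positivity
    have ha : Tendsto (fun u : ℝ => Real.arctan (u / z)) atTop (𝓝 (Real.pi / 2)) :=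
      (Real.tendsto_arctan_atTop.mono_right nhdsWithin_le_nhds).comp
        (tendsto_id.atTop_div_const hz)
    have hb : Tendsto (fun u : ℝ => Real.arctan (u / √(u ^ 2 + (y ^ 2 + z ^ 2)) * (y / z))) atTop
        (𝓝 (Real.arctan (1 * (y / z)))) :=
      (Real.continuous_arctan.tendsto _).comp ((tendsto_div_sqrt_atTop hw).mul_const _)
    have h := (((ha.add_const (Real.arctan (y / z))).add hb).div_const
      (2 * Real.pi)).const_add (1 / 4)
    have h' : Tendsto (fun u : ℝ => lebPrim (poisson z) (emb (u, y))) atTop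
        (𝓝 (lebPrim (poisson z) (⊤, (y : EReal)))) :=
      (hc.tendsto _).comp (EReal.tendsto_coe_atTop.prodMk_nhds tendsto_const_nhds)
    refine tendsto_nhds_unique h' (h.congr fun u => ?_)
    rw [lebPrim_poisson hz]
    rfl
  have ha : Tendsto (fun y : ℝ => Real.arctan (y / z)) atTop (𝓝 (Real.pi / 2)) :=
    (Real.tendsto_arctan_atTop.mono_right nhdsWithin_le_nhds).comp
      (tendsto_id.atTop_div_const hz)
  have h := (((ha.const_add (Real.pi / 2)).add ha).div_const (2 * Real.pi)).const_add (1 / 4)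
  have h' : Tendsto (fun y : ℝ => lebPrim (poisson z) (⊤, (y : EReal))) atTop
      (𝓝 (lebPrim (poisson z) (⊤, ⊤))) :=
    (hc.tendsto _).comp (tendsto_const_nhds.prodMk_nhds EReal.tendsto_coe_atTop)
  have h2 : ∫ p, poisson z p = lebPrim (poisson z) (⊤, ⊤) := by simp [lebPrim]
  rw [h2]
  refine tendsto_nhds_unique h' ((h.congr fun y => ?_).trans (le_of_eq ?_))
  · rw [h1, one_mul]
  · congr 1
    field_simp
    norm_num

/-! ### Poisson smoothings of step functions -/

/-- The convolution `w ∗ Φ_z` is, on the plane, the real analytic primitive of an integrable real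
analytic function. -/
def Smoothable (z : ℝ) (w : EReal × EReal → ℝ) : Prop :=
  ∃ g : ℝ × ℝ → ℝ, Integrable g ∧ ContDiff ℝ ⊤ g ∧ ContDiff ℝ ⊤ (fun p => lebPrim g (emb p)) ∧
    ∀ p, Integrable (fun q : ℝ × ℝ => w (emb (p - q)) * poisson z q) ∧
      lebPrim g (emb p) = ∫ q : ℝ × ℝ, w (emb (p - q)) * poisson z q

theorem lebPrim_add {f g : ℝ × ℝ → ℝ} (hf : Integrable f) (hg : Integrable g) (x : EReal × EReal) :
    lebPrim (fun p => f p + g p) x = lebPrim f x + lebPrim g x := by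
  simp only [lebPrim, mul_add]
  exact integral_add (integrable_chi_mul hf x) (integrable_chi_mul hg x)

theorem lebPrim_const_mul (c : ℝ) (f : ℝ × ℝ → ℝ) (x : EReal × EReal) :
    lebPrim (fun p => c * f p) x = c * lebPrim f x := by
  simp only [lebPrim, ← integral_const_mul]
  exact integral_congr_ae (ae_of_all _ fun p => by ring)

theorem Smoothable.add {z : ℝ} {w w' : EReal × EReal → ℝ} (h : Smoothable z w)
    (h' : Smoothable z w') : Smoothable z fun x => w x + w' x := by
  obtain ⟨g, h1, h2, h3, h4⟩ := h
  obtain ⟨g', h1', h2', h3', h4'⟩ := h'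
  refine ⟨fun p => g p + g' p, h1.add h1', h2.add h2', ?_, fun p => ⟨?_, ?_⟩⟩
  · simp_rw [lebPrim_add h1 h1']
    exact h3.add h3'
  · simp_rw [add_mul]
    exact (h4 p).1.add (h4' p).1
  · simp_rw [add_mul]
    rw [lebPrim_add h1 h1', integral_add (h4 p).1 (h4' p).1, (h4 p).2, (h4' p).2]

theorem Smoothable.const_mul {z : ℝ} {w : EReal × EReal → ℝ} (c : ℝ) (h : Smoothable z w) :
    Smoothable z fun x => c * w x := by
  obtain ⟨g, h1, h2, h3, h4⟩ := h
  refine ⟨fun p => c * g p, h1.const_mul c, contDiff_const.mul h2, ?_, fun p => ⟨?_, ?_⟩⟩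
  · simp_rw [lebPrim_const_mul]
    exact contDiff_const.mul h3
  · simp_rw [mul_assoc]
    exact (h4 p).1.const_mul c
  · simp_rw [mul_assoc]
    rw [lebPrim_const_mul, integral_const_mul, (h4 p).2]

theorem smoothable_zero (z : ℝ) : Smoothable z fun _ => 0 :=
  ⟨fun _ => 0, integrable_zero _ _ _, contDiff_const, by simp [lebPrim, contDiff_const],
    fun p => by simp [lebPrim]⟩

theorem smoothable_sum {z : ℝ} {ι : Type*} (s : Finset ι) {w : ι → EReal × EReal → ℝ}
    (h : ∀ i ∈ s, Smoothable z (w i)) : Smoothable z fun x => ∑ i ∈ s, w i x := by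
  classical
  induction s using Finset.induction_on with
  | empty => simpa using smoothable_zero z
  | insert a s ha ih =>
    simp_rw [Finset.sum_insert ha]
    exact (h a (Finset.mem_insert_self a s)).add
      (ih fun i hi => h i (Finset.mem_insert_of_mem hi))

open Classical in
/-- The indicator of the corner `{x > c, y > d}`. -/
def cornerInd (c d : EReal) (x : EReal × EReal) : ℝ := if c < x.1 ∧ d < x.2 then 1 else 0

theorem cornerInd_coe_sub (c d : ℝ) (p q : ℝ × ℝ) :
    cornerInd c d (emb (p - q)) = chi ((p.1 - c : ℝ) : EReal) q.1 * chi ((p.2 - d : ℝ) : EReal) q.2 := by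
  have h1 : c < p.1 - q.1 ↔ q.1 < p.1 - c := by constructor <;> intro h <;> linarith
  have h2 : d < p.2 - q.2 ↔ q.2 < p.2 - d := by constructor <;> intro h <;> linarith
  simp only [cornerInd, emb, chi, Prod.fst_sub, Prod.snd_sub, EReal.coe_lt_coe_iff, h1, h2]
  split_ifs <;> simp_all

/-- For real c and d the convolution is the primitive of Φ_z translated by (c, d), with density the
translated kernel. If c or d is ∞ the corner is empty. A corner with c = -∞ is excluded because its
smoothing would not depend on x and so could not be the primitive of an integrable function. -/
theorem smoothable_cornerInd {z : ℝ} (hz : 0 < z) {c d : EReal} (hc : ⊥ < c) (hd : ⊥ < d) :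
    Smoothable z (cornerInd c d) := by
  rcases eq_or_ne c ⊤ with rfl | hc'
  · convert smoothable_zero z using 1
    funext x
    simp [cornerInd]
  rcases eq_or_ne d ⊤ with rfl | hd'
  · convert smoothable_zero z using 1
    funext x
    simp [cornerInd]
  lift c to ℝ using ⟨hc', hc.ne'⟩
  lift d to ℝ using ⟨hd', hd.ne'⟩
  have hprim : ∀ p : ℝ × ℝ, lebPrim (fun q => poisson z (q - (c, d))) (emb p) =
      lebPrim (poisson z) (emb (p - (c, d))) := by
    intro p
    rw [lebPrim, lebPrim, ← integral_sub_right_eq_self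
      (fun q : ℝ × ℝ => chi (emb (p - (c, d))).1 q.1 * chi (emb (p - (c, d))).2 q.2 * poisson z q) (c, d)]
    refine integral_congr_ae (ae_of_all _ fun q => ?_)
    simp only [emb, chi, Prod.fst_sub, Prod.snd_sub, EReal.coe_lt_coe_iff, sub_lt_sub_iff_right]
  refine ⟨fun q => poisson z (q - (c, d)), (integrable_poisson hz).comp_sub_right _,
    (contDiff_poisson hz).comp (contDiff_id.sub contDiff_const), ?_, fun p => ?_⟩
  · simp_rw [hprim, lebPrim_poisson hz]
    exact (contDiff_poissonCdf hz).comp (contDiff_id.sub contDiff_const)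
  · simp_rw [cornerInd_coe_sub, hprim]
    exact ⟨integrable_chi_mul (integrable_poisson hz) (emb (p - (c, d))), rfl⟩

theorem indicator_Ioc_prod {a b c d : EReal} (hab : a ≤ b) (hcd : c ≤ d) (s : ℝ)
    (x : EReal × EReal) :
    (Ioc a b ×ˢ Ioc c d).indicator (fun _ => s) x =
      s * (cornerInd a c x + (-1) * cornerInd b c x + (-1) * cornerInd a d x + cornerInd b d x) := by
  have hx : b < x.1 → a < x.1 := hab.trans_lt
  have hy : d < x.2 → c < x.2 := hcd.trans_lt
  simp only [indicator, cornerInd, mem_prod, mem_Ioc, ← not_lt]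
  by_cases h1 : a < x.1 <;> by_cases h2 : b < x.1 <;> by_cases h3 : c < x.2 <;>
    by_cases h4 : d < x.2 <;>
    first
      | exact absurd (hx h2) h1
      | exact absurd (hy h4) h3
      | simp [h1, h2, h3, h4]

/-- By inclusion and exclusion each cell is a combination of four corners. The cells adjacent to -∞
carry the value 0, so only corners with c, d > -∞ occur. -/
theorem smoothable_gridStep {z : ℝ} (hz : 0 < z) {n : ℕ} {p : ℕ → EReal}
    (hp : ∀ i < n, p i < p (i + 1)) {s : ℕ → ℕ → ℝ} (hs : ∀ i, s 0 i = 0 ∧ s i 0 = 0) :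
    Smoothable z (gridStep n p s) := by
  refine smoothable_sum _ fun i hi => smoothable_sum _ fun j hj => ?_
  rw [Finset.mem_range] at hi hj
  have h0 : s i j = 0 → Smoothable z
      ((Ioc (p i) (p (i + 1)) ×ˢ Ioc (p j) (p (j + 1))).indicator fun _ => s i j) := by
    intro h
    rw [h, indicator_zero]
    exact smoothable_zero z
  rcases Nat.eq_zero_or_pos i with rfl | hi0
  · exact h0 (hs j).1
  rcases Nat.eq_zero_or_pos j with rfl | hj0
  · exact h0 (hs i).2
  have hpos : ∀ k < n, 0 < k → ⊥ < p k := by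
    intro k hk hk0
    have := hp (k - 1) (by omega)
    rw [Nat.sub_add_cancel hk0] at this
    exact bot_le.trans_lt this
  have hi1 := hpos i hi hi0
  have hj1 := hpos j hj hj0
  have hi2 := hi1.trans (hp i hi)
  have hj2 := hj1.trans (hp j hj)
  rw [show (Ioc (p i) (p (i + 1)) ×ˢ Ioc (p j) (p (j + 1))).indicator (fun _ => s i j) = _ from
    funext fun x => indicator_Ioc_prod (hp i hi).le (hp j hj).le (s i j) x]
  exact ((((smoothable_cornerInd hz hi1 hj1).add ((smoothable_cornerInd hz hi2 hj1).const_mul _)).add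
    ((smoothable_cornerInd hz hi1 hj2).const_mul _)).add (smoothable_cornerInd hz hi2 hj2)).const_mul _

/-! ### Approximation by convolution -/

/-- Translation on the extended plane. -/
theorem continuous_translate :
    Continuous fun w : (ℝ × ℝ) × EReal × EReal =>
      ((w.2.1 + ((-w.1.1 : ℝ) : EReal), w.2.2 + ((-w.1.2 : ℝ) : EReal)) : EReal × EReal) := by
  have h : ∀ w : EReal × ℝ, ContinuousAt (fun w : EReal × ℝ => w.1 + ((-w.2 : ℝ) : EReal)) w := by
    intro w
    refine ContinuousAt.comp (f := fun w : EReal × ℝ => (w.1, ((-w.2 : ℝ) : EReal)))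
      (g := fun p : EReal × EReal => p.1 + p.2)
      (EReal.continuousAt_add (Or.inr (EReal.coe_ne_bot _)) (Or.inr (EReal.coe_ne_top _))) ?_
    exact (continuous_fst.prodMk (continuous_coe_real_ereal.comp continuous_snd.neg)).continuousAt
  have hc : Continuous fun w : EReal × ℝ => w.1 + ((-w.2 : ℝ) : EReal) :=
    continuous_iff_continuousAt.2 h
  exact (hc.comp ((continuous_fst.comp continuous_snd).prodMk
    (continuous_fst.comp continuous_fst))).prodMk
    (hc.comp ((continuous_snd.comp continuous_snd).prodMk (continuous_snd.comp continuous_fst)))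

/-- The translates of `F`, as a continuous family. -/
def translates (F : C(EReal × EReal, ℝ)) : C(ℝ × ℝ, C(EReal × EReal, ℝ)) :=
  (F.comp ⟨_, continuous_translate⟩).curry

theorem translates_apply_emb (F : C(EReal × EReal, ℝ)) (p q : ℝ × ℝ) :
    translates F q (emb p) = F (emb (p - q)) := by
  have : (((p.1 : EReal) + ((-q.1 : ℝ) : EReal), (p.2 : EReal) + ((-q.2 : ℝ) : EReal)) :
      EReal × EReal) = emb (p - q) := by
    simp only [emb, Prod.fst_sub, Prod.snd_sub, ← EReal.coe_add, ← sub_eq_add_neg]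
  exact congrArg F this

theorem translates_zero (F : C(EReal × EReal, ℝ)) : translates F 0 = F := by
  refine ContinuousMap.ext fun x => ?_
  have : ((x.1 + ((-(0 : ℝ × ℝ).1 : ℝ) : EReal), x.2 + ((-(0 : ℝ × ℝ).2 : ℝ) : EReal)) :
      EReal × EReal) = x := by simp
  exact congrArg F this

theorem norm_translates_sub_le (F : C(EReal × EReal, ℝ)) (q : ℝ × ℝ) :
    ‖translates F q - F‖ ≤ 2 * ‖F‖ := by
  have : ‖translates F q‖ ≤ ‖F‖ :=
    (ContinuousMap.norm_le _ (norm_nonneg _)).2 fun x => F.norm_coe_le_norm _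
  linarith [norm_sub_le (translates F q) F]

theorem poisson_smul {z : ℝ} (hz : 0 < z) (r : ℝ × ℝ) :
    poisson z (z • r) = (z ^ 2)⁻¹ * poisson 1 r := by
  rw [poisson_eq hz, poisson_eq one_pos]
  have h : (z • r).1 ^ 2 + (z • r).2 ^ 2 + z ^ 2 = z ^ 2 * (r.1 ^ 2 + r.2 ^ 2 + 1 ^ 2) := by
    simp only [Prod.smul_fst, Prod.smul_snd, smul_eq_mul]
    ring
  rw [h, Real.sqrt_mul (sq_nonneg z), Real.sqrt_sq hz.le]
  have := Real.sqrt_pos.2 (poisson_base_pos one_pos r)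
  field_simp

theorem integral_mul_poisson {z : ℝ} (hz : 0 < z) (h : ℝ × ℝ → ℝ) :
    ∫ q, h q * poisson z q = ∫ r, h (z • r) * poisson 1 r := by
  have e := Measure.integral_comp_smul (volume : Measure (ℝ × ℝ)) (fun q => h q * poisson z q) z
  rw [Module.finrank_prod, Module.finrank_self, abs_of_nonneg (by positivity), smul_eq_mul] at e
  have e' : ∀ r : ℝ × ℝ, h (z • r) * poisson z (z • r) =
      (z ^ 2)⁻¹ * (h (z • r) * poisson 1 r) := fun r => by
    rw [poisson_smul hz]; ring
  simp_rw [e'] at e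
  rw [integral_const_mul] at e
  exact (mul_left_cancel₀ (by positivity) e).symm

/-- Translation is continuous from the plane into the uniform norm, the extended plane being
compact. The error at every p is at most ∫ ‖F(· - q) - F‖ Φ_z(q) dq; substituting q = z r turns this
into an integral against Φ_1 that tends to 0 with z by dominated convergence, independently of p. -/
theorem exists_poisson_near (F : C(EReal × EReal, ℝ)) {ε : ℝ} (hε : 0 < ε) :
    ∃ z > 0, ∀ p : ℝ × ℝ, |(∫ q, F (emb (p - q)) * poisson z q) - F (emb p)| < ε := by
  have hcont : Continuous fun q => ‖translates F q - F‖ :=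
    ((translates F).continuous.sub continuous_const).norm
  have hlim : Tendsto (fun n : ℕ => ∫ r, ‖translates F ((n + 1 : ℝ)⁻¹ • r) - F‖ * poisson 1 r)
      atTop (𝓝 (∫ _r : ℝ × ℝ, (0 : ℝ))) := by
    refine tendsto_integral_of_dominated_convergence (fun r => 2 * ‖F‖ * poisson 1 r)
      (fun n => ?_) ((integrable_poisson one_pos).const_mul _)
      (fun n => ae_of_all _ fun r => ?_) (ae_of_all _ fun r => ?_)
    · exact ((hcont.comp (by fun_prop)).mul (continuous_poisson one_pos)).aestronglyMeasurable
    · rw [Real.norm_of_nonneg (mul_nonneg (norm_nonneg _) (poisson_nonneg one_pos r))]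
      exact mul_le_mul_of_nonneg_right (norm_translates_sub_le F _) (poisson_nonneg one_pos r)
    · have h2 : Tendsto (fun n : ℕ => ((n : ℝ) + 1)⁻¹ • r) atTop (𝓝 ((0 : ℝ) • r)) :=
        (tendsto_inv_atTop_zero.comp
          (tendsto_atTop_add_const_right _ 1 tendsto_natCast_atTop_atTop)).smul_const r
      rw [zero_smul] at h2
      have h3 := ((hcont.tendsto 0).comp h2).mul_const (poisson 1 r)
      rw [translates_zero, sub_self, norm_zero, zero_mul] at h3
      exact h3
  rw [integral_zero] at hlim
  obtain ⟨n, hn⟩ := (hlim.eventually_lt_const hε).exists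
  have hz : (0 : ℝ) < (n + 1 : ℝ)⁻¹ := by positivity
  refine ⟨_, hz, fun p => lt_of_le_of_lt ?_ hn⟩
  rw [← integral_mul_poisson hz (fun q => ‖translates F q - F‖)]
  have hint : Integrable fun q => F (emb (p - q)) * poisson (n + 1 : ℝ)⁻¹ q :=
    (integrable_poisson hz).bdd_mul (c := ‖F‖)
      (F.continuous.comp (continuous_emb.comp (by fun_prop))).aestronglyMeasurable
      (ae_of_all _ fun q => F.norm_coe_le_norm _)
  have h1 : F (emb p) = ∫ q, F (emb p) * poisson (n + 1 : ℝ)⁻¹ q := by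
    rw [integral_const_mul, integral_poisson hz, mul_one]
  rw [h1, ← integral_sub hint ((integrable_poisson hz).const_mul _), ← Real.norm_eq_abs]
  refine norm_integral_le_of_norm_le ?_ (ae_of_all _ fun q => ?_)
  · exact (integrable_poisson hz).bdd_mul (c := 2 * ‖F‖) hcont.aestronglyMeasurable
      (ae_of_all _ fun q => by rw [norm_norm]; exact norm_translates_sub_le F q)
  · rw [← sub_mul, norm_mul, Real.norm_of_nonneg (poisson_nonneg hz q)]
    refine mul_le_mul_of_nonneg_right ?_ (poisson_nonneg hz q)
    rw [← translates_apply_emb]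
    exact (translates F q - F).norm_coe_le_norm (emb p)

/-- One ε/3 is for replacing F by a step function under the convolution, which has total mass 1, and
one is for F ∗ Φ_z against F. The bound 2ε/3 on the plane extends to the points at infinity by
density. -/
theorem exists_smoothing_near {F : C(EReal × EReal, ℝ)} (hF : F ∈ Bc) {ε : ℝ} (hε : 0 < ε) :
    ∃ (g : ℝ × ℝ → ℝ) (hg : Integrable g), ContDiff ℝ ⊤ g ∧
      ContDiff ℝ ⊤ (fun p => lebPrim g (emb p)) ∧ IsPoissonSmoothing (lebPrim g) ∧
      ‖lebC g hg - F‖ < ε := by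
  obtain ⟨n, p, s, h0, hn, hp, hs, hσ⟩ := exists_gridStep_near hF (show 0 < ε / 3 by positivity)
  obtain ⟨z, hz, hP⟩ := exists_poisson_near F (show 0 < ε / 3 by positivity)
  obtain ⟨g, hg, h1, h2, h3⟩ := smoothable_gridStep hz hp hs
  refine ⟨g, hg, h1, h2, ⟨_, isStep_gridStep h0 hn hp s, z, hz, fun p => (h3 p).2⟩, ?_⟩
  have hreal : ∀ p : ℝ × ℝ, |(lebC g hg - F) (emb p)| ≤ 2 * (ε / 3) := by
    intro p
    have hint : Integrable fun q => F (emb (p - q)) * poisson z q :=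
      (integrable_poisson hz).bdd_mul (c := ‖F‖)
        (F.continuous.comp (continuous_emb.comp (by fun_prop))).aestronglyMeasurable
        (ae_of_all _ fun q => F.norm_coe_le_norm _)
    have e1 : |lebPrim g (emb p) - ∫ q, F (emb (p - q)) * poisson z q| ≤ ε / 3 := by
      rw [(h3 p).2, ← integral_sub (h3 p).1 hint, ← Real.norm_eq_abs]
      refine (norm_integral_le_of_norm_le ((integrable_poisson hz).const_mul (ε / 3))
        (ae_of_all _ fun q => ?_)).trans_eq (by rw [integral_const_mul, integral_poisson hz, mul_one])
      rw [← sub_mul, norm_mul, Real.norm_of_nonneg (poisson_nonneg hz q), Real.norm_eq_abs,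
        abs_sub_comm]
      exact mul_le_mul_of_nonneg_right (hσ _).le (poisson_nonneg hz q)
    have e2 := abs_sub_le (lebPrim g (emb p)) (∫ q, F (emb (p - q)) * poisson z q) (F (emb p))
    have e3 := hP p
    change |lebPrim g (emb p) - F (emb p)| ≤ _
    linarith
  refine lt_of_le_of_lt ((ContinuousMap.norm_le _ (by positivity)).2 fun x => ?_)
    (show 2 * (ε / 3) < ε by linarith)
  exact dense_range_emb.induction_on x
    (isClosed_le (lebC g hg - F).continuous.norm continuous_const) hreal

/-- Analytic Poisson smoothings with analytic mixed derivative. -/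
theorem dense_smoothings :
    Dense {U : Bc | AnalyticOnNhd ℝ (fun p => U.1 (emb p)) univ ∧ IsPoissonSmoothing U.1 ∧
      ∃ g : ℝ × ℝ → ℝ, AnalyticOnNhd ℝ g univ ∧ d12 U.1 = toDist g} := by
  refine Metric.dense_iff.2 fun F r hr => ?_
  obtain ⟨g, hg, h1, h2, h3, h4⟩ := exists_smoothing_near F.2 hr
  -- The smoothness order `⊤` in `WithTop ℕ∞` is ω, so the two `ContDiff` statements are
  -- analyticity.
  refine ⟨⟨lebC g hg, lebC_mem_Bc g hg⟩, ?_, contDiff_omega_iff_analyticOnNhd.1 h2, h3, g,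
    contDiff_omega_iff_analyticOnNhd.1 h1, d12_lebC hg⟩
  rw [Metric.mem_ball, Subtype.dist_eq, dist_eq_norm]
  exact h4

theorem denseInAc_smoothings :
    DenseInAc {T | ∃ U ∈ Bc, IsPoissonSmoothing U ∧ T = d12 U ∧
      ∃ g : ℝ × ℝ → ℝ, AnalyticOnNhd ℝ g univ ∧ T = toDist g} := by
  intro T hT ε hε
  obtain ⟨_, ⟨U, ⟨-, hU, g, hg, hUg⟩, rfl⟩, h⟩ := denseInAc_image dense_smoothings T hT ε hε
  exact ⟨_, ⟨U, U.2, hU, rfl, g, hg, hUg⟩, h⟩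

/-! ### The primitive of a product with a test function -/

/-- The primitive of `φ ∂₁₂F`. -/
def mulPrim (φ : Test) (F : EReal × EReal → ℝ) (z : EReal × EReal) : ℝ :=
  ∫ q : ℝ × ℝ, mixed φ q * F (min z.1 q.1, min z.2 q.2)

theorem continuous_truncate (z : EReal × EReal) :
    Continuous fun q : ℝ × ℝ => ((min z.1 q.1, min z.2 q.2) : EReal × EReal) :=
  (continuous_const.min (continuous_coe_real_ereal.comp continuous_fst)).prodMk
    (continuous_const.min (continuous_coe_real_ereal.comp continuous_snd))

section mulPrim
variable (φ : Test) (F : C(EReal × EReal, ℝ))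

theorem integrable_mixed_mul_truncate (z : EReal × EReal) :
    Integrable fun q : ℝ × ℝ => mixed φ q * F (min z.1 q.1, min z.2 q.2) :=
  integrable_test_mul _ (F.continuous.comp (continuous_truncate z))

theorem continuous_mulPrim : Continuous (mulPrim φ F) := by
  refine continuous_of_dominated (bound := fun q => |mixed φ q| * ‖F‖)
    (fun z => (integrable_mixed_mul_truncate φ F z).aestronglyMeasurable)
    (fun z => ae_of_all _ fun q => ?_) ((integrable_test _).abs.mul_const _)
    (ae_of_all _ fun q => ?_)
  · rw [norm_mul, Real.norm_eq_abs]
    exact mul_le_mul_of_nonneg_left (F.norm_coe_le_norm _) (abs_nonneg _)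
  · exact continuous_const.mul (F.continuous.comp ((continuous_fst.min continuous_const).prodMk
      (continuous_snd.min continuous_const)))

/-- By linearity of the integral: this is where cells truncated at q enter. -/
theorem incr_mulPrim (a b c d : EReal) : incr (mulPrim φ F) a b c d =
    ∫ q : ℝ × ℝ, mixed φ q * incr F (min a q.1) (min b q.1) (min c q.2) (min d q.2) := by
  unfold incr mulPrim
  rw [← integral_add_sub_sub (integrable_mixed_mul_truncate φ F (a, c))
    (integrable_mixed_mul_truncate φ F (b, d)) (integrable_mixed_mul_truncate φ F (a, d))
    (integrable_mixed_mul_truncate φ F (b, c))]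
  exact integral_congr_ae (ae_of_all _ fun q => by ring)

/-- The whole extended plane truncated at q is the quadrant below q, over which the increment of F
is F(q). -/
theorem incr_mulPrim_univ {F : C(EReal × EReal, ℝ)} (hF : F ∈ Bc) :
    incr (mulPrim φ F) ⊥ ⊤ ⊥ ⊤ = d12 F φ := by
  rw [incr_mulPrim, d12_apply']
  refine integral_congr_ae (ae_of_all _ fun q => ?_)
  simp only [bot_inf_eq, top_inf_eq]
  rw [apply_eq_incr hF (emb q)]
  rfl

end mulPrim

/-- The point function whose increments are areas. -/
def areaFun (z : EReal × EReal) : ℝ := z.1.toReal * z.2.toReal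

theorem incr_areaFun (a b c d : EReal) :
    incr areaFun a b c d = (b.toReal - a.toReal) * (d.toReal - c.toReal) := by
  simp only [incr, areaFun]
  ring

theorem Cell.incr_areaFun (J : Cell) : J.incr areaFun = J.area := CPI.incr_areaFun _ _ _ _

theorem incr_lin (t : ℝ) (F : EReal × EReal → ℝ) (a b c d : EReal) :
    incr (fun z => t * areaFun z - F z) a b c d = t * incr areaFun a b c d - incr F a b c d := by
  simp only [incr]
  ring

theorem toReal_min_coe (a u : ℝ) : (min (a : EReal) (u : EReal)).toReal = min a u := by
  rw [← EReal.coe_strictMono.monotone.map_min, EReal.toReal_coe]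

theorem incr_areaFun_truncate (a b c d : ℝ) (q : ℝ × ℝ) :
    incr areaFun (min (a : EReal) q.1) (min (b : EReal) q.1) (min (c : EReal) q.2)
      (min (d : EReal) q.2) = (min b q.1 - min a q.1) * (min d q.2 - min c q.2) := by
  simp only [incr_areaFun, toReal_min_coe]

theorem setIntegral_Ico_eq {f : ℝ × ℝ → ℝ} (hf : Integrable f) {a b c d : ℝ} (hab : a ≤ b)
    (hcd : c ≤ d) : ∫ p in Ico a b ×ˢ Ico c d, f p = incr (lebPrim f) a b c d := by
  rw [incr_lebPrim hf, ← integral_indicator (measurableSet_Ico.prod measurableSet_Ico)]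
  have h : ∀ {a b : ℝ}, a ≤ b → ∀ r : ℝ,
      chi b r - chi a r = (Ico a b).indicator (fun _ => (1 : ℝ)) r := by
    intro a b hab r
    rcases lt_or_ge r a with h1 | h1
    · simp [chi, h1, h1.trans_le hab]
    · by_cases h2 : r < b <;> simp [chi, h1, h1.not_gt, h2]
  refine integral_congr_ae (ae_of_all _ fun p => ?_)
  simp only
  rw [h hab, h hcd]
  by_cases hx : p.1 ∈ Ico a b
  · by_cases hy : p.2 ∈ Ico c d
    · rw [indicator_of_mem hx, indicator_of_mem hy,
        indicator_of_mem (show p ∈ Ico a b ×ˢ Ico c d from ⟨hx, hy⟩)]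
      ring
    · rw [indicator_of_notMem hy, indicator_of_notMem fun h : p ∈ Ico a b ×ˢ Ico c d => hy h.2]
      ring
  · rw [indicator_of_notMem hx, indicator_of_notMem fun h : p ∈ Ico a b ×ˢ Ico c d => hx h.1]
    ring

theorem lebPrim_indicator_Ico {a b c d : ℝ} (hab : a ≤ b) (hcd : c ≤ d) (q : ℝ × ℝ) :
    lebPrim ((Ico a b ×ˢ Ico c d).indicator fun _ => 1) (emb q) =
      (min b q.1 - min a q.1) * (min d q.2 - min c q.2) := by
  have h1 : ∀ p : ℝ × ℝ, chi (emb q).1 p.1 * chi (emb q).2 p.2 *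
      (Ico a b ×ˢ Ico c d).indicator (fun _ => (1 : ℝ)) p =
      (Ico (min a q.1) (min b q.1) ×ˢ Ico (min c q.2) (min d q.2)).indicator (fun _ => (1 : ℝ)) p := by
    intro p
    by_cases hx : p.1 < q.1 <;> by_cases hy : p.2 < q.2 <;>
      simp [chi, emb, indicator, hx, hy] <;> grind
  rw [lebPrim, integral_congr_ae (ae_of_all _ h1),
    integral_indicator (measurableSet_Ico.prod measurableSet_Ico), setIntegral_const,
    Measure.volume_eq_prod, measureReal_prod_prod, Real.volume_real_Ico_of_le (min_le_min_right _ hab),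
    Real.volume_real_Ico_of_le (min_le_min_right _ hcd), smul_eq_mul, mul_one]

/-- The integration by parts formula applied to the indicator of the rectangle, whose primitive at q
is the area of the rectangle truncated at q. The area function itself has no integrable density and
is not continuous at infinity, so the formula cannot be applied to it directly. -/
theorem integral_mixed_mul_area (φ : Test) {a b c d : ℝ} (hab : a ≤ b) (hcd : c ≤ d) :
    ∫ q : ℝ × ℝ, mixed φ q * ((min b q.1 - min a q.1) * (min d q.2 - min c q.2)) =
      ∫ p in Ico a b ×ˢ Ico c d, φ p := by
  have hint : Integrable ((Ico a b ×ˢ Ico c d).indicator fun _ => (1 : ℝ)) := by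
    refine (integrable_indicator_iff (measurableSet_Ico.prod measurableSet_Ico)).2
      (integrableOn_const ?_)
    rw [Measure.volume_eq_prod, Measure.prod_prod]
    exact ENNReal.mul_ne_top (by simp) (by simp)
  have h := integral_mixed_mul_lebPrim φ hint
  simp_rw [lebPrim_indicator_Ico hab hcd] at h
  rw [h, ← integral_indicator (measurableSet_Ico.prod measurableSet_Ico)]
  refine integral_congr_ae (ae_of_all _ fun p => ?_)
  by_cases hp : p ∈ Ico a b ×ˢ Ico c d <;> simp [indicator, hp]

/-- The error made on a cell when the primitive of `φ ∂₁₂F` is compared to that of `φ(p) t`. -/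
theorem abs_mul_area_sub_incr_mulPrim_le (φ : Test) (F : C(EReal × EReal, ℝ)) {a b c d : ℝ}
    (hab : a ≤ b) (hcd : c ≤ d) (t s : ℝ) {h : ℝ × ℝ → ℝ} (hh : Integrable h)
    (hle : ∀ q ∈ Icc a b ×ˢ Icc c d, |t| * |φ q - s| ≤ h q) :
    |t * s * ((b - a) * (d - c)) - incr (mulPrim φ F) a b c d| ≤
      (∫ q : ℝ × ℝ, |mixed φ q| * |incr (fun z => t * areaFun z - F z) (min (a : EReal) q.1)
        (min (b : EReal) q.1) (min (c : EReal) q.2) (min (d : EReal) q.2)|) +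
      incr (lebPrim h) a b c d := by
  have hi : ∀ g : ℝ × ℝ → ℝ, Integrable g → IntegrableOn g (Ico a b ×ˢ Ico c d) :=
    fun g hg => hg.integrableOn
  have harea : t * s * ((b - a) * (d - c)) = ∫ q in Ico a b ×ˢ Ico c d, t * s := by
    rw [setIntegral_const, Measure.volume_eq_prod, measureReal_prod_prod,
      Real.volume_real_Ico_of_le hab, Real.volume_real_Ico_of_le hcd, smul_eq_mul]
    ring
  have hfin : (volume : Measure (ℝ × ℝ)) (Ico a b ×ˢ Ico c d) ≠ ⊤ := by
    rw [Measure.volume_eq_prod, Measure.prod_prod]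
    exact ENNReal.mul_ne_top (by simp) (by simp)
  have hci : Integrable (fun _ : ℝ × ℝ => t * s) (volume.restrict (Ico a b ×ˢ Ico c d)) :=
    integrableOn_const hfin
  -- The comparison goes through t∫φ over the cell. This half is the cost of freezing φ at s; the
  -- next one compares two integrals of truncated increments with the same weight, those of t·area
  -- and those of F.
  have e1 : |t * s * ((b - a) * (d - c)) - t * ∫ q in Ico a b ×ˢ Ico c d, φ q| ≤
      incr (lebPrim h) a b c d := by
    rw [← setIntegral_Ico_eq hh hab hcd, harea, ← integral_const_mul,
      ← integral_sub hci ((hi _ (integrable_test φ)).const_mul t),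
      ← Real.norm_eq_abs]
    refine norm_integral_le_of_norm_le (hi h hh)
      ((ae_restrict_iff' (measurableSet_Ico.prod measurableSet_Ico)).2 (ae_of_all _ fun q hq => ?_))
    rw [← mul_sub, norm_mul, Real.norm_eq_abs, Real.norm_eq_abs, abs_sub_comm]
    exact hle q ⟨Ico_subset_Icc_self hq.1, Ico_subset_Icc_self hq.2⟩
  have hA : Integrable fun q : ℝ × ℝ =>
      mixed φ q * ((min b q.1 - min a q.1) * (min d q.2 - min c q.2)) :=
    integrable_test_mul _ (by fun_prop)
  have hF : Integrable fun q : ℝ × ℝ => mixed φ q *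
      incr F (min (a : EReal) q.1) (min (b : EReal) q.1) (min (c : EReal) q.2) (min (d : EReal) q.2) := by
    refine integrable_test_mul _ ?_
    unfold incr
    exact (((F.continuous.comp (continuous_truncate (a, c))).add
      (F.continuous.comp (continuous_truncate (b, d)))).sub
      (F.continuous.comp (continuous_truncate (a, d)))).sub
      (F.continuous.comp (continuous_truncate (b, c)))
  have e2 : |(t * ∫ q in Ico a b ×ˢ Ico c d, φ q) - incr (mulPrim φ F) a b c d| ≤
      ∫ q : ℝ × ℝ, |mixed φ q| * |incr (fun z => t * areaFun z - F z) (min (a : EReal) q.1)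
        (min (b : EReal) q.1) (min (c : EReal) q.2) (min (d : EReal) q.2)| := by
    rw [← integral_mixed_mul_area φ hab hcd, incr_mulPrim, ← integral_const_mul,
      ← integral_sub (hA.const_mul t) hF]
    refine (abs_integral_le_integral_abs).trans_eq (integral_congr_ae (ae_of_all _ fun q => ?_))
    simp only [incr_lin, incr_areaFun_truncate]
    rw [← abs_mul]
    ring_nf
  linarith [abs_sub_le (t * s * ((b - a) * (d - c))) (t * ∫ q in Ico a b ×ˢ Ico c d, φ q)
    (incr (mulPrim φ F) a b c d)]

theorem abs_incr_mulPrim_le (φ : Test) (F : C(EReal × EReal, ℝ)) (a b c d : EReal) :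
    |incr (mulPrim φ F) a b c d| ≤ ∫ q : ℝ × ℝ, |mixed φ q| *
      |incr F (min a q.1) (min b q.1) (min c q.2) (min d q.2)| := by
  rw [incr_mulPrim]
  refine (abs_integral_le_integral_abs).trans_eq ?_
  simp_rw [abs_mul]

theorem continuous_incr_truncate (F : C(EReal × EReal, ℝ)) (a b c d : EReal) :
    Continuous fun q : ℝ × ℝ => incr F (min a q.1) (min b q.1) (min c q.2) (min d q.2) := by
  unfold incr
  exact (((F.continuous.comp (continuous_truncate (a, c))).add
      (F.continuous.comp (continuous_truncate (b, d)))).sub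
      (F.continuous.comp (continuous_truncate (a, d)))).sub
      (F.continuous.comp (continuous_truncate (b, c)))

theorem integrable_abs_test_mul (φ : Test) {g : ℝ × ℝ → ℝ} (hg : Continuous g) :
    Integrable fun p => |φ p| * |g p| :=
  (φ.continuous.abs.mul hg.abs).integrable_of_hasCompactSupport
    (HasCompactSupport.mul_right (φ.hasCompactSupport.comp_left (g := fun x : ℝ => |x|) abs_zero))

/-- Integrated form of the truncation inequality. -/
theorem sum_integral_truncate_le (φ : Test) {ι : Type} [Fintype ι] {P : ι → Cell}
    {Φ : ι → EReal × EReal → ℝ} {C : ℝ}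
    (hcont : ∀ i, Continuous fun q : ℝ × ℝ => incr (Φ i) (min (P i).a q.1) (min (P i).b q.1)
      (min (P i).c q.2) (min (P i).d q.2))
    (h : ∀ P' : ι → Cell, (∀ i, (P' i).tag = (P i).tag ∧ (P' i).set ⊆ (P i).set) →
      ∑ i, |(P' i).incr (Φ i)| ≤ C) :
    ∑ i, ∫ q : ℝ × ℝ, |mixed φ q| * |incr (Φ i) (min (P i).a q.1) (min (P i).b q.1)
      (min (P i).c q.2) (min (P i).d q.2)| ≤ 4 * C * ∫ q, |mixed φ q| := by
  rw [← integral_finsetSum _ fun i _ => integrable_abs_test_mul _ (hcont i), ← integral_const_mul]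
  refine integral_mono (integrable_finsetSum _ fun i _ => integrable_abs_test_mul _ (hcont i))
    ((integrable_test _).abs.const_mul _) fun q => ?_
  simp only
  rw [← Finset.mul_sum, mul_comm]
  exact mul_le_mul_of_nonneg_right (sum_abs_truncate_le h _ _) (abs_nonneg _)

theorem IsGauge.exists_real {γ : EReal × EReal → Set (EReal × EReal)} (hγ : IsGauge γ) {J : Cell}
    (hJ : J.set ⊆ γ J.tag) (ht : J.tag ∈ finitePlane) :
    ∃ a b c d : ℝ, J.a = a ∧ J.b = b ∧ J.c = c ∧ J.d = d ∧ a ≤ b ∧ c ≤ d :=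
  Cell.exists_real (hJ.trans ((hγ _).2.2 ht))

theorem extendZero_emb (f : ℝ × ℝ → ℝ) (p : ℝ × ℝ) : extendZero f (emb p) = f p := by
  rw [extendZero, if_pos ⟨p, rfl⟩]
  rfl

theorem extendZero_of_notMem (f : ℝ × ℝ → ℝ) {p : EReal × EReal} (hp : p ∉ finitePlane) :
    extendZero f p = 0 := if_neg hp

/-- Increments of a nondecreasing function over nonoverlapping cells. -/
theorem IsPartial.sum_incr_le {γ : EReal × EReal → Set (EReal × EReal)} {ι : Type} [Fintype ι]
    {P : ι → Cell} (hP : IsPartial γ univ P) {F : EReal × EReal → ℝ}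
    (hF : ∀ a b c d : EReal, a ≤ b → c ≤ d → 0 ≤ incr F a b c d) :
    ∑ i, (P i).incr F ≤ incr F ⊥ ⊤ ⊥ ⊤ := by
  obtain ⟨κ, _, R, hR, hd, hc⟩ := exists_completion isGauge_topGauge P
    (bot_le : (⊥ : EReal) ≤ ⊤) (bot_le : (⊥ : EReal) ≤ ⊤)
  have hdiv : IsDivision (fun _ => univ) (box ⊥ ⊤ ⊥ ⊤) (Sum.elim P R) := by
    refine ⟨(hP.mono (by rw [box_univ]) fun _ => subset_univ _).sumElim
      (hR.mono subset_rfl fun _ => subset_univ _) fun i k => (hd k i).symm, hc.trans ?_⟩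
    rw [iUnion_sum, union_comm]
    exact subset_rfl
  rw [← sum_incr_eq bot_le bot_le hdiv F, Fintype.sum_sum_type]
  simp only [Sum.elim_inl, Sum.elim_inr]
  linarith [Finset.sum_nonneg fun k (_ : k ∈ Finset.univ) =>
    hF (R k).a (R k).b (R k).c (R k).d (R k).hab (R k).hcd, show ∑ k, (R k).incr F =
      ∑ k, incr F (R k).a (R k).b (R k).c (R k).d from rfl]

/-! ### Henstock–Kurzweil primitives -/

/-- The conclusion of the Saks–Henstock lemma. -/
def IsHKPrimitive (f : ℝ × ℝ → ℝ) (F : EReal × EReal → ℝ) : Prop :=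
  ∀ ε > 0, ∃ γ, IsGauge γ ∧ ∀ (ι : Type) [Fintype ι] (P : ι → Cell), IsPartial γ univ P →
    ∑ i, |extendZero f (P i).tag * (P i).area - (P i).incr F| ≤ ε

theorem IsHKPrimitive.hasHKIntegral {f : ℝ × ℝ → ℝ} {F : EReal × EReal → ℝ}
    (h : IsHKPrimitive f F) {a b c d : EReal} (hab : a ≤ b) (hcd : c ≤ d) :
    HasHKIntegral f a b c d (incr F a b c d) := by
  intro ε hε
  obtain ⟨γ, hγ, hS⟩ := h (ε / 2) (by positivity)
  refine ⟨γ, hγ, fun n P hP => ?_⟩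
  have hP' : IsDivision γ (box a b c d) P := hP
  rw [← sum_incr_eq hab hcd hP' F, ← Finset.sum_sub_distrib]
  have := hS _ P (hP'.1.mono (subset_univ _) fun _ => subset_rfl)
  linarith [Finset.abs_sum_le_sum_abs
    (fun i => extendZero f (P i).tag * (P i).area - (P i).incr F) Finset.univ]

theorem isOpenEmbedding_emb : IsOpenEmbedding emb :=
  EReal.isOpenEmbedding_coe.prodMap EReal.isOpenEmbedding_coe

/-- The error on a cell has two parts. The truncated Saks–Henstock errors of F sum to at most 4δM.
The oscillation of φ on the cell, multiplied by |f(tag)|, is made smaller than δΦ_1 by shrinking the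
gauge, and nonoverlapping cells then contribute at most δ∫Φ_1 = δ. Here Φ_1 serves only as a
positive continuous function of integral 1. -/
theorem IsHKPrimitive.mul_test {f : ℝ × ℝ → ℝ} {F : C(EReal × EReal, ℝ)}
    (h : IsHKPrimitive f F) (φ : Test) : IsHKPrimitive (fun p => f p * φ p) (mulPrim φ F) := by
  classical
  intro ε hε
  set M := ∫ q, |mixed φ q| with hM
  have hM0 : 0 ≤ M := integral_nonneg fun q => abs_nonneg _
  set δ := ε / (4 * M + 1) with hδ
  have hδ0 : 0 < δ := by positivity
  obtain ⟨γ, hγ, hS⟩ := h δ hδ0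
  -- The neighbourhood may depend on f(p), so no bound on f is needed; positivity of the kernel
  -- makes it contain p.
  set V : EReal × EReal → Set (EReal × EReal) := fun p => if p ∈ finitePlane then
    emb '' {q | |extendZero f p| * |φ q - φ (p.1.toReal, p.2.toReal)| < δ * poisson 1 q} else univ
    with hV
  have hh0 : ∀ q, 0 < δ * poisson 1 q := fun q => mul_pos hδ0 (poisson_pos one_pos q)
  have hhi : Integrable fun q => δ * poisson 1 q := (integrable_poisson one_pos).const_mul δ
  have hVg : IsGauge fun p => V p ∩ topGauge p := by
    refine IsGauge.of_open (fun p => ?_) fun p => ?_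
    · simp only [hV]
      split_ifs
      · refine isOpenEmbedding_emb.isOpenMap _ (isOpen_lt ?_ ?_)
        · exact continuous_const.mul (φ.continuous.sub continuous_const).abs
        · exact continuous_const.mul (continuous_poisson one_pos)
      · exact isOpen_univ
    · simp only [hV]
      split_ifs with hp
      · obtain ⟨q, rfl⟩ := hp
        exact ⟨q, by simpa [emb] using hh0 q, rfl⟩
      · exact mem_univ _
  refine ⟨_, hγ.inter hVg, fun ι _ P hP => ?_⟩
  have hPγ : IsPartial γ univ P := hP.mono subset_rfl fun p => inter_subset_left
  set t : ι → ℝ := fun i => extendZero f (P i).tag with ht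
  have hcase : ∀ i, (t i = 0 ∧ extendZero (fun p => f p * φ p) (P i).tag = 0) ∨
      ∃ a b c d : ℝ, (P i).a = a ∧ (P i).b = b ∧ (P i).c = c ∧ (P i).d = d ∧ a ≤ b ∧ c ≤ d ∧
        ∃ p, (P i).tag = emb p := by
    intro i
    by_cases hp : (P i).tag ∈ finitePlane
    · right
      obtain ⟨a, b, c, d, h1, h2, h3, h4, h5, h6⟩ := hγ.exists_real (hPγ.1 i).2 hp
      obtain ⟨p, hp⟩ := hp
      exact ⟨a, b, c, d, h1, h2, h3, h4, h5, h6, p, hp.symm⟩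
    · exact Or.inl ⟨extendZero_of_notMem f hp, extendZero_of_notMem _ hp⟩
  have hcont : ∀ i, Continuous fun q : ℝ × ℝ => incr (fun z => t i * areaFun z - F z)
      (min (P i).a q.1) (min (P i).b q.1) (min (P i).c q.2) (min (P i).d q.2) := by
    intro i
    simp_rw [incr_lin]
    refine Continuous.sub ?_ (continuous_incr_truncate F _ _ _ _)
    rcases hcase i with ⟨h0, -⟩ | ⟨a, b, c, d, h1, h2, h3, h4, -, -, -⟩
    · simp_rw [h0, zero_mul]
      exact continuous_const
    · simp_rw [h1, h2, h3, h4, incr_areaFun_truncate]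
      fun_prop
  have hcell : ∀ i, |extendZero (fun p => f p * φ p) (P i).tag * (P i).area -
      (P i).incr (mulPrim φ F)| ≤
      (∫ q : ℝ × ℝ, |mixed φ q| * |incr (fun z => t i * areaFun z - F z) (min (P i).a q.1)
        (min (P i).b q.1) (min (P i).c q.2) (min (P i).d q.2)|) +
      (P i).incr (lebPrim fun q => δ * poisson 1 q) := by
    intro i
    rcases hcase i with ⟨h0, h0'⟩ | ⟨a, b, c, d, h1, h2, h3, h4, h5, h6, p, hp⟩
    · rw [h0', zero_mul, zero_sub, abs_neg]
      have e := abs_incr_mulPrim_le φ F (P i).a (P i).b (P i).c (P i).d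
      have e' := incr_lebPrim_nonneg hhi (fun q => (hh0 q).le) (P i).hab (P i).hcd
      simp_rw [incr_lin, h0, zero_mul, zero_sub, abs_neg]
      exact e.trans (le_add_of_nonneg_right e')
    · have e := abs_mul_area_sub_incr_mulPrim_le φ F h5 h6 (t i) (φ p) hhi ?_
      · have h7 : extendZero (fun p => f p * φ p) (P i).tag = t i * φ p := by
          simp only [ht, hp, extendZero_emb]
        simp only [h7, Cell.area, Cell.incr, h1, h2, h3, h4, EReal.toReal_coe]
        exact e
      · intro q hq
        have hq' : emb q ∈ (P i).set := by
          simp only [Cell.set, h1, h2, h3, h4, box, emb]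
          exact ⟨⟨EReal.coe_le_coe_iff.2 hq.1.1, EReal.coe_le_coe_iff.2 hq.1.2⟩,
            EReal.coe_le_coe_iff.2 hq.2.1, EReal.coe_le_coe_iff.2 hq.2.2⟩
        have hqV : emb q ∈ V (P i).tag := ((hP.1 i).2 hq').2.1
        simp only [hV] at hqV
        rw [if_pos (by rw [hp]; exact ⟨p, rfl⟩)] at hqV
        obtain ⟨q', hq1, hq2⟩ := hqV
        rw [isOpenEmbedding_emb.injective hq2] at hq1
        have : ((P i).tag.1.toReal, (P i).tag.2.toReal) = p := by rw [hp]; rfl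
        rw [mem_ofPred_eq, this] at hq1
        exact hq1.le
  have hsum := sum_integral_truncate_le φ (Φ := fun i z => t i * areaFun z - F z) hcont
    (C := δ) fun P' hP' => by
      have h1 := hS ι P' (hPγ.shrink hP')
      simp only [(hP' _).1] at h1
      refine le_trans (le_of_eq (Finset.sum_congr rfl fun i _ => ?_)) h1
      rw [Cell.incr, incr_lin, ← Cell.incr, Cell.incr_areaFun]
      rfl
  have hpois := hP.sum_incr_le (F := lebPrim fun q => δ * poisson 1 q)
    fun a b c d hab hcd => incr_lebPrim_nonneg hhi (fun q => (hh0 q).le) hab hcd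
  have htot : incr (lebPrim fun q => δ * poisson 1 q) ⊥ ⊤ ⊥ ⊤ = δ := by
    rw [incr_lebPrim hhi]
    simp [integral_const_mul, integral_poisson one_pos]
  calc _ ≤ _ := Finset.sum_le_sum fun i _ => hcell i
    _ ≤ 4 * δ * M + δ := by
      rw [Finset.sum_add_distrib]
      exact add_le_add hsum (hpois.trans_eq htot)
    _ = ε := by
      rw [hδ]
      field_simp

/-! ### Existence of the Henstock–Kurzweil primitive -/

/-- Gluing divisions of nonoverlapping cells with a completion. -/
theorem IsDivision.glue {γ : EReal × EReal → Set (EReal × EReal)} {I : Set (EReal × EReal)}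
    {ι κ : Type} {B : ι → Cell} {τ : ι → Type} {Q : ∀ i, τ i → Cell} {R : κ → Cell}
    (hBI : ∀ i, (B i).set ⊆ I) (hB : Pairwise fun i j => Disjoint (B i).inside (B j).inside)
    (hQ : ∀ i, IsDivision γ (B i).set (Q i)) (hR : IsPartial γ I R)
    (hRB : ∀ k i, Disjoint (R k).inside (B i).inside)
    (hc : I ⊆ (⋃ k, (R k).set) ∪ ⋃ i, (B i).set) :
    IsDivision γ I (Sum.elim (fun x : Σ i, τ i => Q x.1 x.2) R) := by
  have hQB : ∀ i l, (Q i l).inside ⊆ (B i).inside := fun i l => Cell.inside_mono ((hQ i).1.1 l).1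
  refine ⟨IsPartial.sumElim ⟨fun x => ⟨((hQ x.1).1.1 x.2).1.trans (hBI _), ((hQ x.1).1.1 x.2).2⟩,
    ?_⟩ hR fun x k => ((hRB k x.1).mono_right (hQB _ _)).symm, ?_⟩
  · rintro ⟨i, l⟩ ⟨j, m⟩ hne
    by_cases hij : i = j
    · subst hij
      exact (hQ i).1.2 fun h => hne (congrArg (Sigma.mk i) h)
    · exact (hB hij).mono (hQB i l) (hQB j m)
  · intro p hp
    rw [iUnion_sum]
    rcases hc hp with h | h
    · exact Or.inr h
    · obtain ⟨i, hi⟩ := mem_iUnion.1 h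
      obtain ⟨l, hl⟩ := mem_iUnion.1 ((hQ i).2 hi)
      exact Or.inl (mem_iUnion.2 ⟨⟨i, l⟩, hl⟩)

theorem isDivision_unit {γ : EReal × EReal → Set (EReal × EReal)} {J : Cell}
    (hJ : J.set ⊆ γ J.tag) : IsDivision γ J.set fun _ : Unit => J :=
  ⟨⟨fun _ => ⟨subset_rfl, hJ⟩, fun _ _ hij => absurd rfl hij⟩, fun _ hp => mem_iUnion.2 ⟨(), hp⟩⟩

/-- Riemann sums. -/
def riemannSum (f : ℝ × ℝ → ℝ) {ι : Type} [Fintype ι] (P : ι → Cell) : ℝ :=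
  ∑ i, extendZero f (P i).tag * (P i).area

/-! ### Integrals over subboxes, additivity and the Saks–Henstock lemma -/

section hk
variable {f : ℝ × ℝ → ℝ} {a b c d : EReal}

theorem HasHKIntegral.exists_gauge {A : ℝ} (h : HasHKIntegral f a b c d A) {ε : ℝ} (hε : 0 < ε) :
    ∃ γ, IsGauge γ ∧ ∀ (ι : Type) [Fintype ι] (P : ι → Cell), IsDivision γ (box a b c d) P →
      |riemannSum f P - A| < ε := by
  obtain ⟨γ, hγ, hP⟩ := h ε hε
  refine ⟨γ, hγ, fun ι _ P hdiv => ?_⟩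
  have e := (Fintype.equivFin ι).symm
  have := hP _ _ (isFineDivision_iff.2 (hdiv.comp e))
  rwa [show ∑ i, extendZero f ((P ∘ e) i).tag * ((P ∘ e) i).area = riemannSum f P from
    Equiv.sum_comp e fun i => extendZero f (P i).tag * (P i).area] at this

theorem HasHKIntegral.unique {A B : ℝ} (hA : HasHKIntegral f a b c d A)
    (hB : HasHKIntegral f a b c d B) (hab : a ≤ b) (hcd : c ≤ d) : A = B := by
  refine eq_of_forall_dist_le fun ε hε => ?_
  obtain ⟨γ, hγ, h1⟩ := hA.exists_gauge (half_pos hε)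
  obtain ⟨γ', hγ', h2⟩ := hB.exists_gauge (half_pos hε)
  obtain ⟨κ, _, P, hP⟩ := exists_isDivision (hγ.inter hγ') hab hcd
  have e1 := h1 κ P (hP.mono_gauge fun _ => inter_subset_left)
  have e2 := h2 κ P (hP.mono_gauge fun _ => inter_subset_right)
  rw [abs_lt] at e1 e2
  rw [Real.dist_eq, abs_le]
  constructor <;> linarith

/-- The filter of fine divisions. -/
def divFilter (a b c d : EReal) : Filter (Σ n, Fin n → Cell) :=
  ⨅ γ ∈ {γ | IsGauge γ}, 𝓟 {P | IsFineDivision γ (box a b c d) P.2}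

theorem hasBasis_divFilter (a b c d : EReal) : (divFilter a b c d).HasBasis IsGauge
    fun γ => {P : Σ n, Fin n → Cell | IsFineDivision γ (box a b c d) P.2} := by
  refine hasBasis_biInf_principal ?_ ⟨_, isGauge_topGauge⟩
  intro γ hγ γ' hγ'
  exact ⟨_, IsGauge.inter hγ hγ',
    fun P hP => IsDivision.mono_gauge (isFineDivision_iff.1 hP) fun _ => inter_subset_left,
    fun P hP => IsDivision.mono_gauge (isFineDivision_iff.1 hP) fun _ => inter_subset_right⟩

theorem divFilter_neBot (hab : a ≤ b) (hcd : c ≤ d) : (divFilter a b c d).NeBot := by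
  refine (hasBasis_divFilter a b c d).neBot_iff.2 fun {γ} hγ => ?_
  obtain ⟨κ, _, P, hP⟩ := exists_isDivision hγ hab hcd
  exact ⟨⟨_, P ∘ (Fintype.equivFin κ).symm⟩, hP.comp _⟩

/-- With the integral written as a limit along a filter, completeness of ℝ supplies the Cauchy
criterion. -/
theorem hasHKIntegral_iff_tendsto {A : ℝ} : HasHKIntegral f a b c d A ↔
    Tendsto (fun P : Σ n, Fin n → Cell => riemannSum f P.2) (divFilter a b c d) (𝓝 A) := by
  rw [(hasBasis_divFilter a b c d).tendsto_iff Metric.nhds_basis_ball]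
  constructor
  · intro h ε hε
    obtain ⟨γ, hγ, hP⟩ := h ε hε
    exact ⟨γ, hγ, fun P hdiv => hP P.1 P.2 hdiv⟩
  · intro h ε hε
    obtain ⟨γ, hγ, hP⟩ := h ε hε
    exact ⟨γ, hγ, fun n P hdiv => hP ⟨n, P⟩ hdiv⟩

theorem riemannSum_sumElim {ι κ : Type} [Fintype ι] [Fintype κ] (P : ι → Cell) (Q : κ → Cell) :
    riemannSum f (Sum.elim P Q) = riemannSum f P + riemannSum f Q := by
  simp [riemannSum, Fintype.sum_sum_type]

theorem riemannSum_sigma {ι : Type} [Fintype ι] {τ : ι → Type} [∀ i, Fintype (τ i)]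
    (Q : ∀ i, τ i → Cell) :
    riemannSum f (fun x : Σ i, τ i => Q x.1 x.2) = ∑ i, riemannSum f (Q i) := by
  simp [riemannSum, Fintype.sum_sigma]

/-- Two fine divisions of the subbox are extended by the same completion R to fine divisions of the
whole plane. Both total sums are within ε/2 of A and R cancels, so the Riemann sums on the subbox
are Cauchy. -/
theorem HasHKIntegral.exists_subbox {A : ℝ} (h : HasHKIntegral f ⊥ ⊤ ⊥ ⊤ A) (hab : a ≤ b)
    (hcd : c ≤ d) : ∃ B, HasHKIntegral f a b c d B := by
  simp_rw [hasHKIntegral_iff_tendsto]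
  have := divFilter_neBot hab hcd
  refine cauchy_map_iff_exists_tendsto.1 (Metric.cauchy_iff.2 ⟨inferInstance, fun ε hε => ?_⟩)
  obtain ⟨γ, hγ, hS⟩ := h.exists_gauge (half_pos hε)
  refine ⟨_, image_mem_map ((hasBasis_divFilter a b c d).mem_of_mem hγ), ?_⟩
  rintro _ ⟨P, hP, rfl⟩ _ ⟨Q, hQ, rfl⟩
  set K : Cell := ⟨a, b, c, d, (a, c), hab, hcd, ⟨left_mem_Icc.2 hab, left_mem_Icc.2 hcd⟩⟩ with hK
  obtain ⟨κ, _, R, hR, hd, hc⟩ := exists_completion hγ (fun _ : Unit => K)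
    (bot_le : (⊥ : EReal) ≤ ⊤) (bot_le : (⊥ : EReal) ≤ ⊤)
  have hglue : ∀ P : Σ n, Fin n → Cell, IsDivision γ (box a b c d) P.2 →
      |riemannSum f P.2 + riemannSum f R - A| < ε / 2 := by
    intro P hP
    have := hS _ _ (IsDivision.glue (B := fun _ : Unit => K) (Q := fun _ => P.2)
      (fun _ => by rw [box_univ]; exact subset_univ _) (fun _ _ hij => absurd rfl hij)
      (fun _ => hP) hR hd hc)
    rw [riemannSum_sumElim, riemannSum_sigma (fun _ : Unit => P.2)] at this
    simpa using this
  have e1 := hglue P hP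
  have e2 := hglue Q hQ
  rw [abs_lt] at e1 e2
  rw [Real.dist_eq, abs_lt]
  constructor <;> linarith

theorem HasHKIntegral.add_fst {m : EReal} {A B C : ℝ} (ham : a ≤ m) (hmb : m ≤ b) (hcd : c ≤ d)
    (hA : HasHKIntegral f a m c d A) (hB : HasHKIntegral f m b c d B)
    (hC : HasHKIntegral f a b c d C) : C = A + B := by
  refine eq_of_forall_dist_le fun ε hε => ?_
  obtain ⟨γ₁, hγ₁, h1⟩ := hA.exists_gauge (show 0 < ε / 3 by positivity)
  obtain ⟨γ₂, hγ₂, h2⟩ := hB.exists_gauge (show 0 < ε / 3 by positivity)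
  obtain ⟨γ₃, hγ₃, h3⟩ := hC.exists_gauge (show 0 < ε / 3 by positivity)
  have hγ := (hγ₁.inter hγ₂).inter hγ₃
  obtain ⟨ι, _, P, hP⟩ := exists_isDivision hγ ham hcd
  obtain ⟨κ, _, Q, hQ⟩ := exists_isDivision hγ hmb hcd
  have e1 := h1 ι P (hP.mono_gauge fun _ => inter_subset_left.trans inter_subset_left)
  have e2 := h2 κ Q (hQ.mono_gauge fun _ => inter_subset_left.trans inter_subset_right)
  have e3 := h3 (ι ⊕ κ) (Sum.elim P Q) ⟨IsPartial.sumElim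
    (hP.1.mono (prod_mono (Icc_subset_Icc_right hmb) subset_rfl) fun _ => inter_subset_right)
    (hQ.1.mono (prod_mono (Icc_subset_Icc_left ham) subset_rfl) fun _ => inter_subset_right)
    fun i k => disjoint_inside_of_split (hP.1.1 i).1 (hQ.1.1 k).1 (Or.inl le_rfl), by
      rw [iUnion_sum]
      rintro ⟨x, y⟩ ⟨hx, hy⟩
      rcases le_total x m with h | h
      exacts [Or.inl (hP.2 ⟨⟨hx.1, h⟩, hy⟩), Or.inr (hQ.2 ⟨⟨h, hx.2⟩, hy⟩)]⟩
  rw [riemannSum_sumElim] at e3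
  rw [abs_lt] at e1 e2 e3
  rw [Real.dist_eq, abs_le]
  constructor <;> linarith

theorem HasHKIntegral.add_snd {m : EReal} {A B C : ℝ} (hab : a ≤ b) (hcm : c ≤ m) (hmd : m ≤ d)
    (hA : HasHKIntegral f a b c m A) (hB : HasHKIntegral f a b m d B)
    (hC : HasHKIntegral f a b c d C) : C = A + B := by
  refine eq_of_forall_dist_le fun ε hε => ?_
  obtain ⟨γ₁, hγ₁, h1⟩ := hA.exists_gauge (show 0 < ε / 3 by positivity)
  obtain ⟨γ₂, hγ₂, h2⟩ := hB.exists_gauge (show 0 < ε / 3 by positivity)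
  obtain ⟨γ₃, hγ₃, h3⟩ := hC.exists_gauge (show 0 < ε / 3 by positivity)
  have hγ := (hγ₁.inter hγ₂).inter hγ₃
  obtain ⟨ι, _, P, hP⟩ := exists_isDivision hγ hab hcm
  obtain ⟨κ, _, Q, hQ⟩ := exists_isDivision hγ hab hmd
  have e1 := h1 ι P (hP.mono_gauge fun _ => inter_subset_left.trans inter_subset_left)
  have e2 := h2 κ Q (hQ.mono_gauge fun _ => inter_subset_left.trans inter_subset_right)
  have e3 := h3 (ι ⊕ κ) (Sum.elim P Q) ⟨IsPartial.sumElim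
    (hP.1.mono (prod_mono subset_rfl (Icc_subset_Icc_right hmd)) fun _ => inter_subset_right)
    (hQ.1.mono (prod_mono subset_rfl (Icc_subset_Icc_left hcm)) fun _ => inter_subset_right)
    fun i k => disjoint_inside_of_split (hP.1.1 i).1 (hQ.1.1 k).1 (Or.inr le_rfl), by
      rw [iUnion_sum]
      rintro ⟨x, y⟩ ⟨hx, hy⟩
      rcases le_total y m with h | h
      exacts [Or.inl (hP.2 ⟨hx, ⟨hy.1, h⟩⟩), Or.inr (hQ.2 ⟨hx, ⟨h, hy.2⟩⟩)]⟩
  rw [riemannSum_sumElim] at e3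
  rw [abs_lt] at e1 e2 e3
  rw [Real.dist_eq, abs_le]
  constructor <;> linarith

/-- An integral over subboxes is given by the increments of a point function. -/
theorem HasHKIntegral.exists_pointFun {A : ℝ} (h : HasHKIntegral f ⊥ ⊤ ⊥ ⊤ A) :
    ∃ F : EReal × EReal → ℝ, (∀ s, F (⊥, s) = 0 ∧ F (s, ⊥) = 0) ∧
      ∀ a b c d : EReal, a ≤ b → c ≤ d → HasHKIntegral f a b c d (incr F a b c d) := by
  choose V hV using fun (a b c d : EReal) (hab : a ≤ b) (hcd : c ≤ d) => h.exists_subbox hab hcd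
  -- A degenerate box splits into two copies of itself, so its integral V satisfies V = V + V.
  have hzx : ∀ s t : EReal, ∀ hst : s ≤ t, V ⊥ ⊥ s t le_rfl hst = 0 := fun s t hst => by
    have e := (hV ⊥ ⊥ s t le_rfl hst).add_fst le_rfl le_rfl hst (hV ⊥ ⊥ s t le_rfl hst)
      (hV ⊥ ⊥ s t le_rfl hst)
    linarith
  have hzy : ∀ s t : EReal, ∀ hst : s ≤ t, V s t ⊥ ⊥ hst le_rfl = 0 := fun s t hst => by
    have e := (hV s t ⊥ ⊥ hst le_rfl).add_snd hst le_rfl le_rfl (hV s t ⊥ ⊥ hst le_rfl)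
      (hV s t ⊥ ⊥ hst le_rfl)
    linarith
  refine ⟨fun z => V ⊥ z.1 ⊥ z.2 bot_le bot_le, fun s => ⟨hzx _ _ _, hzy _ _ _⟩, ?_⟩
  intro a b c d hab hcd
  have e1 := (hV ⊥ a c d bot_le hcd).add_fst bot_le hab hcd (hV a b c d hab hcd)
    (hV ⊥ b c d bot_le hcd)
  have e2 := (hV ⊥ b ⊥ c bot_le bot_le).add_snd bot_le bot_le hcd (hV ⊥ b c d bot_le hcd)
    (hV ⊥ b ⊥ d bot_le bot_le)
  have e3 := (hV ⊥ a ⊥ c bot_le bot_le).add_snd bot_le bot_le hcd (hV ⊥ a c d bot_le hcd)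
    (hV ⊥ a ⊥ d bot_le bot_le)
  have e : incr (fun z => V ⊥ z.1 ⊥ z.2 bot_le bot_le) a b c d = V a b c d hab hcd := by
    simp only [incr]
    linarith
  rw [e]
  exact hV a b c d hab hcd

theorem sum_abs_le_of_sum_subset_le {ι : Type} [Fintype ι] {x : ι → ℝ} {C : ℝ}
    (h : ∀ s : Finset ι, |∑ i ∈ s, x i| ≤ C) : ∑ i, |x i| ≤ 2 * C := by
  classical
  rw [← Finset.sum_filter_add_sum_filter_not Finset.univ (fun i => 0 ≤ x i)]
  have h1 := (abs_le.1 (h (Finset.univ.filter fun i => 0 ≤ x i))).2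
  have h2 := (abs_le.1 (h (Finset.univ.filter fun i => ¬ 0 ≤ x i))).1
  rw [Finset.sum_congr rfl fun i hi => abs_of_nonneg (Finset.mem_filter.1 hi).2,
    Finset.sum_congr (f := fun i => |x i|) rfl fun i hi =>
      abs_of_neg (not_le.1 (Finset.mem_filter.1 hi).2), Finset.sum_neg_distrib]
  linarith

/-- The Saks–Henstock lemma. -/
theorem HasHKIntegral.isHKPrimitive {A : ℝ} (h : HasHKIntegral f ⊥ ⊤ ⊥ ⊤ A)
    {F : EReal × EReal → ℝ}
    (hF : ∀ a b c d : EReal, a ≤ b → c ≤ d → HasHKIntegral f a b c d (incr F a b c d)) :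
    IsHKPrimitive f F := by
  intro ε hε
  obtain ⟨γ, hγ, hS⟩ := h.exists_gauge (show 0 < ε / 4 by positivity)
  refine ⟨γ, hγ, fun ι _ P hP => ?_⟩
  -- Two divisions share the completion R: one uses the selected cells themselves, the other refines
  -- each by a division whose Riemann sum is within η of the increment. Each total is within ε/4 of
  -- A, so the selected errors sum to at most ε/2 + δ for every δ. Absolute values then cost a
  -- factor 2.
  have key : ∀ s : Finset ι,
      |∑ i ∈ s, (extendZero f (P i).tag * (P i).area - (P i).incr F)| ≤ ε / 2 := by
    intro s
    refine le_of_forall_pos_le_add fun δ hδ => ?_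
    set B : s → Cell := fun i => P i with hB
    have hBP : IsPartial γ univ B := hP.comp Subtype.val_injective
    obtain ⟨κ, _, R, hR, hd, hc⟩ := exists_completion hγ B
      (bot_le : (⊥ : EReal) ≤ ⊤) (bot_le : (⊥ : EReal) ≤ ⊤)
    set η : ℝ := δ / ((Fintype.card s : ℝ) + 1) with hη
    have hη0 : 0 < η := by positivity
    choose γ' hγ' hS' using fun i : s => (hF _ _ _ _ (B i).hab (B i).hcd).exists_gauge hη0
    choose τ hτ Q hQ using fun i : s => exists_isDivision (hγ.inter (hγ' i)) (B i).hab (B i).hcd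
    have hBI : ∀ i, (B i).set ⊆ box ⊥ ⊤ ⊥ ⊤ := fun i => by rw [box_univ]; exact subset_univ _
    have e1 := hS _ _ (IsDivision.glue (Q := fun i (_ : Unit) => B i) hBI hBP.2
      (fun i => isDivision_unit (hBP.1 i).2) hR hd hc)
    have e2 := hS _ _ (IsDivision.glue (Q := Q) hBI hBP.2
      (fun i => (hQ i).mono_gauge fun _ => inter_subset_left) hR hd hc)
    rw [riemannSum_sumElim, riemannSum_sigma (fun i (_ : Unit) => B i)] at e1
    rw [riemannSum_sumElim, riemannSum_sigma Q] at e2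
    have e3 : |∑ i, (riemannSum f (Q i) - (B i).incr F)| ≤ δ := by
      refine (Finset.abs_sum_le_sum_abs _ _).trans ?_
      calc ∑ i, |riemannSum f (Q i) - (B i).incr F| ≤ ∑ _i : s, η :=
            Finset.sum_le_sum fun i _ =>
              (hS' i _ _ ((hQ i).mono_gauge fun _ => inter_subset_right)).le
        _ = Fintype.card s * η := by simp
        _ ≤ δ := by
          rw [hη, mul_div_assoc', div_le_iff₀ (by positivity)]
          nlinarith
    rw [Finset.sum_sub_distrib] at e3
    have e4 : ∑ i ∈ s, (extendZero f (P i).tag * (P i).area - (P i).incr F) =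
        ∑ i, riemannSum f (fun _ : Unit => B i) - ∑ i, (B i).incr F := by
      rw [← Finset.sum_coe_sort s, Finset.sum_sub_distrib]
      congr 1
      exact Finset.sum_congr rfl fun i _ => by simp [riemannSum, hB]
    rw [e4]
    rw [abs_lt] at e1 e2
    rw [abs_le] at e3 ⊢
    constructor <;> linarith [e3.1, e3.2]
  linarith [sum_abs_le_of_sum_subset_le key]

end hk

/-! ### Continuity of the Henstock–Kurzweil primitive -/

/-- Fine divisions of a segment `{x₀} × [c, d]`, thickened. -/
theorem exists_strip {γ : EReal × EReal → Set (EReal × EReal)} (hγ : IsGauge γ) (x₀ : EReal)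
    {c d : EReal} (hcd : c ≤ d) :
    ∃ (ι : Type) (_ : Fintype ι) (u v t : ι → EReal), ∃ U ∈ 𝓝 x₀,
      (∀ i, c ≤ u i ∧ u i ≤ t i ∧ t i ≤ v i ∧ v i ≤ d ∧ U ×ˢ Icc (u i) (v i) ⊆ γ (x₀, t i)) ∧
      (Pairwise fun i j => Disjoint (Ioo (u i) (v i)) (Ioo (u j) (v j))) ∧
      ∀ g : EReal → ℝ, ∑ i, (g (v i) - g (u i)) = g d - g c := by
  refine cousin_line (P := fun c d => ∃ (ι : Type) (_ : Fintype ι) (u v t : ι → EReal), ∃ U ∈ 𝓝 x₀,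
      (∀ i, c ≤ u i ∧ u i ≤ t i ∧ t i ≤ v i ∧ v i ≤ d ∧ U ×ˢ Icc (u i) (v i) ⊆ γ (x₀, t i)) ∧
      (Pairwise fun i j => Disjoint (Ioo (u i) (v i)) (Ioo (u j) (v j))) ∧
      ∀ g : EReal → ℝ, ∑ i, (g (v i) - g (u i)) = g d - g c) ?_ ?_ hcd
  · rintro c m d hcm hmd ⟨ι, _, u, v, t, U, hU, h1, h2, h3⟩ ⟨ι', _, u', v', t', U', hU', h1', h2', h3'⟩
    refine ⟨ι ⊕ ι', inferInstance, Sum.elim u u', Sum.elim v v', Sum.elim t t', U ∩ U',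
      inter_mem hU hU', ?_, ?_, ?_⟩
    · rintro (i | i)
      · obtain ⟨e1, e2, e3, e4, e5⟩ := h1 i
        exact ⟨e1, e2, e3, e4.trans hmd, (prod_mono inter_subset_left subset_rfl).trans e5⟩
      · obtain ⟨e1, e2, e3, e4, e5⟩ := h1' i
        exact ⟨hcm.trans e1, e2, e3, e4, (prod_mono inter_subset_right subset_rfl).trans e5⟩
    · have hdis : ∀ i j, Disjoint (Ioo (u i) (v i)) (Ioo (u' j) (v' j)) := fun i j =>
        Set.disjoint_left.2 fun x hx hx' =>
          ((hx.2.trans_le (h1 i).2.2.2.1).trans_le (h1' j).1).not_gt hx'.1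
      rintro (i | i) (j | j) hne
      · exact h2 fun h => hne (by rw [h])
      · exact hdis i j
      · exact (hdis j i).symm
      · exact h2' fun h => hne (by rw [h])
    · intro g
      rw [Fintype.sum_sum_type]
      simp only [Sum.elim_inl, Sum.elim_inr, h3 g, h3' g]
      ring
  · intro t
    obtain ⟨U, hU, V, hV, hUV⟩ := mem_nhds_prod_iff.1 ((hγ (x₀, t)).1.mem_nhds (hγ (x₀, t)).2.1)
    refine ⟨V, hV, fun c d hcd hs ht => ⟨Unit, inferInstance, fun _ => c, fun _ => d, fun _ => t, U,
      hU, fun _ => ⟨le_rfl, ?_, ?_, le_rfl, (prod_mono subset_rfl hs).trans hUV⟩,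
      fun _ _ hij => absurd rfl hij, by simp⟩⟩
    · rcases ht with h | h <;> simp [h, hcd]
    · rcases ht with h | h <;> simp [h, hcd]

/-- The strip between x₀ and x is cut into fine cells with tags on {x₀} × [-∞, ∞], and these are
truncated at height y. Their increments sum to ±(F(x, y) - F(x₀, y)). The Saks–Henstock errors total
at most 4·ε/8, and the Riemann sum is at most |x - x₀|·C with C independent of x and y. Hence the
estimate is uniform in y. -/
theorem IsHKPrimitive.eventually_fst {f : ℝ × ℝ → ℝ} {F : EReal × EReal → ℝ}
    (h : IsHKPrimitive f F) (hF : ∀ s, F (s, ⊥) = 0) (x₀ : EReal) {ε : ℝ} (hε : 0 < ε) :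
    ∀ᶠ x in 𝓝 x₀, ∀ y, |F (x, y) - F (x₀, y)| ≤ ε := by
  obtain ⟨γ, hγ, hS⟩ := h (ε / 8) (by positivity)
  obtain ⟨ι, _, u, v, t, U, hU, h1, h2, h3⟩ := exists_strip hγ x₀ (bot_le : (⊥ : EReal) ≤ ⊤)
  set C := ∑ i, |extendZero f (x₀, t i)| * ((v i).toReal - (u i).toReal) with hC
  -- At x₀ = ±∞ `toReal` is not continuous, but all tags are then at infinity, the integrand is 0
  -- there, and C = 0.
  have hclose : ∀ᶠ x in 𝓝 x₀, |x.toReal - x₀.toReal| * C ≤ ε / 2 := by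
    by_cases hx : x₀ = ⊥ ∨ x₀ = ⊤
    · have : C = 0 := by
        refine Finset.sum_eq_zero fun i _ => ?_
        rw [extendZero_of_notMem, abs_zero, zero_mul]
        rintro ⟨p, hp⟩
        have hp1 : (p.1 : EReal) = x₀ := congrArg Prod.fst hp
        rcases hx with h | h
        · rw [h] at hp1; exact EReal.coe_ne_bot _ hp1
        · rw [h] at hp1; exact EReal.coe_ne_top _ hp1
      rw [this]
      exact Eventually.of_forall fun x => by simp; positivity
    · rw [not_or] at hx
      have ht : Tendsto (fun x : EReal => |x.toReal - x₀.toReal| * C) (𝓝 x₀)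
          (𝓝 (|x₀.toReal - x₀.toReal| * C)) :=
        (((EReal.tendsto_toReal hx.2 hx.1).sub_const _).abs).mul_const _
      rw [sub_self, abs_zero, zero_mul] at ht
      exact (ht.eventually_lt_const (half_pos hε)).mono fun x hx => hx.le
  -- Membership in the order-connected component means that the whole interval between x₀ and x lies
  -- in U, so the cells of the strip are fine.
  filter_upwards [hclose, ordConnectedComponent_mem_nhds.2 hU] with x hx hxU y
  rw [mem_ordConnectedComponent] at hxU
  set P : ι → Cell := fun i => ⟨min x₀ x, max x₀ x, u i, v i, (x₀, t i), min_le_max,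
    (h1 i).2.1.trans (h1 i).2.2.1,
    ⟨⟨min_le_left _ _, le_max_left _ _⟩, (h1 i).2.1, (h1 i).2.2.1⟩⟩ with hP
  have hPp : IsPartial γ univ P := by
    refine ⟨fun i => ⟨subset_univ _, ?_⟩, fun i j hij => ?_⟩
    · exact (prod_mono hxU subset_rfl).trans (h1 i).2.2.2.2
    · exact Set.disjoint_left.2 fun p hp hp' => Set.disjoint_left.1 (h2 hij) hp.2 hp'.2
  have hfin : ∀ i, extendZero f (x₀, t i) ≠ 0 → ∃ a b c d : ℝ, (P i).a = a ∧ (P i).b = b ∧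
      (P i).c = c ∧ (P i).d = d ∧ a ≤ b ∧ c ≤ d := fun i hi =>
    hγ.exists_real (hPp.1 i).2 (by_contra fun hn => hi (extendZero_of_notMem f hn))
  have htr := sum_abs_truncate_le (P := P)
    (Φ := fun i z => extendZero f (x₀, t i) * areaFun z - F z) (C := ε / 8) (fun P' hP' => by
      have h1 := hS ι P' (hPp.shrink hP')
      simp only [(hP' _).1] at h1
      refine le_trans (le_of_eq (Finset.sum_congr rfl fun i _ => ?_)) h1
      rw [Cell.incr, incr_lin, ← Cell.incr, Cell.incr_areaFun]
      rfl) ⊤ y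
  simp only [incr_lin, hP, min_eq_left le_top] at htr
  have harea : ∀ i, |extendZero f (x₀, t i) * incr areaFun (min x₀ x) (max x₀ x) (min (u i) y)
      (min (v i) y)| ≤ |x.toReal - x₀.toReal| *
        (|extendZero f (x₀, t i)| * ((v i).toReal - (u i).toReal)) := by
    intro i
    by_cases h0 : extendZero f (x₀, t i) = 0
    · simp [h0]
    obtain ⟨a, b, c, d, ha, hb, hc, hd, hab, hcd⟩ := hfin i h0
    simp only [hP] at ha hb hc hd
    have hx0 : x₀ ∈ Icc (a : EReal) b := by rw [← ha, ← hb]; exact ⟨min_le_left _ _, le_max_left _ _⟩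
    have hxx : x ∈ Icc (a : EReal) b := by rw [← ha, ← hb]; exact ⟨min_le_right _ _, le_max_right _ _⟩
    have hreal : ∀ w ∈ Icc (a : EReal) b, ∃ r : ℝ, w = r := fun w hw =>
      ⟨w.toReal, (EReal.coe_toReal (ne_top_of_le_ne_top (EReal.coe_ne_top b) hw.2)
        (ne_bot_of_le_ne_bot (EReal.coe_ne_bot a) hw.1)).symm⟩
    obtain ⟨r₀, hr₀⟩ := hreal x₀ hx0
    obtain ⟨r, hr⟩ := hreal x hxx
    have hwidth : |(max x₀ x).toReal - (min x₀ x).toReal| = |x.toReal - x₀.toReal| := by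
      rw [hr, hr₀]
      rcases le_total r₀ r with h | h
      · rw [max_eq_right (EReal.coe_le_coe_iff.2 h), min_eq_left (EReal.coe_le_coe_iff.2 h)]
      · rw [max_eq_left (EReal.coe_le_coe_iff.2 h), min_eq_right (EReal.coe_le_coe_iff.2 h),
          abs_sub_comm]
    have hheight : |(min (v i) y).toReal - (min (u i) y).toReal| ≤ (v i).toReal - (u i).toReal := by
      rw [hc, hd, EReal.toReal_coe, EReal.toReal_coe]
      induction y with
      | bot => simpa using hcd
      | top => simp [abs_of_nonneg (sub_nonneg.2 hcd)]
      | coe y =>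
        rw [toReal_min_coe, toReal_min_coe, abs_of_nonneg (sub_nonneg.2 (min_le_min_right _ hcd))]
        rcases le_total d y with h1 | h1 <;> rcases le_total c y with h2 | h2 <;>
          simp [h1, h2] <;> linarith
    rw [abs_mul, incr_areaFun, abs_mul, hwidth]
    calc _ = |x.toReal - x₀.toReal| * (|extendZero f (x₀, t i)| *
          |(min (v i) y).toReal - (min (u i) y).toReal|) := by ring
      _ ≤ _ := by gcongr
  have htel := h3 fun s => F (max x₀ x, min s y) - F (min x₀ x, min s y)
  simp only [bot_inf_eq, top_inf_eq, hF, sub_zero] at htel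
  have hsum : ∑ i, incr F (min x₀ x) (max x₀ x) (min (u i) y) (min (v i) y) =
      F (max x₀ x, y) - F (min x₀ x, y) := by
    rw [← htel]
    refine Finset.sum_congr rfl fun i _ => ?_
    simp only [incr]
    ring
  have hmm : |F (x, y) - F (x₀, y)| = |F (max x₀ x, y) - F (min x₀ x, y)| := by
    rcases le_total x₀ x with h | h
    · rw [max_eq_right h, min_eq_left h]
    · rw [max_eq_left h, min_eq_right h, abs_sub_comm]
  rw [hmm, ← hsum]
  have e1 : ∀ i, |incr F (min x₀ x) (max x₀ x) (min (u i) y) (min (v i) y)| ≤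
      |extendZero f (x₀, t i) * incr areaFun (min x₀ x) (max x₀ x) (min (u i) y) (min (v i) y) -
        incr F (min x₀ x) (max x₀ x) (min (u i) y) (min (v i) y)| +
      |x.toReal - x₀.toReal| * (|extendZero f (x₀, t i)| * ((v i).toReal - (u i).toReal)) := by
    intro i
    have := abs_sub_abs_le_abs_sub (incr F (min x₀ x) (max x₀ x) (min (u i) y) (min (v i) y))
      (extendZero f (x₀, t i) * incr areaFun (min x₀ x) (max x₀ x) (min (u i) y) (min (v i) y))
    rw [abs_sub_comm] at this
    linarith [harea i]
  refine (Finset.abs_sum_le_sum_abs _ _).trans ((Finset.sum_le_sum fun i _ => e1 i).trans ?_)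
  rw [Finset.sum_add_distrib, ← Finset.mul_sum]
  linarith

/-- The reflection of a cell in the diagonal. -/
def Cell.swap (J : Cell) : Cell :=
  ⟨J.c, J.d, J.a, J.b, J.tag.swap, J.hcd, J.hab, ⟨J.tag_mem.2, J.tag_mem.1⟩⟩

theorem Cell.swap_set (J : Cell) : J.swap.set = Prod.swap ⁻¹' J.set := by
  ext ⟨x, y⟩
  exact and_comm

theorem swap_mem_finitePlane {p : EReal × EReal} : p.swap ∈ finitePlane ↔ p ∈ finitePlane := by
  constructor
  · rintro ⟨q, hq⟩
    exact ⟨q.swap, Prod.swap_injective hq⟩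
  · rintro ⟨q, rfl⟩
    exact ⟨q.swap, rfl⟩

theorem extendZero_swap (f : ℝ × ℝ → ℝ) (p : EReal × EReal) :
    extendZero (f ∘ Prod.swap) p = extendZero f p.swap := by
  by_cases h : p ∈ finitePlane
  · rw [extendZero, if_pos h, extendZero, if_pos (swap_mem_finitePlane.2 h)]
    rfl
  · rw [extendZero_of_notMem _ h, extendZero_of_notMem _ fun h' => h (swap_mem_finitePlane.1 h')]

theorem IsHKPrimitive.swap {f : ℝ × ℝ → ℝ} {F : EReal × EReal → ℝ} (h : IsHKPrimitive f F) :
    IsHKPrimitive (f ∘ Prod.swap) (F ∘ Prod.swap) := by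
  intro ε hε
  obtain ⟨γ, hγ, hS⟩ := h ε hε
  refine ⟨fun p => Prod.swap ⁻¹' γ p.swap, fun p => ⟨(hγ _).1.preimage continuous_swap, (hγ _).2.1,
    fun hp q hq => swap_mem_finitePlane.1 ((hγ _).2.2 (swap_mem_finitePlane.2 hp) hq)⟩,
    fun ι _ P hP => ?_⟩
  have hP' : IsPartial γ univ fun i => (P i).swap := by
    refine ⟨fun i => ⟨subset_univ _, ?_⟩, fun i j hij => ?_⟩
    · rw [Cell.swap_set]
      intro q hq
      exact (hP.1 i).2 hq
    · exact Set.disjoint_left.2 fun p hp hp' =>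
        Set.disjoint_left.1 (hP.2 hij) (show p.swap ∈ _ from ⟨hp.2, hp.1⟩) ⟨hp'.2, hp'.1⟩
  refine le_trans (le_of_eq (Finset.sum_congr rfl fun i _ => ?_)) (hS ι _ hP')
  rw [extendZero_swap]
  simp only [Cell.incr, Cell.area, Cell.swap, incr, Function.comp, Prod.swap]
  ring_nf

/-- Continuity in x uniformly in y, together with the same statement reflected in the diagonal,
gives joint continuity. -/
theorem IsHKPrimitive.continuous {f : ℝ × ℝ → ℝ} {F : EReal × EReal → ℝ}
    (h : IsHKPrimitive f F) (hF : ∀ s, F (⊥, s) = 0 ∧ F (s, ⊥) = 0) : Continuous F := by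
  refine continuous_iff_continuousAt.2 fun z => Metric.tendsto_nhds.2 fun ε hε => ?_
  obtain ⟨x₀, y₀⟩ := z
  have h1 := h.eventually_fst (fun s => (hF s).2) x₀ (show 0 < ε / 3 by positivity)
  have h2 := h.swap.eventually_fst (fun s => (hF s).1) y₀ (show 0 < ε / 3 by positivity)
  rw [nhds_prod_eq]
  filter_upwards [h1.prod_mk h2] with z hz
  obtain ⟨x, y⟩ := z
  have e1 := hz.1 y
  have e2 := hz.2 x₀
  simp only [Function.comp, Prod.swap] at e2
  rw [Real.dist_eq]
  linarith [abs_sub_le (F (x, y)) (F (x₀, y)) (F (x₀, y₀))]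

theorem hk_cpi {f : ℝ × ℝ → ℝ} (hf : ∃ A, HasHKIntegral f ⊥ ⊤ ⊥ ⊤ A) :
    ∃ T ∈ Ac, (∀ φ : Test, ∀ A, HasHKIntegral (fun p => f p * φ p) ⊥ ⊤ ⊥ ⊤ A ↔ A = T φ) ∧
      ∀ a b c d : EReal, a ≤ b → c ≤ d → ∀ A, HasHKIntegral f a b c d A ↔ A = cpi T a b c d := by
  obtain ⟨A, hA⟩ := hf
  obtain ⟨F, hF0, hF⟩ := hA.exists_pointFun
  have hprim := hA.isHKPrimitive hF
  set G : C(EReal × EReal, ℝ) := ⟨F, hprim.continuous hF0⟩ with hG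
  have hGB : G ∈ Bc := hF0
  have hprim' : IsHKPrimitive f G := hprim
  refine ⟨d12 G, ⟨G, hGB, rfl⟩, fun φ B => ?_, fun a b c d hab hcd B => ?_⟩
  · have h := (hprim'.mul_test φ).hasHKIntegral (bot_le : (⊥ : EReal) ≤ ⊤) (bot_le : (⊥ : EReal) ≤ ⊤)
    rw [incr_mulPrim_univ φ hGB] at h
    exact ⟨fun hB => hB.unique h bot_le bot_le, fun hB => hB ▸ h⟩
  · rw [cpi_d12 hGB]
    exact ⟨fun hB => hB.unique (hF a b c d hab hcd) hab hcd, fun hB => hB ▸ hF a b c d hab hcd⟩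

/-! ### Generalised absolute continuity -/

section ac
variable {F : EReal × EReal → ℝ} {I E : Set (EReal × EReal)}

theorem IsACOn.exists_gauge (h : IsACOn F I E) {ε : ℝ} (hε : 0 < ε) :
    ∃ η > 0, ∃ γ, IsGauge γ ∧ ∀ (ι : Type) [Fintype ι] (P : ι → Cell), IsPartial γ I P →
      (∀ i, (P i).tag ∈ E) → ∑ i, (P i).area < η → ∑ i, |(P i).incr F| < ε := by
  obtain ⟨η, hη, γ, hγ, hP⟩ := h ε hε
  refine ⟨η, hη, γ, hγ, fun ι _ P hpart htag harea => ?_⟩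
  have e := (Fintype.equivFin ι).symm
  have := hP _ _ (isFinePartialDivision_iff.2 (hpart.comp e.injective)) (fun i => htag (e i))
    (lt_of_eq_of_lt (Equiv.sum_comp e fun i => (P i).area) harea)
  exact lt_of_eq_of_lt (Equiv.sum_comp e fun i => |(P i).incr F|).symm this

theorem IsNegligibleOn.exists_gauge (h : IsNegligibleOn F I E) {ε : ℝ} (hε : 0 < ε) :
    ∃ γ, IsGauge γ ∧ ∀ (ι : Type) [Fintype ι] (P : ι → Cell), IsPartial γ I P →
      (∀ i, (P i).tag ∈ E) → ∑ i, |(P i).incr F| < ε := by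
  obtain ⟨γ, hγ, hP⟩ := h ε hε
  refine ⟨γ, hγ, fun ι _ P hpart htag => ?_⟩
  have e := (Fintype.equivFin ι).symm
  have := hP _ _ (isFinePartialDivision_iff.2 (hpart.comp e.injective)) (fun i => htag (e i))
  exact lt_of_eq_of_lt (Equiv.sum_comp e fun i => |(P i).incr F|).symm this

theorem IsACG.mono {I' : Set (EReal × EReal)} (h : IsACG F I) (hI : I' ⊆ I) : IsACG F I' := by
  obtain ⟨⟨E, hE, hAC⟩, hN⟩ := h
  refine ⟨⟨E, (inter_subset_inter_left _ hI).trans hE, fun n => ⟨(hAC n).1, fun ε hε => ?_⟩⟩,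
    fun ε hε => ?_⟩
  · obtain ⟨η, hη, γ, hγ, hP⟩ := (hAC n).2 ε hε
    exact ⟨η, hη, γ, hγ, fun m P hpart =>
      hP m P ((isFinePartialDivision_iff.1 hpart).mono hI fun _ => subset_rfl)⟩
  · obtain ⟨γ, hγ, hP⟩ := hN ε hε
    exact ⟨γ, hγ, fun m P hpart htag =>
      hP m P ((isFinePartialDivision_iff.1 hpart).mono hI fun _ => subset_rfl)
        fun i => ⟨hI (htag i).1, (htag i).2⟩⟩

theorem IsACG.congr {G : EReal × EReal → ℝ} (h : IsACG F I) (hG : ∀ J : Cell, J.incr G = J.incr F) :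
    IsACG G I := by
  obtain ⟨⟨E, hE, hAC⟩, hN⟩ := h
  refine ⟨⟨E, hE, fun n => ⟨(hAC n).1, ?_⟩⟩, ?_⟩
  · simpa only [IsACOn, hG] using (hAC n).2
  · simpa only [IsNegligibleOn, hG] using hN

end ac

theorem Cell.area_mono {J K : Cell} (h : J.set ⊆ K.set) (hK : K.set ⊆ finitePlane) :
    J.area ≤ K.area := by
  obtain ⟨a, b, c, d, h1, h2, h3, h4, h5, h6⟩ := Cell.exists_real (h.trans hK)
  obtain ⟨a', b', c', d', h1', h2', h3', h4', h5', h6'⟩ := Cell.exists_real hK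
  have := (box_subset_box_iff J.hab J.hcd).1 h
  simp only [h1, h2, h3, h4, h1', h2', h3', h4', EReal.coe_le_coe_iff] at this
  simp only [Cell.area, h1, h2, h3, h4, h1', h2', h3', h4', EReal.toReal_coe]
  exact mul_le_mul (by linarith [this.1.1, this.1.2]) (by linarith [this.2.1, this.2.2])
    (by linarith) (by linarith)

theorem sum_abs_incr_mulPrim_le (φ : Test) (F : C(EReal × EReal, ℝ)) {ι : Type} [Fintype ι]
    {P : ι → Cell} {C : ℝ}
    (h : ∀ P' : ι → Cell, (∀ i, (P' i).tag = (P i).tag ∧ (P' i).set ⊆ (P i).set) →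
      ∑ i, |(P' i).incr F| ≤ C) :
    ∑ i, |(P i).incr (mulPrim φ F)| ≤ 4 * C * ∫ q, |mixed φ q| :=
  (Finset.sum_le_sum fun _ _ => abs_incr_mulPrim_le φ F _ _ _ _).trans
    (sum_integral_truncate_le φ (Φ := fun _ => F) (fun _ => continuous_incr_truncate F _ _ _ _) h)

theorem four_mul_div_lt {ε M : ℝ} (hε : 0 < ε) (hM : 0 ≤ M) : 4 * (ε / (4 * M + 1)) * M < ε := by
  rw [mul_div_assoc', div_mul_eq_mul_div, div_lt_iff₀ (by positivity)]
  nlinarith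

/-- The same covering sets and gauges serve, with ε divided by 4∫|∂₁₂φ| + 1: shrunken cells keep
their tags and do not gain area, so the hypothesis on F applies to them and the truncation
inequality concludes. -/
theorem IsACG.mulPrim {F : C(EReal × EReal, ℝ)} {I : Set (EReal × EReal)} (h : IsACG F I)
    (φ : Test) : IsACG (mulPrim φ F) I := by
  obtain ⟨⟨E, hE, hAC⟩, hN⟩ := h
  have hM : 0 ≤ ∫ q, |mixed φ q| := integral_nonneg fun q => abs_nonneg _
  refine ⟨⟨E, hE, fun n => ⟨(hAC n).1, fun ε hε => ?_⟩⟩, fun ε hε => ?_⟩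
  · obtain ⟨η, hη, γ, hγ, hP⟩ := (hAC n).2.exists_gauge
      (show 0 < ε / (4 * (∫ q, |mixed φ q|) + 1) by positivity)
    refine ⟨η, hη, γ, hγ, fun m P hpart htag harea => ?_⟩
    have hpart' : IsPartial γ I P := hpart
    refine (sum_abs_incr_mulPrim_le φ F fun P' hP' => (hP _ P' (hpart'.shrink hP')
      (fun i => by rw [(hP' i).1]; exact htag i) (lt_of_le_of_lt ?_ harea)).le).trans_lt
      (four_mul_div_lt hε hM)
    exact Finset.sum_le_sum fun i _ => Cell.area_mono (hP' i).2
      ((hpart'.1 i).2.trans ((hγ _).2.2 ((hAC n).1 (htag i))))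
  · obtain ⟨γ, hγ, hP⟩ := hN.exists_gauge
      (show 0 < ε / (4 * (∫ q, |mixed φ q|) + 1) by positivity)
    refine ⟨γ, hγ, fun m P hpart htag => ?_⟩
    have hpart' : IsPartial γ I P := hpart
    exact (sum_abs_incr_mulPrim_le φ F fun P' hP' => (hP _ P' (hpart'.shrink hP')
      (fun i => by rw [(hP' i).1]; exact htag i)).le).trans_lt (four_mul_div_lt hε hM)

/-! ### Interval derivatives -/

/-- Near a point of differentiability, increments over thin intervals are also controlled. -/
theorem abs_incr_le_of_regular {Φ : EReal × EReal → ℝ} {s t l B : ℝ} (hl : 0 < l)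
    (h : ∀ a b c d : ℝ, a ≤ s → s ≤ b → c ≤ t → t ≤ d → l ≤ b - a → b - a ≤ 2 * l →
      l ≤ d - c → d - c ≤ 2 * l → |incr Φ a b c d| ≤ B)
    {a b c d : ℝ} (ha : a ≤ s) (hb : s ≤ b) (hc : c ≤ t) (hd : t ≤ d) (hba : b - a ≤ l)
    (hdc : d - c ≤ l) : |incr Φ a b c d| ≤ 9 * B := by
  have habs : ∀ {x y z K : ℝ}, |x| ≤ K → |y| ≤ K → |z| ≤ K → |x + y - z| ≤ 3 * K := by
    intro x y z K hx hy hz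
    rw [abs_le] at *
    constructor <;> linarith [hx.1, hx.2, hy.1, hy.2, hz.1, hz.2]
  have hy : ∀ a b : ℝ, a ≤ s → s ≤ b → l ≤ b - a → b - a ≤ 2 * l →
      |incr Φ a b c d| ≤ 3 * B := by
    intro a b ha hb h1 h2
    -- The interval [c, d] is written as [t-l, d] + [c, t+l] - [t-l, t+l]; all three contain t and
    -- have length between l and 2l. Three terms in each variable account for the factor 9.
    have e : incr Φ a b c d = incr Φ a b (t - l : ℝ) d + incr Φ a b c (t + l : ℝ) -
        incr Φ a b (t - l : ℝ) (t + l : ℝ) := by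
      simp only [incr]
      ring
    rw [e]
    exact habs (h a b _ _ ha hb (by linarith) hd h1 h2 (by linarith) (by linarith))
      (h a b _ _ ha hb hc (by linarith) h1 h2 (by linarith) (by linarith))
      (h a b _ _ ha hb (by linarith) (by linarith) h1 h2 (by linarith) (by linarith))
  have e : incr Φ a b c d = incr Φ (s - l : ℝ) b c d + incr Φ a (s + l : ℝ) c d -
      incr Φ (s - l : ℝ) (s + l : ℝ) c d := by
    simp only [incr]
    ring
  rw [e]
  refine (habs (hy _ _ (by linarith) hb (by linarith) (by linarith))
    (hy _ _ ha (by linarith) (by linarith) (by linarith))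
    (hy _ _ (by linarith) (by linarith) (by linarith) (by linarith))).trans_eq (by ring)

theorem incr_areaFun_coe (a b c d : ℝ) : incr areaFun a b c d = (b - a) * (d - c) := by
  simp [incr_areaFun]

/-- Truncation produces subcells of J containing p that may be arbitrarily thin, where the
derivative of F says nothing directly. `abs_incr_le_of_regular` bounds their increments of L·area -
F by those over intervals with sides between l and 2l, l being the longer side of J, so the
derivative is needed only for side ratios up to 2. The resulting error is a multiple of l², and l²
is at most |κ| times the area of J because the sides of J have ratio at most κ. -/
theorem HasIntervalDerivAt.mulPrim {F : C(EReal × EReal, ℝ)} {L : ℝ} {p : ℝ × ℝ}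
    (h : HasIntervalDerivAt F L p) (φ : Test) : HasIntervalDerivAt (mulPrim φ F) (L * φ p) p := by
  intro κ ε hε
  set M := ∫ q, |mixed φ q| with hM
  have hM0 : 0 ≤ M := integral_nonneg fun q => abs_nonneg _
  -- 144 = 4·9·4: four subcells from truncation, nine regular intervals for each, and area at most
  -- (2l)² = 4l² for each of these. The other half of ε pays for the oscillation of φ.
  set ε₂ := ε / (2 * (144 * |κ| * M + 1)) with hε₂
  have hε₂0 : 0 < ε₂ := by positivity
  obtain ⟨δ₂, hδ₂, hF⟩ := h 2 ε₂ hε₂0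
  have hφ : ∀ᶠ q in 𝓝 p, |L| * |φ q - φ p| < ε / 2 := by
    have hc : Continuous fun q => |L| * |φ q - φ p| :=
      continuous_const.mul (φ.continuous.sub continuous_const).abs
    have := hc.tendsto p
    rw [sub_self, abs_zero, mul_zero] at this
    exact this.eventually_lt_const (half_pos hε)
  obtain ⟨δ₁, hδ₁, hφ⟩ := Metric.eventually_nhds_iff.1 hφ
  -- The comparison intervals have sides up to 2l, which must stay below δ₂.
  refine ⟨min δ₁ (δ₂ / 2), by positivity, fun a b c d hab hcd hp hba hdc hr1 hr2 => ?_⟩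
  obtain ⟨⟨hpa, hpb⟩, hpc, hpd⟩ := hp
  have hb1 := hba.trans_le (min_le_left _ _)
  have hb2 := hba.trans_le (min_le_right _ _)
  have hd1 := hdc.trans_le (min_le_left _ _)
  have hd2 := hdc.trans_le (min_le_right _ _)
  set l := max (b - a) (d - c) with hl
  have hl0 : 0 < l := lt_max_of_lt_left (sub_pos.2 hab)
  have hl2 : l < δ₂ / 2 := max_lt hb2 hd2
  have hA0 : 0 < (b - a) * (d - c) := mul_pos (sub_pos.2 hab) (sub_pos.2 hcd)
  have hlA : l ^ 2 ≤ |κ| * ((b - a) * (d - c)) := by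
    have hκ := le_abs_self κ
    have h1 : 0 < b - a := sub_pos.2 hab
    have h2 : 0 < d - c := sub_pos.2 hcd
    rcases max_choice (b - a) (d - c) with h | h
    · rw [hl, h]
      nlinarith [mul_le_mul_of_nonneg_right hκ h2.le]
    · rw [hl, h]
      nlinarith [mul_le_mul_of_nonneg_right hκ h1.le]
  set hh : ℝ × ℝ → ℝ := (Icc a b ×ˢ Icc c d).indicator fun _ => ε / 2 with hhh
  have hms : MeasurableSet (Icc a b ×ˢ Icc c d : Set (ℝ × ℝ)) :=
    measurableSet_Icc.prod measurableSet_Icc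
  have hhi : Integrable hh := by
    refine (integrable_indicator_iff hms).2 (integrableOn_const ?_)
    rw [Measure.volume_eq_prod, Measure.prod_prod]
    exact ENNReal.mul_ne_top (by simp) (by simp)
  have hleb : incr (lebPrim hh) a b c d = ε / 2 * ((b - a) * (d - c)) := by
    rw [← setIntegral_Ico_eq hhi hab.le hcd.le, setIntegral_congr_fun (g := fun _ => ε / 2)
      (measurableSet_Ico.prod measurableSet_Ico) fun q hq => indicator_of_mem
        (show q ∈ Icc a b ×ˢ Icc c d from ⟨Ico_subset_Icc_self hq.1, Ico_subset_Icc_self hq.2⟩) _,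
      setIntegral_const, Measure.volume_eq_prod, measureReal_prod_prod,
      Real.volume_real_Ico_of_le hab.le, Real.volume_real_Ico_of_le hcd.le, smul_eq_mul]
    ring
  have hmain := abs_mul_area_sub_incr_mulPrim_le φ F hab.le hcd.le L (φ p) hhi (by
    intro q hq
    rw [hhh, indicator_of_mem hq]
    refine (hφ ?_).le
    rw [Prod.dist_eq, Real.dist_eq, Real.dist_eq, max_lt_iff, abs_lt, abs_lt]
    obtain ⟨⟨h1, h2⟩, h3, h4⟩ := hq
    refine ⟨⟨?_, ?_⟩, ?_, ?_⟩ <;> linarith)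
  rw [hleb] at hmain
  set J : Cell := ⟨a, b, c, d, emb p, EReal.coe_le_coe_iff.2 hab.le, EReal.coe_le_coe_iff.2 hcd.le,
    ⟨⟨EReal.coe_le_coe_iff.2 hpa, EReal.coe_le_coe_iff.2 hpb⟩, EReal.coe_le_coe_iff.2 hpc,
      EReal.coe_le_coe_iff.2 hpd⟩⟩ with hJ
  have hJfin : J.set ⊆ finitePlane := by
    rintro ⟨x, y⟩ ⟨hx, hy⟩
    refine ⟨(x.toReal, y.toReal), Prod.ext ?_ ?_⟩
    · exact EReal.coe_toReal (ne_top_of_le_ne_top (EReal.coe_ne_top b) hx.2)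
        (ne_bot_of_le_ne_bot (EReal.coe_ne_bot a) hx.1)
    · exact EReal.coe_toReal (ne_top_of_le_ne_top (EReal.coe_ne_top d) hy.2)
        (ne_bot_of_le_ne_bot (EReal.coe_ne_bot c) hy.1)
  have hint := sum_integral_truncate_le φ (ι := Unit) (P := fun _ => J)
    (Φ := fun _ z => L * areaFun z - F z) (C := 9 * (4 * ε₂ * l ^ 2)) (fun _ => by
      simp_rw [incr_lin]
      refine Continuous.sub ?_ (continuous_incr_truncate F _ _ _ _)
      simp_rw [hJ, incr_areaFun_truncate]
      fun_prop) (by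
    intro P' hP'
    simp only [Finset.univ_unique, Finset.sum_singleton]
    obtain ⟨ht, hs⟩ := hP' ()
    obtain ⟨a', b', c', d', h1, h2, h3, h4, h5, h6⟩ := Cell.exists_real (hs.trans hJfin)
    have hsub := (box_subset_box_iff (P' ()).hab (P' ()).hcd).1 hs
    have htag := (P' ()).tag_mem
    rw [ht] at htag
    simp only [h1, h2, h3, h4, hJ, EReal.coe_le_coe_iff] at hsub
    simp only [h1, h2, h3, h4, hJ, box, emb, mem_prod, mem_Icc, EReal.coe_le_coe_iff] at htag
    obtain ⟨⟨s1, s2⟩, s3, s4⟩ := hsub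
    obtain ⟨⟨t1, t2⟩, t3, t4⟩ := htag
    change |incr _ (P' ()).a (P' ()).b (P' ()).c (P' ()).d| ≤ _
    rw [h1, h2, h3, h4]
    refine abs_incr_le_of_regular hl0 ?_ t1 t2 t3 t4
      (by linarith [le_max_left (b - a) (d - c)]) (by linarith [le_max_right (b - a) (d - c)])
    intro x y z w g1 g2 g3 g4 g5 g6 g7 g8
    rw [incr_lin, incr_areaFun_coe, abs_sub_comm]
    refine (hF x y z w (by linarith) (by linarith) ⟨⟨g1, g2⟩, g3, g4⟩ (by linarith) (by linarith)
      (by linarith) (by linarith)).trans ?_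
    have : (y - x) * (w - z) ≤ (2 * l) * (2 * l) :=
      mul_le_mul g6 g8 (by linarith) (by linarith)
    nlinarith)
  simp only [Finset.univ_unique, Finset.sum_singleton, ← hM] at hint
  rw [abs_sub_comm]
  refine hmain.trans ?_
  have hfin : 4 * (9 * (4 * ε₂ * l ^ 2)) * M ≤ ε / 2 * ((b - a) * (d - c)) := by
    calc 4 * (9 * (4 * ε₂ * l ^ 2)) * M = 144 * ε₂ * M * l ^ 2 := by ring
      _ ≤ 144 * ε₂ * M * (|κ| * ((b - a) * (d - c))) := by gcongr
      _ = (144 * |κ| * M) * ε₂ * ((b - a) * (d - c)) := by ring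
      _ ≤ ε / 2 * ((b - a) * (d - c)) := by
        gcongr
        rw [hε₂, mul_div_assoc', div_le_div_iff₀ (by positivity) (by positivity)]
        nlinarith
  calc _ ≤ ε / 2 * ((b - a) * (d - c)) + ε / 2 * ((b - a) * (d - c)) := by
        gcongr
        exact le_trans (le_of_eq (by rfl)) (hint.trans hfin)
    _ = ε * ((b - a) * (d - c)) := by ring

theorem HasIntervalDerivAt.sub {F G : EReal × EReal → ℝ} {L : ℝ} {p : ℝ × ℝ}
    (hF : HasIntervalDerivAt F L p) (hG : HasIntervalDerivAt G L p) :
    HasIntervalDerivAt (fun z => F z - G z) 0 p := by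
  intro κ ε hε
  obtain ⟨δ, hδ, h⟩ := hF κ (ε / 2) (half_pos hε)
  obtain ⟨δ', hδ', h'⟩ := hG κ (ε / 2) (half_pos hε)
  refine ⟨min δ δ', lt_min hδ hδ', fun a b c d hab hcd hp hba hdc h1 h2 => ?_⟩
  have e := h a b c d hab hcd hp (hba.trans_le (min_le_left _ _)) (hdc.trans_le (min_le_left _ _)) h1 h2
  have e' := h' a b c d hab hcd hp (hba.trans_le (min_le_right _ _))
    (hdc.trans_le (min_le_right _ _)) h1 h2
  have e0 : incr (fun z => F z - G z) a b c d = incr F a b c d - incr G a b c d := by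
    simp only [incr]
    ring
  rw [e0]
  rw [abs_le] at e e' ⊢
  constructor <;> linarith [e.1, e.2, e'.1, e'.2]

/-! ### Null sets are negligible for generalised absolutely continuous functions -/

theorem emb_injective : Function.Injective emb := isOpenEmbedding_emb.injective

theorem emb_mem_Ioo_prod {a b c d : ℝ} {p : ℝ × ℝ} :
    emb p ∈ Ioo (a : EReal) b ×ˢ Ioo (c : EReal) d ↔ p ∈ Ioo a b ×ˢ Ioo c d := by
  simp [emb]

theorem IsPartial.sum_area_le {γ : EReal × EReal → Set (EReal × EReal)} {I : Set (EReal × EReal)}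
    {ι : Type} [Fintype ι] {P : ι → Cell} (h : IsPartial γ I P) {O : Set (ℝ × ℝ)}
    (hO : ∀ i, (P i).set ⊆ emb '' O) : ENNReal.ofReal (∑ i, (P i).area) ≤ volume O := by
  choose a b c d ha hb hc hd hab hcd using fun i =>
    Cell.exists_real ((hO i).trans (image_subset_range _ _))
  have harea : ∀ i, (P i).area = (b i - a i) * (d i - c i) := fun i => by
    simp only [Cell.area, ha, hb, hc, hd, EReal.toReal_coe]
  have hvol : ∀ i, volume (Ioo (a i) (b i) ×ˢ Ioo (c i) (d i) : Set (ℝ × ℝ)) =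
      ENNReal.ofReal ((P i).area) := fun i => by
    rw [Measure.volume_eq_prod, Measure.prod_prod, Real.volume_Ioo, Real.volume_Ioo, harea,
      ENNReal.ofReal_mul (sub_nonneg.2 (hab i))]
  have hin : ∀ i, ∀ p ∈ Ioo (a i) (b i) ×ˢ Ioo (c i) (d i), emb p ∈ (P i).inside := fun i p hp => by
    rw [Cell.inside, ha, hb, hc, hd]
    exact emb_mem_Ioo_prod.2 hp
  rw [ENNReal.ofReal_sum_of_nonneg fun i _ => by
    rw [harea]; exact mul_nonneg (sub_nonneg.2 (hab i)) (sub_nonneg.2 (hcd i))]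
  simp_rw [← hvol]
  rw [← measure_biUnion_finset]
  · refine measure_mono (iUnion₂_subset fun i _ p hp => ?_)
    obtain ⟨q, hq, hqp⟩ := hO i (prod_mono Ioo_subset_Icc_self Ioo_subset_Icc_self (hin i p hp))
    rwa [← emb_injective hqp]
  · intro i _ j _ hij
    exact Set.disjoint_left.2 fun p hpi hpj =>
      Set.disjoint_left.1 (h.2 hij) (hin i p hpi) (hin j p hpj)
  · exact fun i _ => measurableSet_Ioo.prod measurableSet_Ioo

/-- Each point of N in I gets an index n of a covering set containing it, and its gauge is confined
to an open set O n ⊇ N of measure less than the η belonging to ε/2^(n+1). The cells of index n then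
have total area below this η, and the contributions sum to at most ε. -/
theorem IsACG.exists_gauge_null {F : EReal × EReal → ℝ} {I : Set (EReal × EReal)} (h : IsACG F I)
    {N : Set (ℝ × ℝ)} (hN : volume N = 0) {ε : ℝ} (hε : 0 < ε) :
    ∃ γ, IsGauge γ ∧ ∀ (ι : Type) [Fintype ι] (P : ι → Cell), IsPartial γ I P →
      (∀ i, (P i).tag ∈ emb '' N) → ∑ i, |(P i).incr F| ≤ ε := by
  classical
  obtain ⟨⟨E, hE, hAC⟩, -⟩ := h
  have hidx : ∀ p, ∃ n, p ∈ I ∩ finitePlane → p ∈ E n := fun p => by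
    by_cases hp : p ∈ I ∩ finitePlane
    · obtain ⟨n, hn⟩ := mem_iUnion.1 (hE hp)
      exact ⟨n, fun _ => hn⟩
    · exact ⟨0, fun h => absurd h hp⟩
  choose m hm using hidx
  choose η hη γ hγ hP using fun n : ℕ => (hAC n).2.exists_gauge
    (show 0 < ε / 2 * (1 / 2) ^ n by positivity)
  have hopen : ∀ n, ∃ O ⊇ N, IsOpen O ∧ volume O < ENNReal.ofReal (η n) := fun n =>
    N.exists_isOpen_lt_of_lt _ (by rw [hN]; exact ENNReal.ofReal_pos.2 (hη n))
  choose O hNO hO hvol using hopen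
  set U : EReal × EReal → Set (EReal × EReal) := fun p =>
    if p ∈ emb '' N then emb '' O (m p) else univ with hU
  have hUg : IsGauge fun p => U p ∩ topGauge p := by
    refine IsGauge.of_open (fun p => ?_) fun p => ?_
    · simp only [hU]
      split_ifs
      · exact isOpenEmbedding_emb.isOpenMap _ (hO _)
      · exact isOpen_univ
    · simp only [hU]
      split_ifs with hp
      · exact image_mono (hNO _) hp
      · trivial
  refine ⟨fun p => γ (m p) p ∩ (U p ∩ topGauge p), fun p => ?_, fun ι _ P hpart htag => ?_⟩
  · exact ((hγ (m p)).inter hUg) p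
  have htagI : ∀ i, (P i).tag ∈ I ∩ finitePlane := fun i =>
    ⟨(hpart.1 i).1 (P i).tag_mem, image_subset_range _ _ (htag i)⟩
  have hfib : ∀ n, ∑ i with m (P i).tag = n, |(P i).incr F| ≤ ε / 2 * (1 / 2) ^ n := by
    intro n
    have hmem : ∀ i : {i // m (P i).tag = n}, γ (m (P i).tag) (P i).tag = γ n (P i).tag :=
      fun i => by rw [i.2]
    have hsub : IsPartial (γ n) I fun i : {i // m (P i).tag = n} => P i :=
      ⟨fun i => ⟨(hpart.1 i).1, ((hpart.1 i).2.trans inter_subset_left).trans (hmem i).subset⟩,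
        fun i j hij => hpart.2 fun e => hij (Subtype.ext e)⟩
    have := hP n _ _ hsub (fun i => by
      have := hm _ (htagI i)
      rwa [i.2] at this) (by
      refine (ENNReal.ofReal_lt_ofReal_iff (hη n)).1
        ((hsub.sum_area_le (O := O n) fun i => ?_).trans_lt (hvol n))
      refine ((hpart.1 i).2.trans (inter_subset_right.trans inter_subset_left)).trans ?_
      simp only [hU]
      rw [if_pos (htag i), i.2])
    rw [Finset.sum_subtype (p := fun i => m (P i).tag = n) _ (by simp)]
    exact this.le
  set K := (Finset.univ.sup fun i => m (P i).tag) + 1 with hK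
  rw [← Finset.sum_fiberwise_of_maps_to (t := Finset.range K) (g := fun i => m (P i).tag)
    fun i hi => Finset.mem_range.2 (Nat.lt_succ_of_le (Finset.le_sup (f := fun i => m (P i).tag) hi))]
  calc _ ≤ ∑ n ∈ Finset.range K, ε / 2 * (1 / 2) ^ n := Finset.sum_le_sum fun n _ => hfib n
    _ = ε / 2 * ∑ n ∈ Finset.range K, (1 / 2 : ℝ) ^ n := by rw [Finset.mul_sum]
    _ ≤ ε / 2 * 2 := by gcongr; exact sum_geometric_two_le K
    _ = ε := by ring

/-! ### Cousin's lemma with similar boxes -/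

/-- Halving both sides keeps the boxes similar to the first one. If P failed, it would fail on a
nested sequence of such quarters shrinking to a point, against the local hypothesis there.
Similarity is needed because the interval derivative controls only intervals of bounded side ratio.
-/
theorem cousin_bisection {P : ℝ → ℝ → ℝ → ℝ → Prop} {a₀ b₀ c₀ d₀ : ℝ} (hab : a₀ < b₀)
    (hcd : c₀ < d₀)
    (haddx : ∀ a m b c d, a < m → m < b → c < d → P a m c d → P m b c d → P a b c d)
    (haddy : ∀ a b c m d, a < b → c < m → m < d → P a b c m → P a b m d → P a b c d)
    (hloc : ∀ p ∈ Icc a₀ b₀ ×ˢ Icc c₀ d₀, ∃ δ > 0, ∀ a b c d, a < b → c < d →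
      p ∈ Icc a b ×ˢ Icc c d → b - a < δ → d - c < δ →
      (b - a) * (d₀ - c₀) = (d - c) * (b₀ - a₀) → P a b c d) :
    P a₀ b₀ c₀ d₀ := by
  by_contra hP
  have hstep : ∀ s : ℝ × ℝ × ℝ × ℝ, ∃ t : ℝ × ℝ × ℝ × ℝ,
      (s.1 < s.2.1 ∧ s.2.2.1 < s.2.2.2 ∧ ¬ P s.1 s.2.1 s.2.2.1 s.2.2.2) →
      (t.1 < t.2.1 ∧ t.2.2.1 < t.2.2.2 ∧ ¬ P t.1 t.2.1 t.2.2.1 t.2.2.2) ∧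
      s.1 ≤ t.1 ∧ t.2.1 ≤ s.2.1 ∧ s.2.2.1 ≤ t.2.2.1 ∧ t.2.2.2 ≤ s.2.2.2 ∧
      t.2.1 - t.1 = (s.2.1 - s.1) / 2 ∧ t.2.2.2 - t.2.2.1 = (s.2.2.2 - s.2.2.1) / 2 := by
    rintro ⟨a, b, c, d⟩
    by_cases h : a < b ∧ c < d ∧ ¬ P a b c d
    · obtain ⟨h1, h2, h3⟩ := h
      obtain ⟨a', b', ha, hb, hl, hP'⟩ : ∃ a' b', a ≤ a' ∧ b' ≤ b ∧ b' - a' = (b - a) / 2 ∧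
          ¬ P a' b' c d := by
        by_contra! hcon
        exact h3 (haddx a ((a + b) / 2) b c d (by linarith) (by linarith) h2
          (hcon _ _ le_rfl (by linarith) (by ring)) (hcon _ _ (by linarith) le_rfl (by ring)))
      obtain ⟨c', d', hc, hd, hl', hP''⟩ : ∃ c' d', c ≤ c' ∧ d' ≤ d ∧ d' - c' = (d - c) / 2 ∧
          ¬ P a' b' c' d' := by
        by_contra! hcon
        exact hP' (haddy a' b' c ((c + d) / 2) d (by linarith) (by linarith) (by linarith)
          (hcon _ _ le_rfl (by linarith) (by ring)) (hcon _ _ (by linarith) le_rfl (by ring)))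
      exact ⟨(a', b', c', d'), fun _ => ⟨⟨by dsimp only; linarith, by dsimp only; linarith, hP''⟩,
        ha, hb, hc, hd, hl, hl'⟩⟩
    · exact ⟨0, fun h' => absurd h' h⟩
  choose next hnext using hstep
  set s : ℕ → ℝ × ℝ × ℝ × ℝ := fun n => next^[n] (a₀, b₀, c₀, d₀) with hs
  have hsucc : ∀ n, s (n + 1) = next (s n) := fun n => Function.iterate_succ_apply' _ _ _
  have hgood : ∀ n, (s n).1 < (s n).2.1 ∧ (s n).2.2.1 < (s n).2.2.2 ∧
      ¬ P (s n).1 (s n).2.1 (s n).2.2.1 (s n).2.2.2 := by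
    intro n
    induction n with
    | zero => exact ⟨hab, hcd, hP⟩
    | succ n ih =>
      rw [hsucc]
      exact (hnext _ ih).1
  have hlen : ∀ n, (s n).2.1 - (s n).1 = (b₀ - a₀) * (1 / 2) ^ n ∧
      (s n).2.2.2 - (s n).2.2.1 = (d₀ - c₀) * (1 / 2) ^ n := by
    intro n
    induction n with
    | zero => simp [hs]
    | succ n ih =>
      obtain ⟨-, -, -, -, -, h1, h2⟩ := hnext _ (hgood n)
      rw [hsucc, h1, h2, ih.1, ih.2]
      constructor <;> ring
  have hm1 : Monotone fun n => (s n).1 := monotone_nat_of_le_succ fun n => by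
    rw [hsucc]; exact (hnext _ (hgood n)).2.1
  have hm2 : Antitone fun n => (s n).2.1 := antitone_nat_of_succ_le fun n => by
    rw [hsucc]; exact (hnext _ (hgood n)).2.2.1
  have hm3 : Monotone fun n => (s n).2.2.1 := monotone_nat_of_le_succ fun n => by
    rw [hsucc]; exact (hnext _ (hgood n)).2.2.2.1
  have hm4 : Antitone fun n => (s n).2.2.2 := antitone_nat_of_succ_le fun n => by
    rw [hsucc]; exact (hnext _ (hgood n)).2.2.2.2.1
  have hx := mem_iInter.1 (hm1.ciSup_mem_iInter_Icc_of_antitone hm2 fun n => (hgood n).1.le)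
  have hy := mem_iInter.1 (hm3.ciSup_mem_iInter_Icc_of_antitone hm4 fun n => (hgood n).2.1.le)
  obtain ⟨δ, hδ, h⟩ := hloc (_, _) ⟨hx 0, hy 0⟩
  have hlim : ∀ L : ℝ, ∀ᶠ n : ℕ in atTop, L * (1 / 2) ^ n < δ := fun L => by
    have := (tendsto_pow_atTop_nhds_zero_of_lt_one (r := (1 / 2 : ℝ)) (by norm_num)
      (by norm_num)).const_mul L
    rw [mul_zero] at this
    exact this.eventually_lt_const hδ
  obtain ⟨n, h1, h2⟩ := ((hlim (b₀ - a₀)).and (hlim (d₀ - c₀))).exists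
  refine (hgood n).2.2 (h _ _ _ _ (hgood n).1 (hgood n).2.1 ⟨hx n, hy n⟩ ?_ ?_ ?_)
  · rwa [(hlen n).1]
  · rwa [(hlen n).2]
  · rw [(hlen n).1, (hlen n).2]
    ring

/-! ### Uniqueness of the Denjoy integral -/

/-- The box is divided into fine similar cells, each either tagged in N or with increment at most ε
times its area. The former contribute at most ε in total by negligibility of N, the latter at most ε
times the area of the box. -/
theorem incr_eq_zero_of_hasIntervalDerivAt_zero {D : EReal × EReal → ℝ} {a₀ b₀ c₀ d₀ : ℝ}
    (hab : a₀ < b₀) (hcd : c₀ < d₀) {N : Set (ℝ × ℝ)}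
    (hN : ∀ ε > 0, ∃ γ, IsGauge γ ∧ ∀ (ι : Type) [Fintype ι] (P : ι → Cell),
      IsPartial γ (box a₀ b₀ c₀ d₀) P → (∀ i, (P i).tag ∈ emb '' N) → ∑ i, |(P i).incr D| ≤ ε)
    (hD : ∀ p ∈ Icc a₀ b₀ ×ˢ Icc c₀ d₀, p ∉ N → HasIntervalDerivAt D 0 p) :
    incr D a₀ b₀ c₀ d₀ = 0 := by
  classical
  have hA : 0 < (b₀ - a₀) * (d₀ - c₀) := mul_pos (sub_pos.2 hab) (sub_pos.2 hcd)
  have key : ∀ ε > 0, |incr D a₀ b₀ c₀ d₀| ≤ ε + ε * ((b₀ - a₀) * (d₀ - c₀)) := by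
    intro ε hε
    obtain ⟨γ, hγ, hNP⟩ := hN ε hε
    have hcousin : ∃ (κ : Type) (_ : Fintype κ) (Q : κ → Cell),
        IsPartial γ (box a₀ b₀ c₀ d₀) Q ∧
        (∀ k, 0 ≤ (Q k).area ∧ ((Q k).tag ∈ emb '' N ∨ |(Q k).incr D| ≤ ε * (Q k).area)) ∧
        ∑ k, (Q k).incr D = incr D a₀ b₀ c₀ d₀ ∧
        ∑ k, (Q k).area = (b₀ - a₀) * (d₀ - c₀) := by
      refine cousin_bisection (P := fun a b c d => ∃ (κ : Type) (_ : Fintype κ) (Q : κ → Cell),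
        IsPartial γ (box a b c d) Q ∧
        (∀ k, 0 ≤ (Q k).area ∧ ((Q k).tag ∈ emb '' N ∨ |(Q k).incr D| ≤ ε * (Q k).area)) ∧
        ∑ k, (Q k).incr D = incr D a b c d ∧ ∑ k, (Q k).area = (b - a) * (d - c)) hab hcd ?_ ?_ ?_
      · rintro a m b c d ham hmb hcd ⟨κ, _, Q, hQ, ht, hi, hr⟩ ⟨κ', _, Q', hQ', ht', hi', hr'⟩
        have h1 : box a m c d ⊆ box a b c d :=
          prod_mono (Icc_subset_Icc_right (EReal.coe_le_coe_iff.2 hmb.le)) subset_rfl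
        have h2 : box m b c d ⊆ box a b c d :=
          prod_mono (Icc_subset_Icc_left (EReal.coe_le_coe_iff.2 ham.le)) subset_rfl
        refine ⟨κ ⊕ κ', inferInstance, Sum.elim Q Q', ?_, ?_, ?_, ?_⟩
        · exact (hQ.mono h1 fun _ => subset_rfl).sumElim (hQ'.mono h2 fun _ => subset_rfl)
            fun i k => disjoint_inside_of_split (hQ.1 i).1 (hQ'.1 k).1 (Or.inl le_rfl)
        · rintro (k | k)
          exacts [ht k, ht' k]
        · simp only [Fintype.sum_sum_type, Sum.elim_inl, Sum.elim_inr, hi, hi', incr]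
          ring
        · simp only [Fintype.sum_sum_type, Sum.elim_inl, Sum.elim_inr, hr, hr']
          ring
      · rintro a b c m d hab hcm hmd ⟨κ, _, Q, hQ, ht, hi, hr⟩ ⟨κ', _, Q', hQ', ht', hi', hr'⟩
        have h1 : box a b c m ⊆ box a b c d :=
          prod_mono subset_rfl (Icc_subset_Icc_right (EReal.coe_le_coe_iff.2 hmd.le))
        have h2 : box a b m d ⊆ box a b c d :=
          prod_mono subset_rfl (Icc_subset_Icc_left (EReal.coe_le_coe_iff.2 hcm.le))
        refine ⟨κ ⊕ κ', inferInstance, Sum.elim Q Q', ?_, ?_, ?_, ?_⟩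
        · exact (hQ.mono h1 fun _ => subset_rfl).sumElim (hQ'.mono h2 fun _ => subset_rfl)
            fun i k => disjoint_inside_of_split (hQ.1 i).1 (hQ'.1 k).1 (Or.inr le_rfl)
        · rintro (k | k)
          exacts [ht k, ht' k]
        · simp only [Fintype.sum_sum_type, Sum.elim_inl, Sum.elim_inr, hi, hi', incr]
          ring
        · simp only [Fintype.sum_sum_type, Sum.elim_inl, Sum.elim_inr, hr, hr']
          ring
      · intro p hp
        obtain ⟨δ, hδ, hball⟩ := Metric.isOpen_iff.1
          ((hγ (emb p)).1.preimage isOpenEmbedding_emb.continuous) p (hγ (emb p)).2.1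
        have hfine : ∀ a b c d : ℝ, p ∈ Icc a b ×ˢ Icc c d → b - a < δ → d - c < δ →
            box a b c d ⊆ γ (emb p) := by
          rintro a b c d ⟨⟨hp1, hp2⟩, hp3, hp4⟩ hba hdc ⟨x, y⟩ ⟨⟨hx1, hx2⟩, hy1, hy2⟩
          dsimp only at hx1 hx2 hy1 hy2
          lift x to ℝ using ⟨ne_top_of_le_ne_top (EReal.coe_ne_top b) hx2,
            ne_bot_of_le_ne_bot (EReal.coe_ne_bot a) hx1⟩
          lift y to ℝ using ⟨ne_top_of_le_ne_top (EReal.coe_ne_top d) hy2,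
            ne_bot_of_le_ne_bot (EReal.coe_ne_bot c) hy1⟩
          rw [EReal.coe_le_coe_iff] at hx1 hx2 hy1 hy2
          refine hball (a := (x, y)) ?_
          rw [Metric.mem_ball, Prod.dist_eq, Real.dist_eq, Real.dist_eq, max_lt_iff, abs_lt, abs_lt]
          refine ⟨⟨?_, ?_⟩, ?_, ?_⟩ <;> dsimp only <;> linarith
        have hsingle : ∀ a b c d : ℝ, a < b → c < d → p ∈ Icc a b ×ˢ Icc c d →
            b - a < δ → d - c < δ →
            (p ∈ N ∨ |incr D a b c d| ≤ ε * ((b - a) * (d - c))) →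
            ∃ (κ : Type) (_ : Fintype κ) (Q : κ → Cell), IsPartial γ (box a b c d) Q ∧
            (∀ k, 0 ≤ (Q k).area ∧ ((Q k).tag ∈ emb '' N ∨ |(Q k).incr D| ≤ ε * (Q k).area)) ∧
            ∑ k, (Q k).incr D = incr D a b c d ∧ ∑ k, (Q k).area = (b - a) * (d - c) := by
          intro a b c d hab hcd hp hba hdc hor
          refine ⟨Unit, inferInstance, fun _ => ⟨a, b, c, d, emb p, EReal.coe_le_coe_iff.2 hab.le,
            EReal.coe_le_coe_iff.2 hcd.le,
            ⟨⟨EReal.coe_le_coe_iff.2 hp.1.1, EReal.coe_le_coe_iff.2 hp.1.2⟩,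
              EReal.coe_le_coe_iff.2 hp.2.1, EReal.coe_le_coe_iff.2 hp.2.2⟩⟩,
            ⟨fun _ => ⟨subset_rfl, hfine a b c d hp hba hdc⟩, fun i j hij => absurd rfl hij⟩,
            fun _ => ⟨mul_nonneg ?_ ?_, hor.imp (mem_image_of_mem _) fun h => ?_⟩, ?_, ?_⟩
          · simpa using hab.le
          · simpa using hcd.le
          · simpa [Cell.area, Cell.incr] using h
          · simp [Cell.incr]
          · simp [Cell.area]
        by_cases hpN : p ∈ N
        · exact ⟨δ, hδ, fun a b c d hab hcd hp hba hdc _ =>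
            hsingle a b c d hab hcd hp hba hdc (Or.inl hpN)⟩
        -- Boxes similar to the initial one have exactly its side ratio, so this single κ suffices
        -- for the derivative.
        · set κ := max ((b₀ - a₀) / (d₀ - c₀)) ((d₀ - c₀) / (b₀ - a₀)) with hκ
          obtain ⟨δ', hδ', hder⟩ := hD p hp hpN κ ε hε
          refine ⟨min δ δ', lt_min hδ hδ', fun a b c d h1 h2 hp hba hdc hsim =>
            hsingle a b c d h1 h2 hp (hba.trans_le (min_le_left _ _))
              (hdc.trans_le (min_le_left _ _)) (Or.inr ?_)⟩
          have := hder a b c d h1 h2 hp (hba.trans_le (min_le_right _ _))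
            (hdc.trans_le (min_le_right _ _)) ?_ ?_
          · simpa using this
          · have : b - a = (b₀ - a₀) / (d₀ - c₀) * (d - c) := by
              rw [div_mul_eq_mul_div, eq_div_iff (sub_pos.2 hcd).ne', hsim]
              ring
            rw [this]
            exact mul_le_mul_of_nonneg_right (le_max_left _ _) (sub_pos.2 h2).le
          · have : d - c = (d₀ - c₀) / (b₀ - a₀) * (b - a) := by
              rw [div_mul_eq_mul_div, eq_div_iff (sub_pos.2 hab).ne', ← hsim]
              ring
            rw [this]
            exact mul_le_mul_of_nonneg_right (le_max_right _ _) (sub_pos.2 h1).le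
    obtain ⟨κ, _, Q, hQ, htag, hincr, harea⟩ := hcousin
    rw [← hincr, ← harea]
    calc |∑ k, (Q k).incr D| ≤ ∑ k, |(Q k).incr D| := Finset.abs_sum_le_sum_abs _ _
      _ ≤ ∑ k, ((if (Q k).tag ∈ emb '' N then |(Q k).incr D| else 0) + ε * (Q k).area) := by
        refine Finset.sum_le_sum fun k _ => ?_
        obtain ⟨h1, h2⟩ := htag k
        split_ifs with h
        · exact le_add_of_nonneg_right (mul_nonneg hε.le h1)
        · rw [zero_add]
          exact h2.resolve_left h
      _ = ∑ k : {k // (Q k).tag ∈ emb '' N}, |(Q k).incr D| + ε * ∑ k, (Q k).area := by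
        rw [Finset.sum_add_distrib, ← Finset.mul_sum, ← Finset.sum_filter,
          Finset.sum_subtype (p := fun k => (Q k).tag ∈ emb '' N) _ (by simp)]
      _ ≤ _ := by
        gcongr
        exact hNP _ _ (hQ.comp Subtype.val_injective) fun k => k.2
  refine abs_eq_zero.1 (le_antisymm (le_of_forall_pos_le_add fun ε hε => ?_) (abs_nonneg _))
  refine (key (ε / (1 + (b₀ - a₀) * (d₀ - c₀))) (by positivity)).trans_eq ?_
  field_simp
  ring

/-- The derivative is known only at real points of the open box. Letting the four coordinates tend
to the endpoints from inside, continuity on the closed box reaches its boundary, including the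
points at infinity. -/
theorem incr_eq_zero_of_forall_Ioo {D : EReal × EReal → ℝ} {a b c d : EReal} (hab : a < b)
    (hcd : c < d) (hD : ContinuousOn D (box a b c d))
    (h : ∀ x y z w : ℝ, x < y → z < w → (x : EReal) ∈ Ioo a b → (y : EReal) ∈ Ioo a b →
      (z : EReal) ∈ Ioo c d → (w : EReal) ∈ Ioo c d → incr D x y z w = 0) :
    incr D a b c d = 0 := by
  have hfst : ∀ x y z w : ℝ, z < w → (x : EReal) ∈ Ioo a b → (y : EReal) ∈ Ioo a b →
      (z : EReal) ∈ Ioo c d → (w : EReal) ∈ Ioo c d → incr D x y z w = 0 := by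
    intro x y z w hzw hx hy hz hw
    rcases lt_trichotomy x y with hlt | rfl | hlt
    · exact h x y z w hlt hzw hx hy hz hw
    · simp only [incr]; ring
    · have := h y x z w hlt hzw hy hx hz hw
      simp only [incr] at this ⊢
      linarith
  have hall : ∀ x ∈ Ioo a b, ∀ y ∈ Ioo a b, ∀ z ∈ Ioo c d, ∀ w ∈ Ioo c d, incr D x y z w = 0 := by
    intro x hx y hy z hz w hw
    lift x to ℝ using ⟨hx.2.ne_top, hx.1.ne_bot⟩
    lift y to ℝ using ⟨hy.2.ne_top, hy.1.ne_bot⟩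
    lift z to ℝ using ⟨hz.2.ne_top, hz.1.ne_bot⟩
    lift w to ℝ using ⟨hw.2.ne_top, hw.1.ne_bot⟩
    rcases lt_trichotomy z w with hlt | rfl | hlt
    · exact hfst x y z w hlt hx hy hz hw
    · simp only [incr]; ring
    · have := hfst x y w z hlt hx hy hw hz
      simp only [incr] at this ⊢
      linarith
  have hlim : ∀ x ∈ Icc a b, ∀ y ∈ Icc c d,
      Tendsto D (𝓝[Ioo a b] x ×ˢ 𝓝[Ioo c d] y) (𝓝 (D (x, y))) := fun x hx y hy => by
    rw [← nhdsWithin_prod_eq]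
    exact (hD (x, y) ⟨hx, hy⟩).mono (prod_mono Ioo_subset_Icc_self Ioo_subset_Icc_self)
  have ha := left_mem_Icc.2 hab.le
  have hb := right_mem_Icc.2 hab.le
  have hc := left_mem_Icc.2 hcd.le
  have hd := right_mem_Icc.2 hcd.le
  have : (𝓝[Ioo a b] a).NeBot := left_nhdsWithin_Ioo_neBot hab
  have : (𝓝[Ioo a b] b).NeBot := right_nhdsWithin_Ioo_neBot hab
  have : (𝓝[Ioo c d] c).NeBot := left_nhdsWithin_Ioo_neBot hcd
  have : (𝓝[Ioo c d] d).NeBot := right_nhdsWithin_Ioo_neBot hcd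
  set l := (𝓝[Ioo a b] a ×ˢ 𝓝[Ioo a b] b) ×ˢ (𝓝[Ioo c d] c ×ˢ 𝓝[Ioo c d] d) with hl
  have t1 : Tendsto (fun q : (EReal × EReal) × EReal × EReal => q.1.1) l (𝓝[Ioo a b] a) :=
    tendsto_fst.comp tendsto_fst
  have t2 : Tendsto (fun q : (EReal × EReal) × EReal × EReal => q.1.2) l (𝓝[Ioo a b] b) :=
    tendsto_snd.comp tendsto_fst
  have t3 : Tendsto (fun q : (EReal × EReal) × EReal × EReal => q.2.1) l (𝓝[Ioo c d] c) :=
    tendsto_fst.comp tendsto_snd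
  have t4 : Tendsto (fun q : (EReal × EReal) × EReal × EReal => q.2.2) l (𝓝[Ioo c d] d) :=
    tendsto_snd.comp tendsto_snd
  have hT : Tendsto (fun q : (EReal × EReal) × EReal × EReal => incr D q.1.1 q.1.2 q.2.1 q.2.2) l
      (𝓝 (incr D a b c d)) :=
    ((((hlim a ha c hc).comp (t1.prodMk t3)).add ((hlim b hb d hd).comp (t2.prodMk t4))).sub
      ((hlim a ha d hd).comp (t1.prodMk t4))).sub ((hlim b hb c hc).comp (t2.prodMk t3))
  refine tendsto_nhds_unique hT (tendsto_const_nhds.congr' ?_)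
  filter_upwards [t1.eventually self_mem_nhdsWithin, t2.eventually self_mem_nhdsWithin,
    t3.eventually self_mem_nhdsWithin, t4.eventually self_mem_nhdsWithin] with q h1 h2 h3 h4
  exact (hall _ h1 _ h2 _ h3 _ h4).symm

/-- The difference F - G has derivative 0 off a null set that is negligible for F and for G, hence
for F - G. Its increments over real boxes inside the open box therefore vanish, and continuity gives
the whole box. Degenerate boxes have increment 0 trivially. -/
theorem IsDenjoyPrimitive.incr_unique {f : ℝ × ℝ → ℝ} {a b c d : EReal} (hab : a ≤ b) (hcd : c ≤ d)
    {F G : EReal × EReal → ℝ} (hF : IsDenjoyPrimitive f a b c d F)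
    (hG : IsDenjoyPrimitive f a b c d G) : incr F a b c d = incr G a b c d := by
  rcases hab.eq_or_lt with rfl | hab
  · simp only [incr]; ring
  rcases hcd.eq_or_lt with rfl | hcd
  · simp only [incr]; ring
  have hsub : ∀ x y z w : EReal,
      incr (fun q => F q - G q) x y z w = incr F x y z w - incr G x y z w := fun x y z w => by
    simp only [incr]; ring
  have hFG := hF.2.2.and hG.2.2
  set N : Set (ℝ × ℝ) := {p | ¬ ((emb p ∈ Ioo a b ×ˢ Ioo c d → HasIntervalDerivAt F (f p) p) ∧
    (emb p ∈ Ioo a b ×ˢ Ioo c d → HasIntervalDerivAt G (f p) p))} with hN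
  have hN0 : volume N = 0 := ae_iff.1 hFG
  rw [← sub_eq_zero, ← hsub]
  refine incr_eq_zero_of_forall_Ioo hab hcd (hF.1.sub hG.1) fun x y z w hxy hzw hx hy hz hw => ?_
  have hbox : box x y z w ⊆ box a b c d :=
    prod_mono (Icc_subset_Icc hx.1.le hy.2.le) (Icc_subset_Icc hz.1.le hw.2.le)
  refine incr_eq_zero_of_hasIntervalDerivAt_zero hxy hzw (N := N) (fun ε hε => ?_)
    fun p hp hpN => ?_
  · obtain ⟨γ, hγ, hP⟩ := hF.2.1.exists_gauge_null hN0 (half_pos hε)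
    obtain ⟨γ', hγ', hP'⟩ := hG.2.1.exists_gauge_null hN0 (half_pos hε)
    refine ⟨_, hγ.inter hγ', fun ι _ P hpart htag => ?_⟩
    calc ∑ i, |(P i).incr fun q => F q - G q| ≤ ∑ i, (|(P i).incr F| + |(P i).incr G|) :=
          Finset.sum_le_sum fun i _ => by
            rw [Cell.incr, hsub]
            exact abs_sub _ _
      _ = ∑ i, |(P i).incr F| + ∑ i, |(P i).incr G| := Finset.sum_add_distrib
      _ ≤ ε / 2 + ε / 2 := add_le_add
          (hP ι P (hpart.mono hbox fun _ => inter_subset_left) htag)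
          (hP' ι P (hpart.mono hbox fun _ => inter_subset_right) htag)
      _ = ε := add_halves ε
  · have hin : emb p ∈ Ioo a b ×ˢ Ioo c d :=
      ⟨⟨hx.1.trans_le (EReal.coe_le_coe_iff.2 hp.1.1), (EReal.coe_le_coe_iff.2 hp.1.2).trans_lt hy.2⟩,
        hz.1.trans_le (EReal.coe_le_coe_iff.2 hp.2.1), (EReal.coe_le_coe_iff.2 hp.2.2).trans_lt hw.2⟩
    have := not_not.1 hpN
    exact (this.1 hin).sub (this.2 hin)

/-! ### The primitive of a Denjoy integrable function -/

theorem HasIntervalDerivAt.congr {F G : EReal × EReal → ℝ} {L : ℝ} {p : ℝ × ℝ}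
    (h : HasIntervalDerivAt F L p) (hG : ∀ a b c d, incr G a b c d = incr F a b c d) :
    HasIntervalDerivAt G L p := by
  simpa only [HasIntervalDerivAt, hG] using h

theorem IsDenjoyPrimitive.restrict {f : ℝ × ℝ → ℝ} {F : EReal × EReal → ℝ}
    (h : IsDenjoyPrimitive f ⊥ ⊤ ⊥ ⊤ F) (a b c d : EReal) : IsDenjoyPrimitive f a b c d F := by
  have hsub : box a b c d ⊆ box ⊥ ⊤ ⊥ ⊤ := by rw [box_univ]; exact subset_univ _
  refine ⟨h.1.mono hsub, h.2.1.mono hsub, ?_⟩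
  filter_upwards [h.2.2] with p hp hin
  exact hp ⟨⟨bot_le.trans_lt hin.1.1, hin.1.2.trans_le le_top⟩,
    bot_le.trans_lt hin.2.1, hin.2.2.trans_le le_top⟩

/-- Apart from continuity, the conditions on a Denjoy primitive see only increments, and these are
unchanged by the normalisation z ↦ increment of F over the quadrant below z, which vanishes at -∞.
-/
theorem IsDenjoyPrimitive.exists_mem_Bc {f : ℝ × ℝ → ℝ} {F : EReal × EReal → ℝ}
    (h : IsDenjoyPrimitive f ⊥ ⊤ ⊥ ⊤ F) : ∃ G ∈ Bc, IsDenjoyPrimitive f ⊥ ⊤ ⊥ ⊤ G := by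
  have hc : Continuous F := by
    have := h.1
    rwa [box_univ, continuousOn_univ] at this
  have hG : Continuous fun z : EReal × EReal => incr F ⊥ z.1 ⊥ z.2 := by
    unfold incr
    fun_prop
  have hincr : ∀ a b c d, incr (fun z : EReal × EReal => incr F ⊥ z.1 ⊥ z.2) a b c d =
      incr F a b c d := fun a b c d => by
    simp only [incr]; ring
  refine ⟨⟨_, hG⟩, fun s => ⟨?_, ?_⟩, hG.continuousOn, h.2.1.congr fun J => hincr _ _ _ _, ?_⟩
  · simp only [ContinuousMap.coe_mk, incr]; ring
  · simp only [ContinuousMap.coe_mk, incr]; ring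
  · filter_upwards [h.2.2] with p hp hin
    exact (hp hin).congr hincr

theorem IsDenjoyPrimitive.mul_test {f : ℝ × ℝ → ℝ} {F : C(EReal × EReal, ℝ)} {a b c d : EReal}
    (h : IsDenjoyPrimitive f a b c d F) (φ : Test) :
    IsDenjoyPrimitive (fun p => f p * φ p) a b c d (mulPrim φ F) := by
  refine ⟨(continuous_mulPrim φ F).continuousOn, h.2.1.mulPrim φ, ?_⟩
  filter_upwards [h.2.2] with p hp hin
  exact (hp hin).mulPrim φ

theorem IsDenjoyPrimitive.hasDenjoyIntegral_iff {f : ℝ × ℝ → ℝ} {a b c d : EReal} (hab : a ≤ b)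
    (hcd : c ≤ d) {F : EReal × EReal → ℝ} (hF : IsDenjoyPrimitive f a b c d F) (A : ℝ) :
    HasDenjoyIntegral f a b c d A ↔ A = incr F a b c d :=
  ⟨fun ⟨_, hG, hA⟩ => hA ▸ hG.incr_unique hab hcd hF, fun h => ⟨F, hF, h.symm⟩⟩

/-- Denjoy integrable functions are integrable distributions, with the same integrals. -/
theorem denjoy_cpi {f : ℝ × ℝ → ℝ} (hf : ∃ A, HasDenjoyIntegral f ⊥ ⊤ ⊥ ⊤ A) :
    ∃ T ∈ Ac, (∀ φ : Test, ∀ A, HasDenjoyIntegral (fun p => f p * φ p) ⊥ ⊤ ⊥ ⊤ A ↔ A = T φ) ∧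
      ∀ a b c d : EReal, a ≤ b → c ≤ d →
        ∀ A, HasDenjoyIntegral f a b c d A ↔ A = cpi T a b c d := by
  obtain ⟨-, F, hF, -⟩ := hf
  obtain ⟨G, hG, hGf⟩ := hF.exists_mem_Bc
  refine ⟨d12 G, ⟨G, hG, rfl⟩, fun φ A => ?_, fun a b c d hab hcd A => ?_⟩
  · rw [(hGf.mul_test φ).hasDenjoyIntegral_iff bot_le bot_le, incr_mulPrim_univ φ hG]
  · rw [(hGf.restrict a b c d).hasDenjoyIntegral_iff hab hcd, cpi_d12 hG]

end CPI

end

/-! ### The assembled theorem -/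

theorem proposition4p4 :
    -- (a) step functions are dense in `Bc`
    (∀ F ∈ CPI.Bc, ∀ ε > 0, ∃ σ : EReal × EReal → ℝ, CPI.IsStep σ ∧ ∀ p, |F p - σ p| < ε) ∧
    -- (b) `Bc` and `Ac` are separable
    TopologicalSpace.SeparableSpace CPI.Bc ∧
    (∃ S : Set CPI.Dist, S.Countable ∧ S ⊆ CPI.Ac ∧ CPI.DenseInAc S) ∧
    -- (c) real analytic functions (Poisson smoothings of step functions) are dense in `Bc`
    Dense {U : CPI.Bc | AnalyticOnNhd ℝ (fun p => U.1 (CPI.emb p)) Set.univ ∧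
      CPI.IsPoissonSmoothing U.1} ∧
    -- and real analytic functions (their derivatives `∂₁₂`) are dense in `Ac`
    CPI.DenseInAc {T | ∃ U ∈ CPI.Bc, CPI.IsPoissonSmoothing U ∧ T = CPI.d12 U ∧
      ∃ g : ℝ × ℝ → ℝ, AnalyticOnNhd ℝ g Set.univ ∧ T = CPI.toDist g} ∧
    -- (d) Lebesgue integrable functions
    (∀ f : ℝ × ℝ → ℝ, MeasureTheory.Integrable f →
      ∃ T ∈ CPI.Ac, (∀ φ : CPI.Test, T φ = ∫ p, f p * φ p) ∧
        ∀ a b c d : EReal, a ≤ b → c ≤ d →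
          ∫ p in CPI.emb ⁻¹' CPI.box a b c d, f p = CPI.cpi T a b c d) ∧
    -- Henstock–Kurzweil integrable functions
    (∀ f : ℝ × ℝ → ℝ, (∃ A, CPI.HasHKIntegral f ⊥ ⊤ ⊥ ⊤ A) →
      ∃ T ∈ CPI.Ac,
        (∀ φ : CPI.Test, ∀ A, CPI.HasHKIntegral (fun p => f p * φ p) ⊥ ⊤ ⊥ ⊤ A ↔ A = T φ) ∧
        ∀ a b c d : EReal, a ≤ b → c ≤ d →
          ∀ A, CPI.HasHKIntegral f a b c d A ↔ A = CPI.cpi T a b c d) ∧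
    -- Denjoy integrable functions
    (∀ f : ℝ × ℝ → ℝ, (∃ A, CPI.HasDenjoyIntegral f ⊥ ⊤ ⊥ ⊤ A) →
      ∃ T ∈ CPI.Ac,
        (∀ φ : CPI.Test, ∀ A, CPI.HasDenjoyIntegral (fun p => f p * φ p) ⊥ ⊤ ⊥ ⊤ A ↔ A = T φ) ∧
        ∀ a b c d : EReal, a ≤ b → c ≤ d →
          ∀ A, CPI.HasDenjoyIntegral f a b c d A ↔ A = CPI.cpi T a b c d) := by
  have := CPI.secondCountable_Bc
  exact ⟨fun F hF ε hε => CPI.exists_isStep_near hF hε, inferInstance, CPI.exists_countable_denseInAc,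
    CPI.dense_smoothings.mono fun U hU => ⟨hU.1, hU.2.1⟩, CPI.denseInAc_smoothings,
    fun f hf => CPI.lebesgue_cpi hf, fun f hf => CPI.hk_cpi hf, fun f hf => CPI.denjoy_cpi hf⟩
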